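/- Let $\mathbb S^2\subset\mathbb R^3$ be the unit sphere with area measure $\sigma$, let $\mu=\sigma/(4\pi)$ be the uniform probability measure, and let $d(x,y)\in[0,\pi]$ be the spherical distance. For non-antipodal $x,y$ let $[xy]$ be the shorter geodesic segment joining $x$ to $y$. Say that $[x_1x_2]$ crosses $[x_3x_4]$ if neither $x_1,x_2$ nor $x_3,x_4$ are antipodal and the two segments meet in exactly one point, which is an endpoint of neither. For a measurable symmetric function $w:\mathbb S^2\times\mathbb S^2\to[0,1]$ put $$e(w)=\int_{\mathbb S^2}\int_{\mathbb S^2}w(x,y)\,\mu(\mathrm dx)\,\mu(\mathrm dy),$$ $$\operatorname{Cr}(w)=\int_{(\mathbb S^2)^4}w(x_1,x_2)\,w(x_3,x_4)\,\mathbf 1_{\{[x_1x_2]\text{ crosses }[x_3x_4]\}}\prod_{i=1}^4\mu(\mathrm dx_i).$$ **Theorem.** For every measurable symmetric $w:\mathbb S^2\times\mathbb S^2\to[0,1]$, $$\operatorname{Cr}(w)\ \ge\ \frac{(\sin t-t\cos t)^2}{8\pi^2},$$ where $t\in[0,\pi]$ is determined by $\cos t=1-2e(w)$. Equality is attained by threshold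 kernels: for every $t\in[0,\pi]$, the function $w(x,y)=\mathbf 1_{\{d(x,y)\le t\}}$ is measurable and symmetric, satisfies $\cos t=1-2e(w)$, and has $\operatorname{Cr}(w)=(\sin t-t\cos t)^2/(8\pi^2)$. -/

import Mathlib

open MeasureTheory Set

noncomputable section

namespace SphericalCrossing

/-- The unit sphere `𝕊²` in Euclidean space `ℝ³`. -/
abbrev S2 : Type := Metric.sphere (0 : EuclideanSpace ℝ (Fin 3)) 1

/-- The area measure `σ` on `𝕊²`, of total mass `4π`. -/
def area : Measure S2 := (volume : Measure (EuclideanSpace ℝ (Fin 3))).toSphere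

/-- The uniform probability measure `μ = σ / (4π)` on `𝕊²`. -/
def unif : Measure S2 := (ENNReal.ofReal (4 * Real.pi))⁻¹ • area

theorem area_univ : area univ = ENNReal.ofReal (4 * Real.pi) := by
  rw [area, Measure.toSphere_apply_univ, EuclideanSpace.volume_ball_fin_three]
  rw [finrank_euclideanSpace_fin, ENNReal.ofReal_one, one_pow, one_mul,
    show ((3 : ℕ) : ENNReal) = ENNReal.ofReal 3 by norm_num,
    ← ENNReal.ofReal_mul (by norm_num)]
  congr 1
  ring

instance : IsProbabilityMeasure unif := by
  constructor
  rw [unif, Measure.smul_apply, area_univ, smul_eq_mul]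
  exact ENNReal.inv_mul_cancel
    (by simpa using Real.pi_pos) ENNReal.ofReal_ne_top

/-- The spherical (geodesic) distance `d(x,y) ∈ [0,π]`: the angle between the unit vectors
`x` and `y`. -/
def sdist (x y : S2) : ℝ :=
  InnerProductGeometry.angle (x : EuclideanSpace ℝ (Fin 3)) (y : EuclideanSpace ℝ (Fin 3))

/-- For non-antipodal `x`, `y`, the shorter geodesic segment `[xy]` with endpoints `x` and `y`:
the points lying between `x` and `y` for the spherical distance. (It is used only for
non-antipodal pairs.) -/
def arc (x y : S2) : Set S2 := {z | sdist x z + sdist z y = sdist x y}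

/-- `[x₁x₂]` crosses `[x₃x₄]`: neither pair of endpoints is antipodal, and the two geodesic
segments meet in exactly one point, which is an endpoint of neither. -/
def Crosses (x₁ x₂ x₃ x₄ : S2) : Prop :=
  x₂ ≠ -x₁ ∧ x₄ ≠ -x₃ ∧
    ∃ p : S2, arc x₁ x₂ ∩ arc x₃ x₄ = {p} ∧ p ≠ x₁ ∧ p ≠ x₂ ∧ p ≠ x₃ ∧ p ≠ x₄

/-- The measurable symmetric functions `w : 𝕊² × 𝕊² → [0,1]`. -/
structure IsKernel (w : S2 → S2 → ℝ) : Prop where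
  measurable : Measurable (Function.uncurry w)
  symm : ∀ x y, w x y = w y x
  mem_Icc : ∀ x y, w x y ∈ Icc (0 : ℝ) 1

/-- The ordered edge density `e(w)`. -/
def edgeDensity (w : S2 → S2 → ℝ) : ℝ := ∫ x, ∫ y, w x y ∂unif ∂unif

open Classical in
/-- The crossing functional `Cr(w)`. The integration variable is
`q = ((x₁, x₂), (x₃, x₄))`, ranging over `(𝕊²)⁴` with four independent uniform entries. -/
def crossing (w : S2 → S2 → ℝ) : ℝ :=
  ∫ q : (S2 × S2) × (S2 × S2),
    w q.1.1 q.1.2 * w q.2.1 q.2.2 *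
      (if Crosses q.1.1 q.1.2 q.2.1 q.2.2 then 1 else 0)
    ∂((unif.prod unif).prod (unif.prod unif))

open Classical in
/-- The threshold kernel `1{d(x,y) ≤ t}`. -/
def threshold (t : ℝ) (x y : S2) : ℝ := if sdist x y ≤ t then 1 else 0

end SphericalCrossing

end

namespace SphericalCrossing

open Real

/-! Crossings are counted at the point where they happen. A rotation g marks a point of the sphere
(the image of `equator 0`) and a direction there; `flux w g` is the weighted density of arcs through
that point in that direction. Integral geometry on the rotation group turns Cr(w), up to a constant,
into the average over base points of the energy ∬ |sin(u - v)| G(u) G(v) du dv, where G(u) is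
proportional to the flux in direction u (`lintegral_crossing`, `lintegral_crossing_eq_energy`). An
arc of length ℓ has a range of length ℓ of points on it, so G(u) = ∫ W(u,ℓ) ℓ sin ℓ dℓ with 0 ≤ W ≤
1, whereas e(w) is a multiple of the average of s(u) = ∫ W(u,ℓ) sin ℓ dℓ.

At a fixed base point the problem is planar. The function H = |sin| * G is the support function of a
zonoid, H'' + H = 2G, and the area of this zonoid is ∫ (H² - H'²) = 2 ∫ H G over [0,π]. The
Blaschke–Santaló inequality bounds the area times ∫ H⁻² by π² (`blaschkeSantalo`; it is Wirtinger's
inequality for H exp(iφ) with φ' proportional to H⁻²). With Hölder's inequality this gives (∫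
G^(2/3))³ ≤ (π²/2) ∫ H G (`reverse_hls`).

The exponent 2/3 suits the last ingredient. Given s(u), the bathtub principle yields G(u) ≥ S(τ)
with 1 - cos τ = s(u) and S(τ) = sin τ - τ cos τ, and S^(2/3) is a convex function of 1 - cos τ
because S(τ)/τ³ decreases (`arcMoment_rpow_ge`). Using tangent lines at the single value t fixed by
e(w), both for this function and for the cube, makes the local bound affine in ∫ s
(`zonoid_energy_ge`). Averaging over base points replaces ∫ s by a value determined by e(w), and the
affine correction cancels (`IsKernel.crossing_ge`). A threshold kernel has constant flux, so its
crossing functional is computed directly. -/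

/-! ### Wirtinger's inequality and the planar Blaschke–Santaló inequality -/

/-- **Wirtinger's inequality** for periodic functions of mean zero. -/
theorem wirtinger {F F' : ℝ → ℂ} (hF : ∀ x, HasDerivAt F (F' x) x) (hF' : Continuous F')
    (hper : F (2 * π) = F 0) (hmean : ∫ x in (0 : ℝ)..2 * π, F x = 0) :
    ∫ x in (0 : ℝ)..2 * π, ‖F x‖ ^ 2 ≤ ∫ x in (0 : ℝ)..2 * π, ‖F' x‖ ^ 2 := by
  have h2 : (0 : ℝ) < 2 * π := by positivity
  have hFc : Continuous F := continuous_iff_continuousAt.2 fun x => (hF x).continuousAt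
  have hL {f : ℝ → ℂ} (hf : Continuous f) : MemLp f 2 (volume.restrict (Ioc 0 (2 * π))) := by
    obtain ⟨C, hC⟩ := (isCompact_Icc (a := (0 : ℝ)) (b := 2 * π)).exists_bound_of_continuousOn
      hf.continuousOn
    refine MemLp.of_bound hf.aestronglyMeasurable C ?_
    filter_upwards [ae_restrict_mem measurableSet_Ioc] with x hx
    exact hC x ⟨hx.1.le, hx.2⟩
  have s1 := hasSum_sq_fourierCoeffOn h2 (hL hFc)
  have s2 := hasSum_sq_fourierCoeffOn h2 (hL hF')
  -- Periodicity removes the boundary term, so the n-th coefficient of F' is i n times that of F,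
  -- and |n| ≥ 1 suffices; the coefficient at n = 0 is the mean. Parseval then compares the two
  -- norms.
  have key : ∀ n : ℤ, ‖fourierCoeffOn h2 F n‖ ^ 2 ≤ ‖fourierCoeffOn h2 F' n‖ ^ 2 := by
    intro n
    rcases eq_or_ne n 0 with rfl | hn
    · have : fourierCoeffOn h2 F 0 = 0 := by
        rw [fourierCoeffOn_eq_integral]
        simp [hmean]
      rw [this]
      simp
    · rw [fourierCoeffOn_of_hasDerivAt h2 hn (fun x _ => hF x) (hF'.intervalIntegrable _ _), hper]
      gcongr
      rw [sub_self, mul_zero, zero_sub, norm_mul, norm_neg, norm_mul, ← mul_assoc]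
      have hn1 : (1 : ℝ) ≤ |(n : ℝ)| := by exact_mod_cast Int.one_le_abs hn
      refine mul_le_of_le_one_left (norm_nonneg _) ?_
      have : ‖(1 : ℂ) / (-2 * π * Complex.I * n)‖ * ‖((2 * π : ℝ) : ℂ) - ((0 : ℝ) : ℂ)‖
          = 1 / |(n : ℝ)| := by
        simp [abs_of_pos pi_pos]
        field_simp
      rw [this, div_le_one (by linarith)]
      exact hn1
  have := hasSum_le key s1 s2
  rw [sub_zero, smul_eq_mul, smul_eq_mul] at this
  exact le_of_mul_le_mul_left this (by positivity)

/-- The **Blaschke–Santaló inequality** for centrally symmetric planar bodies, in terms of the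
support function. -/
theorem blaschkeSantalo {H H' : ℝ → ℝ} (hH : ∀ x, HasDerivAt H (H' x) x) (hH' : Continuous H')
    (hpos : ∀ x, 0 < H x) (hper : Function.Periodic H π) :
    (∫ x in (0 : ℝ)..π, (H x ^ 2 - H' x ^ 2)) * (∫ x in (0 : ℝ)..π, (H x)⁻¹ ^ 2) ≤ π ^ 2 := by
  have hHc : Continuous H := continuous_iff_continuousAt.2 fun x => (hH x).continuousAt
  have hper' : Function.Periodic H' π := by
    intro x
    have h1 := (hH (x + π)).comp_add_const x π
    have h2 : (fun y => H (y + π)) = H := funext hper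
    rw [h2] at h1
    exact h1.unique (hH x)
  have hQc : Continuous fun x => (H x)⁻¹ ^ 2 := (hHc.inv₀ fun x => (hpos x).ne').pow 2
  have hQper : Function.Periodic (fun x => (H x)⁻¹ ^ 2) π := fun x => by simp only [hper x]
  set J := ∫ x in (0 : ℝ)..π, (H x)⁻¹ ^ 2 with hJ
  have hJpos : 0 < J := intervalIntegral.intervalIntegral_pos_of_pos (hQc.intervalIntegrable _ _)
    (fun x => by have := hpos x; positivity) pi_pos
  -- With this c the phase φ gains exactly π over one period of H, so H exp(iφ) changes sign under
  -- translation by π and has mean zero over [0, 2π].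
  set c := π / J with hc
  set φ : ℝ → ℝ := fun x => c * ∫ y in (0 : ℝ)..x, (H y)⁻¹ ^ 2 with hφ
  have hφd : ∀ x, HasDerivAt φ (c * (H x)⁻¹ ^ 2) x := fun x =>
    (intervalIntegral.integral_hasDerivAt_right (hQc.intervalIntegrable _ _)
      (hQc.stronglyMeasurableAtFilter _ _) hQc.continuousAt).const_mul c
  have hφper : ∀ x, φ (x + π) = φ x + π := by
    intro x
    simp only [hφ]
    rw [← intervalIntegral.integral_add_adjacent_intervals (hQc.intervalIntegrable 0 x)
      (hQc.intervalIntegrable x (x + π)), hQper.intervalIntegral_add_eq x 0, zero_add, ← hJ, mul_add]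
    congr 1
    rw [hc]; field_simp
  set F : ℝ → ℂ := fun x => H x * Complex.exp (φ x * Complex.I) with hF
  set F' : ℝ → ℂ := fun x => (H' x + H x * (c * (H x)⁻¹ ^ 2 : ℝ) * Complex.I) *
    Complex.exp (φ x * Complex.I) with hF'
  have hFd : ∀ x, HasDerivAt F (F' x) x := by
    intro x
    have h1 := (hH x).ofReal_comp.mul (((hφd x).ofReal_comp.mul_const Complex.I).cexp)
    refine h1.congr_deriv ?_
    simp only [hF']
    ring
  have hφc : Continuous φ := continuous_iff_continuousAt.2 fun x => (hφd x).continuousAt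
  have hF'c : Continuous F' := by
    simp only [hF']
    refine Continuous.mul ?_ (by fun_prop)
    have : Continuous fun x => c * (H x)⁻¹ ^ 2 := continuous_const.mul hQc
    fun_prop
  have hFanti : ∀ x, F (x + π) = - F x := by
    intro x
    simp only [hF, hφper, hper x]
    push_cast
    rw [add_mul, Complex.exp_add, Complex.exp_pi_mul_I]
    ring
  have hFc : Continuous F := continuous_iff_continuousAt.2 fun x => (hFd x).continuousAt
  have split {E : Type} [NormedAddCommGroup E] [NormedSpace ℝ E] (f : ℝ → E) (hf : Continuous f) :
      ∫ x in (0 : ℝ)..2 * π, f x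
        = (∫ x in (0 : ℝ)..π, f x) + ∫ x in (0 : ℝ)..π, f (x + π) := by
    rw [intervalIntegral.integral_comp_add_right, zero_add, ← two_mul]
    exact (intervalIntegral.integral_add_adjacent_intervals (hf.intervalIntegrable _ _)
      (hf.intervalIntegrable _ _)).symm
  have hw := wirtinger hFd hF'c
    (by rw [show 2 * π = 0 + π + π by ring, hFanti, hFanti, neg_neg])
    (by rw [split F hFc]; simp [hFanti])
  have hnF : ∀ x, ‖F x‖ ^ 2 = H x ^ 2 := by
    intro x
    simp only [hF]
    rw [norm_mul, Complex.norm_exp_ofReal_mul_I, mul_one, Complex.norm_real, Real.norm_eq_abs,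
      sq_abs]
  -- After the unimodular factor is removed, H' is the real part and H φ' = c / H the imaginary
  -- part, so there is no cross term.
  have hnF' : ∀ x, ‖F' x‖ ^ 2 = H' x ^ 2 + c ^ 2 * (H x)⁻¹ ^ 2 := by
    intro x
    simp only [hF']
    rw [norm_mul, Complex.norm_exp_ofReal_mul_I, mul_one, ← Complex.ofReal_mul, Complex.sq_norm,
      Complex.normSq_add_mul_I]
    have := (hpos x).ne'
    field_simp
  have hH2c : Continuous fun x => H x ^ 2 := hHc.pow 2
  have hH2'c : Continuous fun x => H' x ^ 2 := hH'.pow 2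
  have hK : Continuous fun x => c ^ 2 * (H x)⁻¹ ^ 2 := continuous_const.mul hQc
  simp only [hnF, hnF'] at hw
  rw [split _ hH2c, split (fun x => H' x ^ 2 + c ^ 2 * (H x)⁻¹ ^ 2) (hH2'c.add hK)] at hw
  simp only [hper _, hper' _] at hw
  rw [intervalIntegral.integral_add (hH2'c.intervalIntegrable _ _) (hK.intervalIntegrable _ _),
    intervalIntegral.integral_const_mul, ← hJ] at hw
  rw [intervalIntegral.integral_sub (hH2c.intervalIntegrable _ _) (hH2'c.intervalIntegrable _ _)]
  have h3 : (∫ x in (0 : ℝ)..π, H x ^ 2) - (∫ x in (0 : ℝ)..π, H' x ^ 2) ≤ c ^ 2 * J := by linarith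
  calc _ ≤ c ^ 2 * J * J := by gcongr
    _ = π ^ 2 := by rw [hc]; field_simp

/-! ### Planar zonoids and the reverse Hardy–Littlewood–Sobolev inequality -/

/-- The derivative of `|sin|` away from its zeros. -/
noncomputable def absSinDeriv (x : ℝ) : ℝ := Real.sign (sin x) * cos x

theorem measurable_absSinDeriv : Measurable absSinDeriv := by
  have : Measurable Real.sign := by
    unfold Real.sign
    exact Measurable.ite measurableSet_Iio measurable_const
      (Measurable.ite measurableSet_Ioi measurable_const measurable_const)
  unfold absSinDeriv
  exact (this.comp measurable_sin).mul measurable_cos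

theorem abs_absSinDeriv_le (x : ℝ) : |absSinDeriv x| ≤ 1 := by
  rw [absSinDeriv, abs_mul]
  refine mul_le_one₀ ?_ (abs_nonneg _) (abs_cos_le_one x)
  rcases Real.sign_apply_eq (sin x) with h | h | h <;> simp [h]

theorem absSinDeriv_add_pi (x : ℝ) : absSinDeriv (x + π) = absSinDeriv x := by
  rw [absSinDeriv, absSinDeriv, sin_add_pi, cos_add_pi, Real.sign_neg]
  ring

theorem absSinDeriv_eventuallyEq {x : ℝ} (hx : sin x ≠ 0) :
    absSinDeriv =ᶠ[nhds x] fun y => Real.sign (sin x) * cos y := by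
  rcases lt_or_gt_of_ne hx with h | h
  · filter_upwards [continuous_sin.continuousAt.eventually_lt_const h] with y hy
    rw [absSinDeriv, Real.sign_of_neg h, Real.sign_of_neg hy]
  · filter_upwards [continuous_sin.continuousAt.eventually_const_lt h] with y hy
    rw [absSinDeriv, Real.sign_of_pos h, Real.sign_of_pos hy]

theorem continuousAt_absSinDeriv {x : ℝ} (hx : sin x ≠ 0) : ContinuousAt absSinDeriv x := by
  refine ContinuousAt.congr ?_ (absSinDeriv_eventuallyEq hx).symm
  fun_prop

theorem hasDerivAt_abs_sin {x : ℝ} (hx : sin x ≠ 0) :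
    HasDerivAt (fun y => |sin y|) (absSinDeriv x) x := by
  rcases lt_or_gt_of_ne hx with h | h
  · rw [absSinDeriv, Real.sign_of_neg h, neg_one_mul]
    exact (hasDerivAt_abs_neg h).comp x (hasDerivAt_sin x) |>.congr_deriv (by ring)
  · rw [absSinDeriv, Real.sign_of_pos h]
    exact (hasDerivAt_abs_pos h).comp x (hasDerivAt_sin x)

theorem abs_abs_sin_sub_abs_sin_le (x y : ℝ) : |(|sin x| - |sin y|)| ≤ |x - y| := by
  refine (abs_abs_sub_abs_le _ _).trans ?_
  have := lipschitzWith_sin.dist_le_mul x y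
  simpa [Real.dist_eq] using this

theorem ae_sin_sub_ne_zero (θ : ℝ) : ∀ᵐ v : ℝ, sin (θ - v) ≠ 0 := by
  have : (range fun n : ℤ => θ - n * π).Countable := countable_range _
  filter_upwards [this.ae_notMem volume] with v hv h
  obtain ⟨n, hn⟩ := sin_eq_zero_iff.1 h
  exact hv ⟨n, by simp only; linarith⟩

/-- The support function of the planar zonoid with generating density `G`. -/
noncomputable def zonoid (G : ℝ → ℝ) (θ : ℝ) : ℝ := ∫ v in (0 : ℝ)..π, |sin (θ - v)| * G v

/-- The derivative of `zonoid G`. -/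
noncomputable def zonoidDeriv (G : ℝ → ℝ) (θ : ℝ) : ℝ := ∫ v in (0 : ℝ)..π, absSinDeriv (θ - v) * G v

section zonoid

variable {G : ℝ → ℝ} {M : ℝ}

theorem intervalIntegrable_of_bdd {f : ℝ → ℝ} (hf : Measurable f) {C : ℝ} (hC : ∀ x, |f x| ≤ C)
    (a b : ℝ) : IntervalIntegrable f volume a b := by
  exact (intervalIntegrable_const (c := C)).mono_fun hf.aestronglyMeasurable
    (Filter.Eventually.of_forall fun x => (hC x).trans (le_abs_self C))

theorem abs_mul_le_of_abs_le_one {a b C : ℝ} (ha : |a| ≤ 1) (hb : |b| ≤ C) : |a * b| ≤ C := by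
  rw [abs_mul]
  exact (mul_le_of_le_one_left (abs_nonneg _) ha).trans hb

theorem abs_abs_sin_le (x : ℝ) : |(|sin x|)| ≤ 1 := by
  rw [abs_abs]; exact abs_sin_le_one x

/-- The kernel is 1-Lipschitz in θ and differentiable for all but countably many v, which is enough
to differentiate under the integral although G is only bounded and measurable. -/
theorem hasDerivAt_zonoid (hG : Measurable G) (hM : ∀ x, |G x| ≤ M) (θ : ℝ) :
    HasDerivAt (zonoid G) (zonoidDeriv G θ) θ := by
  have hm (x : ℝ) : Measurable fun v => |sin (x - v)| * G v := by fun_prop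
  refine (intervalIntegral.hasDerivAt_integral_of_dominated_loc_of_lip (F := fun x v => |sin (x - v)| * G v)
    (F' := fun v => absSinDeriv (θ - v) * G v) (bound := fun _ => M) (s := univ)
    Filter.univ_mem (Filter.Eventually.of_forall fun x => (hm x).aestronglyMeasurable)
    (intervalIntegrable_of_bdd (hm θ)
      (fun v => abs_mul_le_of_abs_le_one (abs_abs_sin_le _) (hM v)) _ _)
    ((measurable_absSinDeriv.comp (by fun_prop)).mul hG).aestronglyMeasurable
    (Filter.Eventually.of_forall fun v _ => ?_) intervalIntegrable_const ?_).2
  · refine LipschitzOnWith.of_dist_le_mul fun x _ y _ => ?_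
    rw [Real.dist_eq, Real.dist_eq, ← sub_mul, abs_mul, mul_comm, coe_nnabs]
    refine mul_le_mul ((hM v).trans (le_abs_self M)) ?_ (abs_nonneg _) (abs_nonneg _)
    refine (abs_abs_sin_sub_abs_sin_le _ _).trans_eq ?_
    congr 1; ring
  · filter_upwards [ae_sin_sub_ne_zero θ] with v hv _
    have := (hasDerivAt_abs_sin hv).comp θ ((hasDerivAt_id θ).sub_const v)
    exact (this.mul_const (G v)).congr_deriv (by ring)

/-- The kernel jumps, but for a given θ only at a null set of v; dominated convergence smooths this
out. -/
theorem continuous_zonoidDeriv (hG : Measurable G) (hM : ∀ x, |G x| ≤ M) :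
    Continuous (zonoidDeriv G) := by
  refine continuous_iff_continuousAt.2 fun θ => ?_
  refine intervalIntegral.continuousAt_of_dominated_interval (bound := fun _ => M)
    (Filter.Eventually.of_forall fun x =>
      ((measurable_absSinDeriv.comp (by fun_prop)).mul hG).aestronglyMeasurable)
    (Filter.Eventually.of_forall fun x => Filter.Eventually.of_forall fun v _ => ?_)
    intervalIntegrable_const ?_
  · exact abs_mul_le_of_abs_le_one (abs_absSinDeriv_le _) (hM v)
  · filter_upwards [ae_sin_sub_ne_zero θ] with v hv _
    have : ContinuousAt (fun x => absSinDeriv (x - v)) θ :=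
      ContinuousAt.comp (f := fun x => x - v) (continuousAt_absSinDeriv hv) (by fun_prop)
    exact this.mul continuousAt_const

theorem zonoid_periodic : Function.Periodic (zonoid G) π := by
  intro θ
  simp only [zonoid, add_sub_right_comm θ π, sin_add_pi, abs_neg]

theorem zonoidDeriv_periodic : Function.Periodic (zonoidDeriv G) π := by
  intro θ
  simp only [zonoidDeriv, add_sub_right_comm θ π, absSinDeriv_add_pi]

/-- The weak form of `H'' + H = 2 G` tested against `|sin|`. -/
theorem integral_mul_abs_sin_sub {H H' : ℝ → ℝ} (hH : ∀ x, HasDerivAt H (H' x) x)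
    (hH' : Continuous H') (hper : Function.Periodic H π) (hper' : Function.Periodic H' π) (v : ℝ) :
    ∫ θ in (0 : ℝ)..π, (H θ * |sin (θ - v)| - H' θ * absSinDeriv (θ - v)) = 2 * H v := by
  have hHc : Continuous H := continuous_iff_continuousAt.2 fun x => (hH x).continuousAt
  have hp : Function.Periodic
      (fun θ => H θ * |sin (θ - v)| - H' θ * absSinDeriv (θ - v)) π := by
    intro θ
    simp only [add_sub_right_comm θ π, absSinDeriv_add_pi, sin_add_pi, abs_neg, hper θ, hper' θ]
  have h0 := hp.intervalIntegral_add_eq 0 v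
  rw [zero_add] at h0
  rw [h0]
  -- On the shifted period [v, v + π] the sine is nonnegative, so the integrand is an exact
  -- derivative. Its two boundary terms are both H v, because cos changes sign and H does not.
  have hd : ∀ θ, HasDerivAt (fun θ => -(H θ * cos (θ - v)))
      (H θ * sin (θ - v) - H' θ * cos (θ - v)) θ := by
    intro θ
    have h1 := ((hasDerivAt_cos (θ - v)).comp θ ((hasDerivAt_id θ).sub_const v))
    exact ((hH θ).mul h1).neg.congr_deriv (by simp; ring)
  have h1 : ∫ θ in v..v + π, (H θ * |sin (θ - v)| - H' θ * absSinDeriv (θ - v))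
      = ∫ θ in v..v + π, (H θ * sin (θ - v) - H' θ * cos (θ - v)) := by
    refine intervalIntegral.integral_congr_ae ?_
    have : ∀ᵐ θ : ℝ, θ ≠ v + π := by simp [ae_iff, measure_singleton]
    filter_upwards [this] with θ hne hθ
    rw [uIoc_of_le (by linarith [pi_pos])] at hθ
    have hs : 0 < sin (θ - v) := sin_pos_of_pos_of_lt_pi (by linarith [hθ.1])
      (by have := lt_of_le_of_ne hθ.2 hne; linarith)
    rw [absSinDeriv, Real.sign_of_pos hs, one_mul, abs_of_pos hs]
  rw [h1, intervalIntegral.integral_eq_sub_of_hasDerivAt (fun x _ => hd x)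
    (Continuous.intervalIntegrable (by fun_prop) _ _)]
  simp [hper v]
  ring

/-- Formally, multiply H'' + H = 2G by H and integrate by parts. Since H'' exists only weakly, one
factor H (and H') is instead expanded as an integral against G, and after Fubini the inner integral
is `integral_mul_abs_sin_sub`. -/
theorem integral_zonoid_sq_sub (hG : Measurable G) (hM : ∀ x, |G x| ≤ M) :
    ∫ θ in (0 : ℝ)..π, (zonoid G θ ^ 2 - zonoidDeriv G θ ^ 2)
      = 2 * ∫ v in (0 : ℝ)..π, zonoid G v * G v := by
  have hc' := continuous_zonoidDeriv hG hM
  have hd := hasDerivAt_zonoid hG hM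
  have hc : Continuous (zonoid G) := continuous_iff_continuousAt.2 fun x => (hd x).continuousAt
  have hM0 : 0 ≤ M := (abs_nonneg _).trans (hM 0)
  have h1 : ∀ θ, zonoid G θ ^ 2 - zonoidDeriv G θ ^ 2 = ∫ v in (0 : ℝ)..π,
      (zonoid G θ * |sin (θ - v)| - zonoidDeriv G θ * absSinDeriv (θ - v)) * G v := by
    intro θ
    simp only [sub_mul, mul_assoc]
    rw [intervalIntegral.integral_sub, intervalIntegral.integral_const_mul, intervalIntegral.integral_const_mul, sq, sq]
    · rfl
    · exact (intervalIntegrable_of_bdd (by fun_prop)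
        (fun v => abs_mul_le_of_abs_le_one (abs_abs_sin_le _) (hM v)) _ _).const_mul _
    · exact (intervalIntegrable_of_bdd ((measurable_absSinDeriv.comp (by fun_prop)).mul hG)
        (fun v => abs_mul_le_of_abs_le_one (abs_absSinDeriv_le _) (hM v)) _ _).const_mul _
  simp only [h1]
  obtain ⟨A, hA⟩ := (isCompact_Icc (a := (0 : ℝ)) (b := π)).exists_bound_of_continuousOn
    hc.continuousOn
  obtain ⟨B, hB⟩ := (isCompact_Icc (a := (0 : ℝ)) (b := π)).exists_bound_of_continuousOn
    hc'.continuousOn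
  rw [← intervalIntegral.integral_const_mul]
  simp only [intervalIntegral.integral_of_le pi_pos.le]
  rw [integral_integral_swap]
  · refine integral_congr_ae (Filter.Eventually.of_forall fun v => ?_)
    simp only
    rw [integral_mul_const, ← intervalIntegral.integral_of_le pi_pos.le,
      integral_mul_abs_sin_sub hd hc' zonoid_periodic zonoidDeriv_periodic]
    ring
  · have hDm := measurable_absSinDeriv
    have hcm := hc.measurable
    have hcm' := hc'.measurable
    refine Integrable.of_bound (C := (A + B) * M) (Measurable.aestronglyMeasurable ?_) ?_
    · unfold Function.uncurry
      fun_prop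
    · rw [Measure.prod_restrict]
      filter_upwards [ae_restrict_mem (measurableSet_Ioc.prod measurableSet_Ioc)] with x hx
      simp only [Function.uncurry, Real.norm_eq_abs]
      rw [abs_mul]
      have hx1 : x.1 ∈ Icc 0 π := ⟨hx.1.1.le, hx.1.2⟩
      have hA1 := hA _ hx1
      have hB1 := hB _ hx1
      rw [Real.norm_eq_abs] at hA1 hB1
      refine mul_le_mul ?_ (hM _) (abs_nonneg _)
        (add_nonneg ((abs_nonneg _).trans hA1) ((abs_nonneg _).trans hB1))
      refine (abs_sub _ _).trans (add_le_add ?_ ?_)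
      · rw [mul_comm]; exact abs_mul_le_of_abs_le_one (abs_abs_sin_le _) hA1
      · rw [mul_comm]; exact abs_mul_le_of_abs_le_one (abs_absSinDeriv_le _) hB1

theorem zonoid_pos (hG : Measurable G) (hG0 : ∀ x, 0 ≤ G x) (hM : ∀ x, |G x| ≤ M)
    (hne : ¬ ∀ᵐ v ∂volume.restrict (Ioc 0 π), G v = 0) (θ : ℝ) : 0 < zonoid G θ := by
  have h0 : ∀ v, 0 ≤ |sin (θ - v)| * G v := fun v => mul_nonneg (abs_nonneg _) (hG0 v)
  refine lt_of_le_of_ne (intervalIntegral.integral_nonneg pi_pos.le fun v _ => h0 v) fun h => hne ?_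
  rw [zonoid, intervalIntegral.integral_of_le pi_pos.le, eq_comm, integral_eq_zero_iff_of_nonneg h0] at h
  · filter_upwards [h, ae_restrict_of_ae (ae_sin_sub_ne_zero θ)] with v hv hs
    simpa [hs] using hv
  · have := intervalIntegrable_of_bdd (f := fun v => |sin (θ - v)| * G v) (by fun_prop)
        (fun v => abs_mul_le_of_abs_le_one (abs_abs_sin_le _) (hM v)) 0 π
    rwa [intervalIntegrable_iff_integrableOn_Ioc_of_le pi_pos.le] at this

/-- A sharp reverse Hardy–Littlewood–Sobolev inequality on the projective line (equivalently, the
affine isoperimetric inequality for centrally symmetric planar convex bodies). -/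
theorem reverse_hls (hG : Measurable G) (hG0 : ∀ x, 0 ≤ G x) (hM : ∀ x, |G x| ≤ M) :
    (∫ v in (0 : ℝ)..π, G v ^ (2 / 3 : ℝ)) ^ 3
      ≤ π ^ 2 / 2 * ∫ v in (0 : ℝ)..π, zonoid G v * G v := by
  by_cases hne : ∀ᵐ v ∂volume.restrict (Ioc 0 π), G v = 0
  · have h1 : ∫ v in (0 : ℝ)..π, G v ^ (2 / 3 : ℝ) = 0 := by
      rw [intervalIntegral.integral_of_le pi_pos.le]
      refine integral_eq_zero_of_ae ?_
      filter_upwards [hne] with v hv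
      simp [hv]
    have h2 : ∫ v in (0 : ℝ)..π, zonoid G v * G v = 0 := by
      rw [intervalIntegral.integral_of_le pi_pos.le]
      refine integral_eq_zero_of_ae ?_
      filter_upwards [hne] with v hv
      simp [hv]
    rw [h1, h2]; simp
  · have hHpos := zonoid_pos hG hG0 hM hne
    have hd := hasDerivAt_zonoid hG hM
    have hc : Continuous (zonoid G) := continuous_iff_continuousAt.2 fun x => (hd x).continuousAt
    have hS := blaschkeSantalo hd (continuous_zonoidDeriv hG hM) hHpos zonoid_periodic
    rw [integral_zonoid_sq_sub hG hM] at hS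
    set I := ∫ v in (0 : ℝ)..π, zonoid G v * G v with hI
    set J := ∫ v in (0 : ℝ)..π, (zonoid G v)⁻¹ ^ 2 with hJ
    set A := ∫ v in (0 : ℝ)..π, G v ^ (2 / 3 : ℝ) with hA
    obtain ⟨C, hC⟩ := (isCompact_Icc (a := (0 : ℝ)) (b := π)).exists_bound_of_continuousOn
      hc.continuousOn
    have hIi : IntervalIntegrable (fun v => zonoid G v * G v) volume 0 π :=
      (intervalIntegrable_of_bdd hG hM 0 π).continuousOn_mul hc.continuousOn
    have hJc : Continuous fun v => (zonoid G v)⁻¹ ^ 2 := (hc.inv₀ fun x => (hHpos x).ne').pow 2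
    have hAi : IntervalIntegrable (fun v => G v ^ (2 / 3 : ℝ)) volume 0 π := by
      refine intervalIntegrable_of_bdd (C := M ^ (2 / 3 : ℝ)) (by fun_prop) (fun v => ?_) 0 π
      rw [abs_of_nonneg (rpow_nonneg (hG0 v) _)]
      exact rpow_le_rpow (hG0 v) ((le_abs_self _).trans (hM v)) (by norm_num)
    have hI0 : 0 < I := by
      have hnn : ∀ v, 0 ≤ zonoid G v * G v := fun v => mul_nonneg (hHpos v).le (hG0 v)
      refine lt_of_le_of_ne (intervalIntegral.integral_nonneg pi_pos.le fun v _ => hnn v) fun h => hne ?_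
      rw [hI, intervalIntegral.integral_of_le pi_pos.le, eq_comm,
        integral_eq_zero_iff_of_nonneg hnn] at h
      · filter_upwards [h] with v hv
        simpa [(hHpos v).ne'] using hv
      · rwa [intervalIntegrable_iff_integrableOn_Ioc_of_le pi_pos.le] at hIi
    -- Hölder's inequality for G^(2/3) = (H G)^(2/3) (H⁻²)^(1/3), in the form of a pointwise
    -- weighted AM–GM with a free scale a that cancels on the left.
    have key : ∀ a : ℝ, 0 < a → A ≤ 2 / 3 * a * I + 1 / 3 * (a⁻¹ ^ 2) * J := by
      intro a ha
      rw [hA, hI, hJ, ← intervalIntegral.integral_const_mul, ← intervalIntegral.integral_const_mul,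
        ← intervalIntegral.integral_add (hIi.const_mul _) ((hJc.intervalIntegrable _ _).const_mul _)]
      refine intervalIntegral.integral_mono_on pi_pos.le hAi ((hIi.const_mul _).add
        ((hJc.intervalIntegrable _ _).const_mul _)) fun v _ => ?_
      have hv := hHpos v
      have hg := hG0 v
      have := Real.geom_mean_le_arith_mean2_weighted (w₁ := 2 / 3) (w₂ := 1 / 3)
        (p₁ := a * (zonoid G v * G v)) (p₂ := (a⁻¹ * (zonoid G v)⁻¹) ^ 2) (by norm_num)
        (by norm_num) (by positivity) (by positivity) (by norm_num)
      have e : (a * (zonoid G v * G v)) ^ (2 / 3 : ℝ) * ((a⁻¹ * (zonoid G v)⁻¹) ^ 2) ^ (1 / 3 : ℝ)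
          = G v ^ (2 / 3 : ℝ) := by
        rw [← rpow_natCast, ← rpow_mul (by positivity), ← mul_assoc a,
          mul_rpow (by positivity) hg, ← mul_inv, inv_rpow (by positivity)]
        have : (a * zonoid G v) ^ (2 / 3 : ℝ) ≠ 0 := by positivity
        norm_num
        field_simp
      rw [e] at this
      refine this.trans_eq ?_
      ring
    -- The scale that balances the two terms: k³ I² = π²/2, so Blaschke–Santaló reads J ≤ k³ I, and
    -- the bound becomes (2/3 + 1/3) k I.
    set k := (π ^ 2 / (2 * I)) ^ (1 / 3 : ℝ) / I ^ (1 / 3 : ℝ) with hk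
    have hp := pi_pos
    have hkpos : 0 < k := by positivity
    have hk3 : k ^ 3 * I ^ 2 = π ^ 2 / 2 := by
      have c3 (x : ℝ) (hx : 0 ≤ x) : (x ^ (1 / 3 : ℝ)) ^ 3 = x := by
        rw [← rpow_natCast, ← rpow_mul hx]; norm_num
      rw [hk, div_pow, c3 _ (by positivity), c3 _ hI0.le]
      field_simp
    have hJ' : J ≤ π ^ 2 / (2 * I) := by
      rw [le_div_iff₀ (by positivity)]
      linarith
    have hle := key k hkpos
    have : A ≤ k * I := by
      have h3 : 1 / 3 * (k⁻¹ ^ 2) * J ≤ 1 / 3 * (k⁻¹ ^ 2) * (k ^ 3 * I) := by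
        gcongr
        refine hJ'.trans_eq ?_
        rw [← div_div, ← hk3]; field_simp
      have h4 : 1 / 3 * (k⁻¹ ^ 2) * (k ^ 3 * I) = 1 / 3 * (k * I) := by field_simp
      linarith
    have hA0 : 0 ≤ A := intervalIntegral.integral_nonneg pi_pos.le fun v _ => rpow_nonneg (hG0 v) _
    calc A ^ 3 ≤ (k * I) ^ 3 := by gcongr
      _ = k ^ 3 * I ^ 2 * I := by ring
      _ = π ^ 2 / 2 * I := by rw [hk3]

end zonoid

/-! ### The arc moment, the bathtub principle and the local inequality -/

/-- The mean length `∫₀ᵗ ℓ sin ℓ dℓ` of the arcs shorter than `t`, up to normalization. -/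
noncomputable def arcMoment (t : ℝ) : ℝ := sin t - t * cos t

theorem hasDerivAt_arcMoment (t : ℝ) : HasDerivAt arcMoment (t * sin t) t := by
  have := (hasDerivAt_sin t).sub ((hasDerivAt_id t).mul (hasDerivAt_cos t))
  exact this.congr_deriv (by simp)

theorem continuous_arcMoment : Continuous arcMoment := by
  unfold arcMoment; fun_prop

theorem integral_mul_sin (t : ℝ) : ∫ x in (0 : ℝ)..t, x * sin x = arcMoment t := by
  rw [intervalIntegral.integral_eq_sub_of_hasDerivAt (fun x _ => hasDerivAt_arcMoment x)
    (Continuous.intervalIntegrable (by fun_prop) _ _)]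
  simp [arcMoment]

theorem strictMonoOn_arcMoment : StrictMonoOn arcMoment (Icc 0 π) := by
  refine strictMonoOn_of_deriv_pos (convex_Icc _ _) continuous_arcMoment.continuousOn fun x hx => ?_
  rw [interior_Icc] at hx
  rw [(hasDerivAt_arcMoment x).deriv]
  exact mul_pos hx.1 (sin_pos_of_mem_Ioo hx)

theorem arcMoment_zero : arcMoment 0 = 0 := by simp [arcMoment]

theorem arcMoment_pos {t : ℝ} (h0 : 0 < t) (ht : t ≤ π) : 0 < arcMoment t := by
  rw [← arcMoment_zero]
  exact strictMonoOn_arcMoment ⟨le_rfl, pi_pos.le⟩ ⟨h0.le, ht⟩ h0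

theorem arcMoment_nonneg {t : ℝ} (ht : t ∈ Icc 0 π) : 0 ≤ arcMoment t := by
  rw [← arcMoment_zero]
  exact strictMonoOn_arcMoment.monotoneOn ⟨le_rfl, pi_pos.le⟩ ht ht.1

/-- The difference of the two sides vanishes at 0 and has derivative x (sin x - x cos x) ≥ 0. It
governs the sign of the derivative of S(t)/t³, where S is `arcMoment`. -/
theorem sq_mul_sin_le {t : ℝ} (ht : t ∈ Icc 0 π) : t ^ 2 * sin t ≤ 3 * arcMoment t := by
  have hd : ∀ x, HasDerivAt (fun x => 3 * arcMoment x - x ^ 2 * sin x) (x * arcMoment x) x := by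
    intro x
    refine (((hasDerivAt_arcMoment x).const_mul 3).sub
      ((hasDerivAt_pow 2 x).mul (hasDerivAt_sin x))).congr_deriv ?_
    simp [arcMoment]; ring
  have hm : MonotoneOn (fun x => 3 * arcMoment x - x ^ 2 * sin x) (Icc 0 π) := by
    refine monotoneOn_of_deriv_nonneg (convex_Icc _ _)
      (continuous_iff_continuousAt.2 fun x => (hd x).continuousAt).continuousOn
      (fun x _ => (hd x).differentiableAt.differentiableWithinAt) fun x hx => ?_
    rw [interior_Icc] at hx
    rw [(hd x).deriv]
    exact mul_nonneg hx.1.le (arcMoment_nonneg (Ioo_subset_Icc_self hx))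
  have := hm ⟨le_rfl, pi_pos.le⟩ ht ht.1
  simp [arcMoment_zero] at this
  linarith

theorem antitoneOn_arcMoment_div : AntitoneOn (fun t => arcMoment t / t ^ 3) (Ioc 0 π) := by
  have hd : ∀ x, 0 < x → HasDerivAt (fun t => arcMoment t / t ^ 3)
      ((x * sin x * x ^ 3 - arcMoment x * (3 * x ^ 2)) / (x ^ 3) ^ 2) x := by
    intro x hx
    exact ((hasDerivAt_arcMoment x).div (hasDerivAt_pow 3 x) (by positivity)).congr_deriv (by simp)
  refine antitoneOn_of_deriv_nonpos (convex_Ioc _ _)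
    (fun x hx => (hd x hx.1).continuousAt.continuousWithinAt)
    (fun x hx => ?_) fun x hx => ?_
  · rw [interior_Ioc] at hx
    exact (hd x hx.1).differentiableAt.differentiableWithinAt
  · rw [interior_Ioc] at hx
    rw [(hd x hx.1).deriv]
    refine div_nonpos_of_nonpos_of_nonneg ?_ (by positivity)
    have := sq_mul_sin_le (Ioo_subset_Icc_self hx)
    nlinarith [sq_nonneg x]

/-- The function is (S/t³)^(-1/3) with S/t³ decreasing. Up to the factor 2/3 it is the derivative of
S^(2/3) with respect to 1 - cos t, so its monotonicity is the convexity used next. -/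
theorem monotoneOn_mul_arcMoment_rpow :
    MonotoneOn (fun t => t * arcMoment t ^ (-(1 / 3) : ℝ)) (Ioc 0 π) := by
  intro s hs t ht hst
  have h := antitoneOn_arcMoment_div hs ht hst
  have e : ∀ x ∈ Ioc 0 π,
      x * arcMoment x ^ (-(1 / 3) : ℝ) = (arcMoment x / x ^ 3) ^ (-(1 / 3) : ℝ) := by
    intro x hx
    have h1 := arcMoment_pos hx.1 hx.2
    rw [div_rpow h1.le (by have := hx.1; positivity), ← rpow_natCast, ← rpow_mul hx.1.le]
    norm_num
    rw [rpow_neg hx.1.le, rpow_one, div_inv_eq_mul, mul_comm]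
  simp only [e s hs, e t ht]
  exact rpow_le_rpow_of_nonpos (div_pos (arcMoment_pos ht.1 ht.2) (pow_pos ht.1 3)) h (by norm_num)

/-- Convexity of `arcMoment ^ (2/3)` as a function of `cos`, in tangent line form. -/
theorem arcMoment_rpow_ge {t t₀ : ℝ} (ht : t ∈ Icc 0 π) (ht₀ : t₀ ∈ Ioc 0 π) :
    arcMoment t₀ ^ (2 / 3 : ℝ) + 2 / 3 * arcMoment t₀ ^ (-(1 / 3) : ℝ) * t₀ * (cos t₀ - cos t)
      ≤ arcMoment t ^ (2 / 3 : ℝ) := by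
  set c := arcMoment t₀ ^ (-(1 / 3) : ℝ) * t₀ with hc
  set f : ℝ → ℝ := fun x => arcMoment x ^ (2 / 3 : ℝ) - 2 / 3 * c * (cos t₀ - cos x) with hf
  have hfc : Continuous f :=
    (continuous_arcMoment.rpow_const fun _ => Or.inr (by norm_num)).sub (by fun_prop)
  have hd : ∀ x ∈ Ioo 0 π, HasDerivAt f
      (2 / 3 * sin x * (x * arcMoment x ^ (-(1 / 3) : ℝ) - c)) x := by
    intro x hx
    have h1 := (hasDerivAt_arcMoment x).rpow_const (p := 2 / 3)
      (Or.inl (arcMoment_pos hx.1 hx.2.le).ne')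
    have h2 := (((hasDerivAt_cos x).const_sub (cos t₀)).const_mul (2 / 3 * c))
    refine (h1.sub h2).congr_deriv ?_
    norm_num
    ring
  have hsin : ∀ x ∈ Ioo 0 π, 0 ≤ 2 / 3 * sin x := fun x hx => by
    have := sin_pos_of_mem_Ioo hx; positivity
  -- The derivative of f is (2/3) sin x times an increasing function minus its value at t₀, so f
  -- decreases before t₀ and increases after it.
  have hmin : f t₀ ≤ f t := by
    rcases le_total t t₀ with h | h
    · have : AntitoneOn f (Icc 0 t₀) := by
        have sub : Ioo 0 t₀ ⊆ Ioo 0 π := Ioo_subset_Ioo_right ht₀.2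
        refine antitoneOn_of_deriv_nonpos (convex_Icc _ _) hfc.continuousOn
          (fun x hx => ?_) fun x hx => ?_
        · rw [interior_Icc] at hx
          exact (hd x (sub hx)).differentiableAt.differentiableWithinAt
        · rw [interior_Icc] at hx
          rw [(hd x (sub hx)).deriv]
          refine mul_nonpos_of_nonneg_of_nonpos (hsin x (sub hx)) ?_
          have := monotoneOn_mul_arcMoment_rpow ⟨hx.1, (sub hx).2.le⟩ ht₀ hx.2.le
          simp only at this
          rw [hc]; linarith
      exact this ⟨ht.1, h⟩ ⟨ht₀.1.le, le_rfl⟩ h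
    · have : MonotoneOn f (Icc t₀ π) := by
        have sub : Ioo t₀ π ⊆ Ioo 0 π := Ioo_subset_Ioo_left ht₀.1.le
        refine monotoneOn_of_deriv_nonneg (convex_Icc _ _) hfc.continuousOn
          (fun x hx => ?_) fun x hx => ?_
        · rw [interior_Icc] at hx
          exact (hd x (sub hx)).differentiableAt.differentiableWithinAt
        · rw [interior_Icc] at hx
          rw [(hd x (sub hx)).deriv]
          refine mul_nonneg (hsin x (sub hx)) ?_
          have := monotoneOn_mul_arcMoment_rpow ht₀ ⟨(sub hx).1, hx.2.le⟩ hx.1.le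
          simp only at this
          rw [hc]; linarith
      exact this ⟨le_rfl, ht₀.2⟩ ⟨h, ht.2⟩ h
  simp only [hf, sub_self, mul_zero, sub_zero, hc] at hmin
  linarith

/-- The bathtub principle: among densities with given mass, the total length is minimized by
filling the short arcs. -/
theorem bathtub {W : ℝ → ℝ} (hW : Measurable W) (h0 : ∀ x, 0 ≤ W x) (h1 : ∀ x, W x ≤ 1)
    {t : ℝ} (ht : t ∈ Icc 0 π) :
    arcMoment t + t * ((∫ x in (0 : ℝ)..π, W x * sin x) - (1 - cos t))
      ≤ ∫ x in (0 : ℝ)..π, W x * (x * sin x) := by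
  have hWi (a b : ℝ) : IntervalIntegrable W volume a b :=
    intervalIntegrable_of_bdd hW (C := 1) (fun x => by rw [abs_of_nonneg (h0 x)]; exact h1 x) _ _
  have i1 (a b : ℝ) : IntervalIntegrable (fun x => W x * (x * sin x)) volume a b :=
    (hWi a b).mul_continuousOn (by fun_prop)
  have i2 (a b : ℝ) : IntervalIntegrable (fun x => W x * sin x) volume a b :=
    (hWi a b).mul_continuousOn (by fun_prop)
  have i3 (a b : ℝ) : IntervalIntegrable (fun x => W x * ((x - t) * sin x)) volume a b :=
    (hWi a b).mul_continuousOn (by fun_prop)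
  -- The mass constraint enters with multiplier t: the weight (x - t) sin x is nonpositive on [0, t]
  -- and nonnegative on [t, π], so W = 1 before t and W = 0 after t minimize its integral.
  have e1 : ∫ x in (0 : ℝ)..π, W x * ((x - t) * sin x)
      = (∫ x in (0 : ℝ)..π, W x * (x * sin x)) - t * ∫ x in (0 : ℝ)..π, W x * sin x := by
    rw [← intervalIntegral.integral_const_mul,
      ← intervalIntegral.integral_sub (i1 _ _) ((i2 _ _).const_mul _)]
    congr 1; ext x; ring
  have e2 : ∫ x in (0 : ℝ)..t, (x - t) * sin x = arcMoment t - t * (1 - cos t) := by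
    have : ∫ x in (0 : ℝ)..t, sin x = 1 - cos t := by simp
    rw [← integral_mul_sin, ← this, ← intervalIntegral.integral_const_mul,
      ← intervalIntegral.integral_sub (Continuous.intervalIntegrable (by fun_prop) _ _)
        (Continuous.intervalIntegrable (by fun_prop) _ _)]
    congr 1; ext x; ring
  have e3 : ∫ x in (0 : ℝ)..t, (x - t) * sin x ≤ ∫ x in (0 : ℝ)..t, W x * ((x - t) * sin x) := by
    refine intervalIntegral.integral_mono_on ht.1
      (Continuous.intervalIntegrable (by fun_prop) _ _) (i3 _ _) fun x hx => ?_
    have hs := sin_nonneg_of_mem_Icc (show x ∈ Icc 0 π from ⟨hx.1, hx.2.trans ht.2⟩)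
    have : 0 ≤ (1 - W x) * ((t - x) * sin x) :=
      mul_nonneg (by linarith [h1 x]) (mul_nonneg (by linarith [hx.2]) hs)
    linarith
  have e4 : 0 ≤ ∫ x in t..π, W x * ((x - t) * sin x) :=
    intervalIntegral.integral_nonneg ht.2 fun x hx =>
      mul_nonneg (h0 x) (mul_nonneg (by linarith [hx.1])
        (sin_nonneg_of_mem_Icc ⟨ht.1.trans hx.1, hx.2⟩))
  rw [← intervalIntegral.integral_add_adjacent_intervals (i3 0 t) (i3 t π)] at e1
  linarith

/-- The bathtub bound is applied at the angle whose cap has the mass of W itself, where its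
correction term vanishes; convexity then passes to the tangent line at t₀. Since t₀ does not depend
on W, the bound can be integrated over directions with different W. -/
theorem arcMoment_le_integral {W : ℝ → ℝ} (hW : Measurable W) (h0 : ∀ x, 0 ≤ W x)
    (h1 : ∀ x, W x ≤ 1) {t₀ : ℝ} (ht₀ : t₀ ∈ Ioc 0 π) :
    arcMoment t₀ ^ (2 / 3 : ℝ) + 2 / 3 * arcMoment t₀ ^ (-(1 / 3) : ℝ) * t₀ *
        ((∫ x in (0 : ℝ)..π, W x * sin x) - (1 - cos t₀))
      ≤ (∫ x in (0 : ℝ)..π, W x * (x * sin x)) ^ (2 / 3 : ℝ) := by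
  set s := ∫ x in (0 : ℝ)..π, W x * sin x with hs
  have hWi : IntervalIntegrable W volume 0 π :=
    intervalIntegrable_of_bdd hW (C := 1) (fun x => by rw [abs_of_nonneg (h0 x)]; exact h1 x) _ _
  have hs0 : 0 ≤ s := intervalIntegral.integral_nonneg pi_pos.le fun x hx =>
    mul_nonneg (h0 x) (sin_nonneg_of_mem_Icc hx)
  have hs2 : s ≤ 2 := by
    have : ∫ x in (0 : ℝ)..π, sin x = 2 := by norm_num
    rw [hs, ← this]
    refine intervalIntegral.integral_mono_on pi_pos.le (hWi.mul_continuousOn (by fun_prop))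
      (Continuous.intervalIntegrable (by fun_prop) _ _) fun x hx => ?_
    exact mul_le_of_le_one_left (sin_nonneg_of_mem_Icc hx) (h1 x)
  have hcos : cos (arccos (1 - s)) = 1 - s := cos_arccos (by linarith) (by linarith)
  have ht : arccos (1 - s) ∈ Icc 0 π := ⟨arccos_nonneg _, arccos_le_pi _⟩
  have hb := bathtub hW h0 h1 ht
  rw [hcos, ← hs, sub_sub_cancel, sub_self, mul_zero, add_zero] at hb
  have := arcMoment_rpow_ge ht ht₀
  rw [hcos] at this
  calc _ = _ := by congr 2; ring
    _ ≤ _ := this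
    _ ≤ _ := rpow_le_rpow (arcMoment_nonneg ht) hb (by norm_num)

/-- The local form of the crossing inequality: `W u ℓ` is the density of the arcs of length `ℓ`
that pass through a given point in the direction `u`. -/
theorem zonoid_energy_ge {W : ℝ → ℝ → ℝ} (hW : Measurable (Function.uncurry W))
    (h0 : ∀ u x, 0 ≤ W u x) (h1 : ∀ u x, W u x ≤ 1) {t : ℝ} (ht : t ∈ Icc 0 π) :
    2 * π * arcMoment t ^ 2 + 4 * arcMoment t * t *
        ((∫ u in (0 : ℝ)..π, ∫ x in (0 : ℝ)..π, W u x * sin x) - π * (1 - cos t))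
      ≤ ∫ u in (0 : ℝ)..π, zonoid (fun u => ∫ x in (0 : ℝ)..π, W u x * (x * sin x)) u *
          ∫ x in (0 : ℝ)..π, W u x * (x * sin x) := by
  set G : ℝ → ℝ := fun u => ∫ x in (0 : ℝ)..π, W u x * (x * sin x) with hG
  set s : ℝ → ℝ := fun u => ∫ x in (0 : ℝ)..π, W u x * sin x with hs
  have meas (k : ℝ → ℝ) (hk : Measurable k) :
      Measurable fun u => ∫ x in (0 : ℝ)..π, W u x * k x := by
    simp only [intervalIntegral.integral_of_le pi_pos.le]
    have : Measurable (Function.uncurry fun u x => W u x * k x) :=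
      hW.mul (hk.comp measurable_snd)
    exact (this.stronglyMeasurable.integral_prod_right
      (ν := volume.restrict (Ioc 0 π))).measurable
  have hWi (u : ℝ) : IntervalIntegrable (W u) volume 0 π :=
    intervalIntegrable_of_bdd (hW.of_uncurry_left) (C := 1)
      (fun x => by rw [abs_of_nonneg (h0 u x)]; exact h1 u x) _ _
  have hGm : Measurable G := meas _ (by fun_prop)
  have hsm : Measurable s := meas _ (by fun_prop)
  have hG0 : ∀ u, 0 ≤ G u := fun u => intervalIntegral.integral_nonneg pi_pos.le fun x hx =>
    mul_nonneg (h0 u x) (mul_nonneg hx.1 (sin_nonneg_of_mem_Icc hx))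
  have hs0 : ∀ u, 0 ≤ s u := fun u => intervalIntegral.integral_nonneg pi_pos.le fun x hx =>
    mul_nonneg (h0 u x) (sin_nonneg_of_mem_Icc hx)
  have hGM : ∀ u, |G u| ≤ arcMoment π := fun u => by
    rw [abs_of_nonneg (hG0 u), ← integral_mul_sin]
    refine intervalIntegral.integral_mono_on pi_pos.le ((hWi u).mul_continuousOn (by fun_prop))
      (Continuous.intervalIntegrable (by fun_prop) _ _) fun x hx => ?_
    exact mul_le_of_le_one_left (mul_nonneg hx.1 (sin_nonneg_of_mem_Icc hx)) (h1 u x)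
  have hsM : ∀ u, |s u| ≤ 2 := fun u => by
    rw [abs_of_nonneg (hs0 u), show (2 : ℝ) = ∫ x in (0 : ℝ)..π, sin x by norm_num]
    refine intervalIntegral.integral_mono_on pi_pos.le ((hWi u).mul_continuousOn (by fun_prop))
      (Continuous.intervalIntegrable (by fun_prop) _ _) fun x hx => ?_
    exact mul_le_of_le_one_left (sin_nonneg_of_mem_Icc hx) (h1 u x)
  rcases ht.1.eq_or_lt with rfl | hpos
  -- At t = 0 the tangent slope, a negative power of `arcMoment t`, is not available, but there only
  -- nonnegativity of the energy is claimed.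
  · simp only [arcMoment_zero]
    norm_num
    exact intervalIntegral.integral_nonneg pi_pos.le fun u _ => mul_nonneg
      (intervalIntegral.integral_nonneg pi_pos.le fun v _ => mul_nonneg (abs_nonneg _) (hG0 v))
      (hG0 u)
  have hls := reverse_hls hGm hG0 hGM
  set A := ∫ u in (0 : ℝ)..π, G u ^ (2 / 3 : ℝ) with hA
  have hS := arcMoment_pos hpos ht.2
  set R := arcMoment t ^ (2 / 3 : ℝ) with hR
  set κ := 2 / 3 * arcMoment t ^ (-(1 / 3) : ℝ) * t with hκ
  have hpw : ∀ u, R + κ * (s u - (1 - cos t)) ≤ G u ^ (2 / 3 : ℝ) := fun u =>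
    arcMoment_le_integral hW.of_uncurry_left (h0 u) (h1 u) ⟨hpos, ht.2⟩
  have hsi : IntervalIntegrable s volume 0 π := intervalIntegrable_of_bdd hsm hsM _ _
  have hA1 : π * R + κ * ((∫ u in (0 : ℝ)..π, s u) - π * (1 - cos t)) ≤ A := by
    have hi : IntervalIntegrable (fun u => κ * (s u - (1 - cos t))) volume 0 π :=
      (hsi.sub intervalIntegrable_const).const_mul _
    have : ∫ u in (0 : ℝ)..π, (R + κ * (s u - (1 - cos t)))
        = π * R + κ * ((∫ u in (0 : ℝ)..π, s u) - π * (1 - cos t)) := by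
      rw [intervalIntegral.integral_add intervalIntegrable_const hi,
        intervalIntegral.integral_const_mul,
        intervalIntegral.integral_sub hsi intervalIntegrable_const]
      simp only [intervalIntegral.integral_const, smul_eq_mul, sub_zero]
    rw [← this]
    refine intervalIntegral.integral_mono_on pi_pos.le (intervalIntegrable_const.add hi)
      ?_ fun u _ => hpw u
    refine intervalIntegrable_of_bdd (C := arcMoment π ^ (2 / 3 : ℝ)) (by fun_prop)
      (fun v => ?_) 0 π
    rw [abs_of_nonneg (rpow_nonneg (hG0 v) _)]
    exact rpow_le_rpow (hG0 v) ((le_abs_self _).trans (hGM v)) (by norm_num)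
  have hA0 : 0 ≤ A :=
    intervalIntegral.integral_nonneg pi_pos.le fun v _ => rpow_nonneg (hG0 v) _
  have hR0 : 0 < R := rpow_pos_of_pos hS _
  have hR3 : R ^ 3 = arcMoment t ^ 2 := by
    rw [hR, ← rpow_natCast, ← rpow_mul hS.le, ← rpow_natCast]; norm_num
  -- The fractional powers disappear once the slope κ is multiplied by the derivative of the cube at
  -- R.
  have hRκ : 3 * R ^ 2 * κ = 2 * arcMoment t * t := by
    have : R ^ 2 * arcMoment t ^ (-(1 / 3) : ℝ) = arcMoment t := by
      rw [hR, ← rpow_natCast, ← rpow_mul hS.le, ← rpow_add hS]; norm_num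
    calc 3 * R ^ 2 * κ = 2 * (R ^ 2 * arcMoment t ^ (-(1 / 3) : ℝ)) * t := by rw [hκ]; ring
      _ = _ := by rw [this]
  have hp := pi_pos
  -- The tangent line of the cube at π R, valid for A ≥ 0: the difference of the sides factors as (A
  -- - πR)² (A + 2πR). It keeps the estimate affine in the mass.
  have cube : (π * R) ^ 3 + 3 * (π * R) ^ 2 * (A - π * R) ≤ A ^ 3 := by
    have : 0 ≤ (A - π * R) ^ 2 * (A + 2 * (π * R)) := by positivity
    linarith
  set X := (∫ u in (0 : ℝ)..π, s u) - π * (1 - cos t) with hX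
  have h5 : 3 * (π * R) ^ 2 * (κ * X) ≤ 3 * (π * R) ^ 2 * (A - π * R) := by
    gcongr; linarith
  have h6 : π ^ 3 * arcMoment t ^ 2 + π ^ 2 * (2 * arcMoment t * t) * X ≤ A ^ 3 := by
    rw [← hR3, ← hRκ]; linarith
  refine le_of_mul_le_mul_left ?_ (show (0 : ℝ) < π ^ 2 / 2 by positivity)
  refine le_trans (le_of_eq ?_) (h6.trans hls)
  ring

/-! ### The rotation group, its Haar measure and its action on the sphere -/

open Matrix
open scoped Pointwise

/-- The rotation group of `ℝ³`. -/
abbrev SO3 : Type := Matrix.specialOrthogonalGroup (Fin 3) ℝ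

/-- Second countability makes the Borel structure on products with `SO3` the product structure, so
that continuous maps on such products are measurable. -/
instance : SecondCountableTopology SO3 :=
  inferInstanceAs (SecondCountableTopology {g : Fin 3 → Fin 3 → ℝ //
    g ∈ (Matrix.specialOrthogonalGroup (Fin 3) ℝ : Set (Matrix (Fin 3) (Fin 3) ℝ))})

theorem SO3.mul_transpose (g : SO3) : g.1 * g.1ᵀ = 1 := by
  have := (mem_specialOrthogonalGroup_iff.1 g.2).1
  rwa [mem_orthogonalGroup_iff] at this

theorem SO3.transpose_mul (g : SO3) : g.1ᵀ * g.1 = 1 := by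
  have := (mem_specialOrthogonalGroup_iff.1 g.2).1
  rwa [mem_orthogonalGroup_iff'] at this

theorem SO3.det_eq_one (g : SO3) : g.1.det = 1 := (mem_specialOrthogonalGroup_iff.1 g.2).2

theorem SO3.coe_inv (g : SO3) : (g⁻¹).1 = g.1ᵀ := rfl

theorem SO3.coe_mul (g h : SO3) : (g * h).1 = g.1 * h.1 := rfl

instance : IsTopologicalGroup SO3 where
  continuous_inv := by
    refine Continuous.subtype_mk ?_ _
    exact continuous_subtype_val.matrix_transpose

theorem SO3.abs_apply_le (g : SO3) (i j : Fin 3) : |g.1 i j| ≤ 1 := by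
  have h := congrFun (congrFun g.mul_transpose i) i
  rw [Matrix.mul_apply, Matrix.one_apply_eq] at h
  simp only [Matrix.transpose_apply, ← sq] at h
  rw [← sq_le_one_iff_abs_le_one, ← h]
  exact Finset.single_le_sum (f := fun k => g.1 i k ^ 2) (fun k _ => sq_nonneg _) (Finset.mem_univ j)

instance : CompactSpace SO3 := by
  refine isCompact_iff_compactSpace.1 ?_
  have hK : IsCompact (Set.pi univ fun _ => Set.pi univ fun _ => Icc (-1) 1 :
      Set (Matrix (Fin 3) (Fin 3) ℝ)) :=
    isCompact_univ_pi fun _ => isCompact_univ_pi fun _ => isCompact_Icc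
  refine hK.of_isClosed_subset ?_ fun g hg i _ j _ => abs_le.1 (SO3.abs_apply_le ⟨g, hg⟩ i j)
  have : (Matrix.specialOrthogonalGroup (Fin 3) ℝ : Set (Matrix (Fin 3) (Fin 3) ℝ))
      = {g | g * gᵀ = 1} ∩ {g | g.det = 1} := by
    ext g
    rw [SetLike.mem_coe, mem_specialOrthogonalGroup_iff, mem_orthogonalGroup_iff]
    rfl
  rw [this]
  exact (isClosed_eq (continuous_id.matrix_mul continuous_id.matrix_transpose)
    continuous_const).inter (isClosed_eq continuous_id.matrix_det continuous_const)

instance : MeasurableSpace SO3 := borel SO3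
instance : BorelSpace SO3 := ⟨rfl⟩

/-- The normalized Haar measure of the rotation group. -/
noncomputable def haarSO3 : Measure SO3 := Measure.haarMeasure ⊤

instance : Measure.IsHaarMeasure haarSO3 := Measure.isHaarMeasure_haarMeasure _

instance : IsProbabilityMeasure haarSO3 := ⟨by
  have := Measure.haarMeasure_self (K₀ := (⊤ : TopologicalSpace.PositiveCompacts SO3))
  rwa [TopologicalSpace.PositiveCompacts.coe_top] at this⟩

/-- A right translate of the Haar probability is again a left Haar probability, hence equal to it by
uniqueness. -/
instance : Measure.IsMulRightInvariant haarSO3 := ⟨fun g => by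
  have : IsProbabilityMeasure (Measure.map (fun x => x * g) haarSO3) :=
    Measure.isProbabilityMeasure_map (by fun_prop)
  have : Measure.IsHaarMeasure (Measure.map (fun x => x * g) haarSO3) :=
    Measure.isHaarMeasure_map_mul_right _ g
  exact Measure.isHaarMeasure_eq_of_isProbabilityMeasure _ _⟩

/-- The action of rotations on vectors. -/
def rotVec (g : SO3) (v : EuclideanSpace ℝ (Fin 3)) : EuclideanSpace ℝ (Fin 3) :=
  WithLp.toLp 2 (g.1 *ᵥ v.ofLp)

theorem rotVec_mul (g h : SO3) (v : EuclideanSpace ℝ (Fin 3)) :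
    rotVec (g * h) v = rotVec g (rotVec h v) := by
  simp [rotVec, Matrix.mulVec_mulVec]

theorem rotVec_one (v : EuclideanSpace ℝ (Fin 3)) : rotVec 1 v = v := by
  simp [rotVec]

theorem inner_rotVec (g : SO3) (v w : EuclideanSpace ℝ (Fin 3)) :
    inner ℝ (rotVec g v) (rotVec g w) = inner ℝ v w := by
  simp only [EuclideanSpace.inner_eq_star_dotProduct, rotVec, star_trivial]
  rw [Matrix.dotProduct_mulVec, Matrix.vecMul_mulVec, SO3.transpose_mul, Matrix.vecMul_one]

theorem norm_rotVec (g : SO3) (v : EuclideanSpace ℝ (Fin 3)) : ‖rotVec g v‖ = ‖v‖ := by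
  rw [norm_eq_sqrt_real_inner, inner_rotVec, ← norm_eq_sqrt_real_inner]

/-- Rotations as linear isometries. -/
noncomputable def rotIsometry (g : SO3) :
    EuclideanSpace ℝ (Fin 3) ≃ₗᵢ[ℝ] EuclideanSpace ℝ (Fin 3) where
  toFun := rotVec g
  invFun := rotVec g⁻¹
  left_inv v := by rw [← rotVec_mul, inv_mul_cancel, rotVec_one]
  right_inv v := by rw [← rotVec_mul, mul_inv_cancel, rotVec_one]
  map_add' v w := by simp [rotVec, Matrix.mulVec_add]
  map_smul' c v := by simp [rotVec, Matrix.mulVec_smul]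
  norm_map' := norm_rotVec g

/-- The action of rotations on the sphere. -/
def rot (g : SO3) (x : S2) : S2 :=
  ⟨rotVec g x.1, by rw [mem_sphere_zero_iff_norm, norm_rotVec]; exact norm_eq_of_mem_sphere x⟩

theorem rot_mul (g h : SO3) (x : S2) : rot (g * h) x = rot g (rot h x) :=
  Subtype.ext (rotVec_mul g h x.1)

theorem rot_one (x : S2) : rot 1 x = x := Subtype.ext (rotVec_one x.1)

theorem continuous_rot : Continuous fun p : SO3 × S2 => rot p.1 p.2 := by
  refine Continuous.subtype_mk ?_ _
  unfold rotVec
  refine (PiLp.continuous_toLp 2 _).comp (Continuous.matrix_mulVec (by fun_prop) ?_)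
  exact (PiLp.continuous_ofLp 2 _).comp (by fun_prop)

theorem measurable_rot : Measurable fun p : SO3 × S2 => rot p.1 p.2 :=
  continuous_rot.measurable

/-- The area of a set is, up to a constant, the volume of the cone over it, and a rotation carries
cones to cones and preserves volume. -/
theorem measurePreserving_rot (g : SO3) : MeasurePreserving (rot g) unif unif := by
  have hm : Measurable (rot g) := by
    have := measurable_rot
    fun_prop
  refine MeasurePreserving.smul_measure ⟨hm, ?_⟩ _
  refine Measure.ext fun s hs => ?_
  have key : Ioo (0 : ℝ) 1 • (Subtype.val '' (rot g ⁻¹' s) : Set (EuclideanSpace ℝ (Fin 3)))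
      = (rotIsometry g).toMeasurableEquiv ⁻¹' (Ioo (0 : ℝ) 1 • (Subtype.val '' s)) := by
    ext v
    simp only [mem_preimage, Set.mem_smul, Set.mem_image]
    constructor
    · rintro ⟨r, hr, _, ⟨x, hx, rfl⟩, rfl⟩
      exact ⟨r, hr, _, ⟨rot g x, hx, rfl⟩, ((rotIsometry g).map_smul r x.1).symm⟩
    · rintro ⟨r, hr, _, ⟨x, hx, rfl⟩, h⟩
      refine ⟨r, hr, _, ⟨rot g⁻¹ x, ?_, rfl⟩, (rotIsometry g).injective ?_⟩
      · rwa [← rot_mul, mul_inv_cancel, rot_one]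
      · rw [(rotIsometry g).map_smul]
        refine Eq.trans ?_ h
        congr 1
        change rotVec g (rotVec g⁻¹ x.1) = x.1
        rw [← rotVec_mul, mul_inv_cancel, rotVec_one]
  rw [Measure.map_apply hm hs, area, Measure.toSphere_apply' _ (hm hs),
    Measure.toSphere_apply' _ hs, key]
  congr 1
  exact (rotIsometry g).measurePreserving.measure_preimage_equiv
    (f := (rotIsometry g).toMeasurableEquiv) _

/-- The rotation by `a` about the third axis. -/
noncomputable def R3 (a : ℝ) : SO3 :=
  ⟨!![cos a, -sin a, 0; sin a, cos a, 0; 0, 0, 1], by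
    rw [mem_specialOrthogonalGroup_iff, mem_orthogonalGroup_iff]
    constructor
    · ext i j
      have := sin_sq_add_cos_sq a
      fin_cases i <;> fin_cases j <;>
        simp [Matrix.mul_apply, Fin.sum_univ_three] <;> linarith
    · rw [Matrix.det_fin_three]
      have := sin_sq_add_cos_sq a
      simp
      linarith⟩

/-- The rotation by `α` about the first axis. -/
noncomputable def R1 (α : ℝ) : SO3 :=
  ⟨!![1, 0, 0; 0, cos α, -sin α; 0, sin α, cos α], by
    rw [mem_specialOrthogonalGroup_iff, mem_orthogonalGroup_iff]
    constructor
    · ext i j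
      have := sin_sq_add_cos_sq α
      fin_cases i <;> fin_cases j <;>
        simp [Matrix.mul_apply, Fin.sum_univ_three] <;> linarith
    · rw [Matrix.det_fin_three]
      have := sin_sq_add_cos_sq α
      simp
      linarith⟩

theorem R3_add (a b : ℝ) : R3 (a + b) = R3 a * R3 b := by
  apply Subtype.ext
  simp only [SO3.coe_mul, R3, cos_add, sin_add]
  ext i j
  fin_cases i <;> fin_cases j <;> simp [Matrix.mul_apply, Fin.sum_univ_three] <;> ring

theorem R1_add (a b : ℝ) : R1 (a + b) = R1 a * R1 b := by
  apply Subtype.ext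
  simp only [SO3.coe_mul, R1, cos_add, sin_add]
  ext i j
  fin_cases i <;> fin_cases j <;> simp [Matrix.mul_apply, Fin.sum_univ_three] <;> ring

/-- A half turn about the third axis reverses the first axis. In the crossing integral this
identifies the crossings at a point with those at its antipode. -/
theorem R1_mul_R3_pi (α : ℝ) : R1 α * R3 π = R3 π * R1 (-α) := by
  apply Subtype.ext
  simp only [SO3.coe_mul, R1, R3]
  ext i j
  fin_cases i <;> fin_cases j <;> simp [Matrix.mul_apply, Fin.sum_univ_three]

theorem R3_add_two_pi (a : ℝ) : R3 (a + 2 * π) = R3 a := by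
  apply Subtype.ext
  simp [R3]

/-- The unit speed parametrization of the equator. -/
noncomputable def equator (s : ℝ) : S2 :=
  ⟨!₂[cos s, sin s, 0], by simp [EuclideanSpace.norm_eq, Fin.sum_univ_three]⟩

theorem rot_R3_equator (a s : ℝ) : rot (R3 a) (equator s) = equator (a + s) := by
  apply Subtype.ext
  ext i
  fin_cases i <;>
    simp [rot, rotVec, equator, R3, cos_add, sin_add] <;> ring

theorem rot_R1_pi_equator (s : ℝ) : rot (R1 π) (equator s) = equator (-s) := by
  apply Subtype.ext
  ext i
  fin_cases i <;>
    simp [rot, rotVec, equator, R1]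

theorem rot_R1_equator_zero (α : ℝ) : rot (R1 α) (equator 0) = equator 0 := by
  apply Subtype.ext
  ext i
  fin_cases i <;>
    simp [rot, rotVec, equator, R1]

/-! ### The law of the distance of two random points -/

/-- The law of the length of a random arc. -/
noncomputable def arcLaw : Measure ℝ :=
  (volume.restrict (Ioo 0 π)).withDensity fun θ => ENNReal.ofReal (sin θ / 2)

theorem measurePreserving_splitCoord (i : Fin 3) :
    MeasurePreserving (fun v : EuclideanSpace ℝ (Fin 3) =>
      (v i, (v (i.succAbove 0), v (i.succAbove 1)))) volume volume := by
  have h1 := PiLp.volume_preserving_ofLp (Fin 3)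
  have h2 := volume_preserving_piFinSuccAbove (fun _ : Fin 3 => ℝ) i
  have h3 := (MeasurePreserving.id (volume : Measure ℝ)).prod (volume_preserving_finTwoArrow ℝ)
  exact h3.comp (h2.comp h1)

/-- Polar coordinates in the planes orthogonal to an axis. -/
theorem volume_axial (i : Fin 3) {C : Set (ℝ × ℝ)} (hC : MeasurableSet C) :
    volume {v : EuclideanSpace ℝ (Fin 3) |
      (v i, √(v (i.succAbove 0) ^ 2 + v (i.succAbove 1) ^ 2)) ∈ C}
      = ENNReal.ofReal (2 * π) *
        ∫⁻ q : ℝ × ℝ, ENNReal.ofReal q.2 * C.indicator 1 q := by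
  have hm : Measurable fun q : ℝ × (ℝ × ℝ) => (q.1, √(q.2.1 ^ 2 + q.2.2 ^ 2)) := by fun_prop
  have h1 := (measurePreserving_splitCoord i).measure_preimage (hm hC).nullMeasurableSet
  refine h1.trans ?_
  have hmi : Measurable fun q : ℝ × ℝ => ENNReal.ofReal q.2 * C.indicator 1 q :=
    (by fun_prop : Measurable fun q : ℝ × ℝ => ENNReal.ofReal q.2).mul
      (measurable_one.indicator hC)
  have hC' : Measurable (C.indicator (1 : ℝ × ℝ → ENNReal)) := measurable_one.indicator hC
  rw [← lintegral_indicator_one (hm hC), Measure.volume_eq_prod,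
    lintegral_prod _ (measurable_one.indicator (hm hC)).aemeasurable, Measure.volume_eq_prod,
    lintegral_prod _ hmi.aemeasurable, ← lintegral_const_mul _ (by fun_prop)]
  congr 1
  ext z
  rw [← Measure.volume_eq_prod, ← lintegral_comp_polarCoord_symm]
  have : ∀ p ∈ polarCoord.target, ENNReal.ofReal p.1 •
      ((fun q : ℝ × (ℝ × ℝ) => (q.1, √(q.2.1 ^ 2 + q.2.2 ^ 2))) ⁻¹' C).indicator
        (1 : ℝ × (ℝ × ℝ) → ENNReal) (z, polarCoord.symm p)
      = (fun ρ => ENNReal.ofReal ρ * C.indicator 1 (z, ρ)) p.1 := by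
    intro p hp
    have hp1 : 0 < p.1 := hp.1
    have e : √((p.1 * cos p.2) ^ 2 + (p.1 * sin p.2) ^ 2) = p.1 := by
      rw [show (p.1 * cos p.2) ^ 2 + (p.1 * sin p.2) ^ 2
        = p.1 ^ 2 * (sin p.2 ^ 2 + cos p.2 ^ 2) by ring, sin_sq_add_cos_sq, mul_one,
        sqrt_sq hp1.le]
    have hmem : (z, polarCoord.symm p) ∈
        ((fun q : ℝ × (ℝ × ℝ) => (q.1, √(q.2.1 ^ 2 + q.2.2 ^ 2))) ⁻¹' C) ↔ (z, p.1) ∈ C := by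
      rw [mem_preimage, polarCoord_symm_apply]
      simp only [e]
    simp only [smul_eq_mul]
    by_cases h : (z, p.1) ∈ C
    · rw [indicator_of_mem h, indicator_of_mem (hmem.2 h)]; rfl
    · rw [indicator_of_notMem h, indicator_of_notMem (mt hmem.1 h)]
  rw [setLIntegral_congr_fun polarCoord.open_target.measurableSet this, polarCoord_target,
    Measure.volume_eq_prod, ← Measure.prod_restrict,
    lintegral_prod _ (by fun_prop)]
  simp only [lintegral_const, Measure.restrict_apply_univ, Real.volume_Ioo]
  rw [lintegral_mul_const _ (by fun_prop), mul_comm, sub_neg_eq_add, ← two_mul]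
  congr 1
  rw [← lintegral_indicator measurableSet_Ioi]
  congr 1
  ext ρ
  by_cases h : ρ ∈ Ioi 0
  · rw [indicator_of_mem h]
  · rw [indicator_of_notMem h, ENNReal.ofReal_of_nonpos (not_lt.1 fun h' => h h'), zero_mul]

/-- Archimedes' theorem: the projection of the uniform measure to an axis. -/
theorem map_coord_unif (i : Fin 3) :
    Measure.map (fun x : S2 => x.1 i) unif = Measure.map cos arcLaw := by
  have hm : Measurable fun x : S2 => x.1 i := by fun_prop
  refine Measure.ext fun (B : Set ℝ) hB => ?_
  rw [Measure.map_apply hm hB, Measure.map_apply measurable_cos hB, unif, Measure.smul_apply, area,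
    Measure.toSphere_apply' _ (hm hB)]
  -- The cone over the set of points with i-th coordinate in B, described by the height along the
  -- axis and the distance from it.
  set C : Set (ℝ × ℝ) := {q | (0 < q.1 ^ 2 + q.2 ^ 2 ∧ q.1 ^ 2 + q.2 ^ 2 < 1) ∧
    q.1 / √(q.1 ^ 2 + q.2 ^ 2) ∈ B} with hCdef
  have hC : MeasurableSet C := by
    have m1 : Measurable fun q : ℝ × ℝ => q.1 ^ 2 + q.2 ^ 2 := by fun_prop
    have m2 : Measurable fun q : ℝ × ℝ => q.1 / √(q.1 ^ 2 + q.2 ^ 2) := by fun_prop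
    exact ((measurableSet_lt measurable_const m1).inter
      (measurableSet_lt m1 measurable_const)).inter (m2 hB)
  have hset : Ioo (0 : ℝ) 1 • (Subtype.val '' ((fun x : S2 => x.1 i) ⁻¹' B) : Set (EuclideanSpace ℝ (Fin 3)))
      = {v : EuclideanSpace ℝ (Fin 3) |
        (v i, √(v (i.succAbove 0) ^ 2 + v (i.succAbove 1) ^ 2)) ∈ C} := by
    ext v
    have hn : v i ^ 2 + √(v (i.succAbove 0) ^ 2 + v (i.succAbove 1) ^ 2) ^ 2 = ‖v‖ ^ 2 := by
      rw [sq_sqrt (by positivity), EuclideanSpace.real_norm_sq_eq, Fin.sum_univ_succAbove _ i,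
        Fin.sum_univ_two]
    simp only [hCdef, mem_ofPred_eq, hn, sqrt_sq (norm_nonneg v), Set.mem_smul, Set.mem_image,
      mem_preimage]
    constructor
    · rintro ⟨r, hr, _, ⟨x, hx, rfl⟩, rfl⟩
      have : ‖r • x.1‖ = r := by
        rw [norm_smul, norm_eq_of_mem_sphere x, mul_one, Real.norm_eq_abs, abs_of_pos hr.1]
      rw [this]
      refine ⟨⟨by have := hr.1; positivity, by have := hr.1; have := hr.2; nlinarith⟩, ?_⟩
      have := hr.1.ne'
      simpa [this] using hx
    · rintro ⟨⟨h0, h1⟩, hB⟩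
      have h0' : 0 < ‖v‖ := by
        rcases (norm_nonneg v).eq_or_lt with h | h
        · rw [← h] at h0; norm_num at h0
        · exact h
      refine ⟨‖v‖, ⟨h0', by nlinarith⟩, ‖v‖⁻¹ • v, ⟨⟨‖v‖⁻¹ • v, ?_⟩, ?_, rfl⟩, ?_⟩
      · rw [mem_sphere_zero_iff_norm, norm_smul, norm_inv, norm_norm, inv_mul_cancel₀ h0'.ne']
      · simpa [div_eq_inv_mul] using hB
      · rw [smul_smul, mul_inv_cancel₀ h0'.ne', one_smul]
  have hmi : Measurable fun q : ℝ × ℝ => ENNReal.ofReal q.2 * C.indicator 1 q :=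
    (by fun_prop : Measurable fun q : ℝ × ℝ => ENNReal.ofReal q.2).mul
      (measurable_one.indicator hC)
  -- Polar coordinates in the plane of height and axial radius. The weight `ENNReal.ofReal q.2` is
  -- zero for negative radius, so only polar angles in (0, π) contribute; the radial integral of r²
  -- on (0,1) cancels the dimension factor 3.
  rw [hset, volume_axial i hC, ← lintegral_comp_polarCoord_symm]
  have hpt : ∀ p ∈ polarCoord.target, ENNReal.ofReal p.1 •
      (ENNReal.ofReal (polarCoord.symm p).2 * C.indicator 1 (polarCoord.symm p))
      = ((Ioo (0 : ℝ) 1).indicator (fun r => ENNReal.ofReal (r ^ 2)) p.1) *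
        (ENNReal.ofReal (sin p.2) * (cos ⁻¹' B).indicator 1 p.2) := by
    intro p hp
    have hp1 : 0 < p.1 := hp.1
    have e : (p.1 * cos p.2) ^ 2 + (p.1 * sin p.2) ^ 2 = p.1 ^ 2 := by
      rw [show (p.1 * cos p.2) ^ 2 + (p.1 * sin p.2) ^ 2
        = p.1 ^ 2 * (sin p.2 ^ 2 + cos p.2 ^ 2) by ring, sin_sq_add_cos_sq, mul_one]
    have hmem : (p.1 * cos p.2, p.1 * sin p.2) ∈ C ↔ p.1 ∈ Ioo 0 1 ∧ cos p.2 ∈ B := by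
      simp only [hCdef, mem_ofPred_eq, e, sqrt_sq hp1.le, mul_div_cancel_left₀ _ hp1.ne', mem_Ioo]
      have : p.1 ^ 2 < 1 ↔ p.1 < 1 := by
        rw [sq_lt_one_iff_abs_lt_one, abs_of_pos hp1]
      rw [this]
      simp [hp1]
    rw [polarCoord_symm_apply, smul_eq_mul, ENNReal.ofReal_mul hp1.le]
    by_cases h1 : p.1 ∈ Ioo 0 1
    · by_cases h2 : p.2 ∈ cos ⁻¹' B
      · rw [indicator_of_mem (hmem.2 ⟨h1, h2⟩), indicator_of_mem h1, indicator_of_mem h2, sq,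
          ENNReal.ofReal_mul hp1.le]
        simp only [Pi.one_apply]
        ring
      · rw [indicator_of_notMem fun h => h2 (hmem.1 h).2, indicator_of_notMem h2]
        simp
    · rw [indicator_of_notMem fun h => h1 (hmem.1 h).1, indicator_of_notMem h1]
      simp
  have hBm : Measurable ((cos ⁻¹' B).indicator (1 : ℝ → ENNReal)) :=
    measurable_one.indicator (measurable_cos hB)
  have hrm : Measurable ((Ioo (0 : ℝ) 1).indicator (fun r => ENNReal.ofReal (r ^ 2))) :=
    (by fun_prop : Measurable fun r : ℝ => ENNReal.ofReal (r ^ 2)).indicator measurableSet_Ioo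
  have hgm : Measurable fun θ => ENNReal.ofReal (sin θ) * (cos ⁻¹' B).indicator 1 θ := by fun_prop
  rw [setLIntegral_congr_fun polarCoord.open_target.measurableSet hpt, polarCoord_target,
    Measure.volume_eq_prod, ← Measure.prod_restrict,
    lintegral_prod_mul hrm.aemeasurable hgm.aemeasurable]
  have hr : ∫⁻ r in Ioi (0 : ℝ), (Ioo (0 : ℝ) 1).indicator (fun r => ENNReal.ofReal (r ^ 2)) r
      = ENNReal.ofReal (1 / 3) := by
    rw [← lintegral_indicator measurableSet_Ioi, indicator_indicator,
      inter_eq_self_of_subset_right Ioo_subset_Ioi_self, lintegral_indicator measurableSet_Ioo,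
      restrict_Ioo_eq_restrict_Ioc,
      ← ofReal_integral_eq_lintegral_ofReal, ← intervalIntegral.integral_of_le zero_le_one]
    · norm_num
    · rw [← IntegrableOn, ← intervalIntegrable_iff_integrableOn_Ioc_of_le zero_le_one]
      exact Continuous.intervalIntegrable (by fun_prop) _ _
    · exact Filter.Eventually.of_forall fun r => sq_nonneg r
  have hθ : ∫⁻ θ in Ioo (-π) π, ENNReal.ofReal (sin θ) * (cos ⁻¹' B).indicator 1 θ
      = 2 * arcLaw (cos ⁻¹' B) := by
    have hsub : Ioo 0 π ⊆ Ioo (-π) π := Ioo_subset_Ioo_left (by linarith [pi_pos])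
    rw [arcLaw, withDensity_apply _ (measurable_cos hB), ← lintegral_const_mul _ (by fun_prop),
      ← lintegral_indicator (measurable_cos hB), ← lintegral_indicator measurableSet_Ioo,
      ← lintegral_indicator measurableSet_Ioo]
    congr 1
    ext θ
    by_cases h : θ ∈ Ioo 0 π
    · rw [indicator_of_mem h, indicator_of_mem (hsub h)]
      by_cases h2 : θ ∈ cos ⁻¹' B
      · rw [indicator_of_mem h2, indicator_of_mem h2, Pi.one_apply, mul_one,
          ← ENNReal.ofReal_ofNat 2, ← ENNReal.ofReal_mul zero_le_two]
        congr 1; ring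
      · rw [indicator_of_notMem h2, indicator_of_notMem h2, mul_zero]
    · rw [indicator_of_notMem h]
      by_cases h2 : θ ∈ Ioo (-π) π
      · have : θ ≤ 0 := by
          by_contra h3
          exact h ⟨not_le.1 h3, h2.2⟩
        rw [indicator_of_mem h2, ENNReal.ofReal_of_nonpos
          (sin_nonpos_of_nonpos_of_neg_pi_le this h2.1.le), zero_mul]
      · rw [indicator_of_notMem h2]
  rw [hr, hθ, finrank_euclideanSpace_fin, smul_eq_mul]
  have hp := pi_pos
  rw [show ((3 : ℕ) : ENNReal) = ENNReal.ofReal 3 by norm_num, ← ENNReal.ofReal_inv_of_pos (by positivity),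
    ← ENNReal.ofReal_ofNat 2, ← mul_assoc, ← mul_assoc, ← mul_assoc, ← mul_assoc,
    ← ENNReal.ofReal_mul (by positivity), ← ENNReal.ofReal_mul (by positivity),
    ← ENNReal.ofReal_mul (by positivity), ← ENNReal.ofReal_mul (by positivity)]
  have : (4 * π)⁻¹ * 3 * (2 * π) * (1 / 3) * 2 = 1 := by field_simp; norm_num
  rw [this, ENNReal.ofReal_one, one_mul]

/-! ### Euler angles and random frames -/

@[fun_prop]
theorem continuous_R3 : Continuous R3 := by
  refine Continuous.subtype_mk ?_ _
  refine continuous_matrix fun i j => ?_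
  fin_cases i <;> fin_cases j <;> simp <;> fun_prop

@[fun_prop]
theorem continuous_R1 : Continuous R1 := by
  refine Continuous.subtype_mk ?_ _
  refine continuous_matrix fun i j => ?_
  fin_cases i <;> fin_cases j <;> simp <;> fun_prop

@[fun_prop]
theorem continuous_equator : Continuous equator := by
  refine Continuous.subtype_mk ?_ _
  refine (PiLp.continuous_toLp 2 _).comp (continuous_pi fun i => ?_)
  fin_cases i <;> simp <;> fun_prop

@[fun_prop]
theorem measurable_R3 : Measurable R3 := continuous_R3.measurable

@[fun_prop]
theorem measurable_R1 : Measurable R1 := continuous_R1.measurable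

@[fun_prop]
theorem measurable_equator : Measurable equator := continuous_equator.measurable

@[fun_prop]
theorem Measurable.rot {X : Type*} [MeasurableSpace X] {f : X → SO3} {u : X → S2}
    (hf : Measurable f) (hu : Measurable u) : Measurable fun x => rot (f x) (u x) :=
  measurable_rot.comp (hf.prodMk hu)

theorem exists_polar {x y z : ℝ} (h : x ^ 2 + y ^ 2 + z ^ 2 = 1) :
    ∃ β, y = sin (arccos x) * cos β ∧ z = sin (arccos x) * sin β := by
  refine ⟨Complex.arg ⟨y, z⟩, ?_⟩
  have hn : sin (arccos x) = ‖(⟨y, z⟩ : ℂ)‖ := by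
    rw [sin_arccos, Complex.norm_def, Complex.normSq_mk]
    congr 1; linarith
  rw [hn, Complex.norm_mul_cos_arg, Complex.norm_mul_sin_arg]
  exact ⟨rfl, rfl⟩

theorem S2.sum_sq (x : S2) : x.1 0 ^ 2 + x.1 1 ^ 2 + x.1 2 ^ 2 = 1 := by
  have h := norm_eq_of_mem_sphere x
  have h2 := EuclideanSpace.real_norm_sq_eq x.1
  rw [h, Fin.sum_univ_three] at h2
  linarith

theorem S2.coord_mem_Icc (x : S2) (i : Fin 3) : x.1 i ∈ Icc (-1) 1 := by
  have h := S2.sum_sq x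
  rw [mem_Icc, ← abs_le, ← sq_le_one_iff_abs_le_one]
  fin_cases i <;> simp only [Fin.zero_eta, Fin.mk_one, Fin.reduceFinMk] <;> nlinarith [sq_nonneg (x.1 0), sq_nonneg (x.1 1), sq_nonneg (x.1 2)]

theorem exists_rot_R1_equator (y : S2) :
    ∃ β, rot (R1 β) (equator (arccos (y.1 0))) = y := by
  obtain ⟨β, h1, h2⟩ := exists_polar (S2.sum_sq y)
  have h0 := S2.coord_mem_Icc y 0
  refine ⟨β, Subtype.ext ?_⟩
  ext i
  fin_cases i
  · simp [rot, rotVec, equator, R1, cos_arccos h0.1 h0.2]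
  · simp [rot, rotVec, equator, R1]
    rw [h1, mul_comm]
  · simp [rot, rotVec, equator, R1]
    rw [h2, mul_comm]

theorem exists_rot_equator_zero (y : S2) : ∃ g, rot g (equator 0) = y := by
  obtain ⟨β, h⟩ := exists_rot_R1_equator y
  refine ⟨R1 β * R3 (arccos (y.1 0)), ?_⟩
  rw [rot_mul, rot_R3_equator, add_zero, h]

theorem SO3.row_mul_row (h : SO3) (i j : Fin 3) :
    h.1 i 0 * h.1 j 0 + h.1 i 1 * h.1 j 1 + h.1 i 2 * h.1 j 2 = if i = j then 1 else 0 := by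
  have := congrFun (congrFun h.mul_transpose i) j
  rwa [Matrix.mul_apply, Fin.sum_univ_three, Matrix.one_apply] at this

theorem SO3.col_mul_col (h : SO3) (i j : Fin 3) :
    h.1 0 i * h.1 0 j + h.1 1 i * h.1 1 j + h.1 2 i * h.1 2 j = if i = j then 1 else 0 := by
  have := congrFun (congrFun h.transpose_mul i) j
  rwa [Matrix.mul_apply, Fin.sum_univ_three, Matrix.one_apply] at this

/-- The last column forces the last row. For the remaining 2×2 block, unit columns and determinant 1
make (h₁₁ - h₀₀)² + (h₀₁ + h₁₀)² equal to 2 - 2 = 0, so it is a plane rotation. -/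
theorem SO3.exists_eq_R3 (h : SO3) (h02 : h.1 0 2 = 0) (h12 : h.1 1 2 = 0) (h22 : h.1 2 2 = 1) :
    ∃ b, h = R3 b := by
  have hr := h.row_mul_row 2 2
  simp only [if_true, h22] at hr
  have h20 : h.1 2 0 = 0 :=
    mul_self_eq_zero.1 (by linarith [mul_self_nonneg (h.1 2 0), mul_self_nonneg (h.1 2 1)])
  have h21 : h.1 2 1 = 0 :=
    mul_self_eq_zero.1 (by linarith [mul_self_nonneg (h.1 2 0), mul_self_nonneg (h.1 2 1)])
  have hc0 := h.col_mul_col 0 0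
  have hc1 := h.col_mul_col 1 1
  simp only [if_true, h20, h21] at hc0 hc1
  have hdet := h.det_eq_one
  rw [Matrix.det_fin_three] at hdet
  simp only [h02, h12, h22, h20, h21] at hdet
  have hsq : (h.1 1 1 - h.1 0 0) ^ 2 + (h.1 0 1 + h.1 1 0) ^ 2 = 0 := by linarith
  have e1 : h.1 1 1 = h.1 0 0 := by
    have : (h.1 1 1 - h.1 0 0) ^ 2 = 0 :=
      le_antisymm (by linarith [sq_nonneg (h.1 0 1 + h.1 1 0)]) (sq_nonneg _)
    linarith [pow_eq_zero_iff two_ne_zero |>.1 this]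
  have e2 : h.1 0 1 = -h.1 1 0 := by
    have : (h.1 0 1 + h.1 1 0) ^ 2 = 0 :=
      le_antisymm (by linarith [sq_nonneg (h.1 1 1 - h.1 0 0)]) (sq_nonneg _)
    linarith [pow_eq_zero_iff two_ne_zero |>.1 this]
  obtain ⟨b, hb1, hb2⟩ := exists_polar (x := 0) (y := h.1 0 0) (z := h.1 1 0) (by linarith)
  rw [arccos_zero, sin_pi_div_two, one_mul] at hb1 hb2
  refine ⟨b, Subtype.ext ?_⟩
  have : h.1 = !![h.1 0 0, h.1 0 1, h.1 0 2; h.1 1 0, h.1 1 1, h.1 1 2;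
      h.1 2 0, h.1 2 1, h.1 2 2] := Matrix.eta_fin_three h.1
  rw [this, h02, h12, h22, h20, h21, e1, e2, hb1, hb2]
  rfl

/-- The Euler angle decomposition of rotations. -/
theorem exists_euler (g : SO3) : ∃ a b, g = R3 a * R1 (arccos (g.1 2 2)) * R3 b := by
  -- The angle a is chosen so that R3 a * R1 α has the same third column as g; the quotient then
  -- fixes the third axis and is a rotation about it.
  obtain ⟨a, ha1, ha2⟩ := exists_polar (x := g.1 2 2) (y := -g.1 1 2) (z := g.1 0 2) (by
    have := g.col_mul_col 2 2
    simp only [if_true] at this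
    linarith)
  have hcos : cos (arccos (g.1 2 2)) = g.1 2 2 := by
    have := abs_le.1 (g.abs_apply_le 2 2)
    exact cos_arccos this.1 this.2
  generalize arccos (g.1 2 2) = α at ha1 ha2 hcos ⊢
  have hm2 : ∀ k, g.1 k 2 = (R3 a * R1 α).1 k 2 := by
    intro k
    fin_cases k
    · simp [R3, R1, ha2, mul_comm]
    · simp [R3, R1]
      linarith
    · simp [R3, R1, hcos]
  have hh2 : ∀ i, ((R3 a * R1 α)⁻¹ * g).1 i 2 = if i = 2 then 1 else 0 := by
    intro i
    rw [← (R3 a * R1 α).col_mul_col i 2, SO3.coe_mul, SO3.coe_inv, Matrix.mul_apply,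
      Fin.sum_univ_three]
    simp only [hm2, Matrix.transpose_apply]
  obtain ⟨b, hb⟩ := SO3.exists_eq_R3 _ (hh2 0) (hh2 1) (hh2 2)
  exact ⟨a, b, by rw [← hb, mul_inv_cancel_left]⟩

/-- By transitivity and right invariance the left side does not depend on x. Averaging it over x and
exchanging the integrals gives the right side, since each rotation preserves the uniform measure. -/
theorem lintegral_rot (x : S2) {φ : S2 → ENNReal} (hφ : Measurable φ) :
    ∫⁻ g, φ (rot g x) ∂haarSO3 = ∫⁻ y, φ y ∂unif := by
  have hconst : ∀ y, ∫⁻ g, φ (rot g y) ∂haarSO3 = ∫⁻ g, φ (rot g (equator 0)) ∂haarSO3 := by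
    intro y
    obtain ⟨h, rfl⟩ := exists_rot_equator_zero y
    simp only [← rot_mul]
    exact lintegral_mul_right_eq_self (fun g => φ (rot g (equator 0))) h
  have h1 : ∀ g, ∫⁻ y, φ (rot g y) ∂unif = ∫⁻ y, φ y ∂unif := fun g =>
    (measurePreserving_rot g).lintegral_comp hφ
  have h2 : ∫⁻ g, ∫⁻ y, φ (rot g y) ∂unif ∂haarSO3 = ∫⁻ y, φ y ∂unif := by
    simp only [h1, lintegral_const, measure_univ, mul_one]
  rw [← h2, lintegral_lintegral_swap (by unfold Function.uncurry; fun_prop)]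
  simp only [hconst, lintegral_const, measure_univ, mul_one]

theorem lintegral_arccos_coord (i : Fin 3) {f : ℝ → ENNReal} (hf : Measurable f) :
    ∫⁻ x : S2, f (arccos (x.1 i)) ∂unif = ∫⁻ θ, f θ ∂arcLaw := by
  have hm : Measurable fun x : S2 => x.1 i := by fun_prop
  have hfa : Measurable fun z => f (arccos z) := hf.comp measurable_arccos
  rw [← lintegral_map (μ := unif) (f := fun z : ℝ => f (arccos z)) hfa hm, map_coord_unif,
    lintegral_map hfa measurable_cos]
  refine lintegral_congr_ae ?_
  have : ∀ᵐ θ ∂arcLaw, θ ∈ Ioo 0 π :=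
    (withDensity_absolutelyContinuous _ _).ae_le (ae_restrict_mem measurableSet_Ioo)
  filter_upwards [this] with θ hθ
  rw [arccos_cos hθ.1.le hθ.2.le]

instance : IsProbabilityMeasure arcLaw := ⟨by
  have := lintegral_arccos_coord 0 (f := fun _ => 1) measurable_const
  simpa using this.symm⟩

/-- A pair of independent uniform points is a randomly rotated arc of random length. -/
theorem lintegral_pair {φ : S2 × S2 → ENNReal} (hφ : Measurable φ) :
    ∫⁻ p, φ p ∂(unif.prod unif)
      = ∫⁻ l, ∫⁻ g, φ (rot g (equator 0), rot g (equator l)) ∂haarSO3 ∂arcLaw := by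
  rw [lintegral_prod _ hφ.aemeasurable,
    ← lintegral_rot (equator 0) (φ := fun x => ∫⁻ y, φ (x, y) ∂unif) hφ.lintegral_prod_right']
  have h1 : ∀ g, ∫⁻ y, φ (rot g (equator 0), y) ∂unif
      = ∫⁻ y, φ (rot g (equator 0), rot g y) ∂unif := fun g =>
    ((measurePreserving_rot g).lintegral_comp (by fun_prop)).symm
  simp only [h1]
  rw [lintegral_lintegral_swap (by unfold Function.uncurry; fun_prop)]
  -- A rotation about the first axis fixes `equator 0` and brings y onto the equator at the same
  -- distance; the Haar measure absorbs it.
  have h2 : ∀ y : S2, ∫⁻ g, φ (rot g (equator 0), rot g y) ∂haarSO3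
      = ∫⁻ g, φ (rot g (equator 0), rot g (equator (arccos (y.1 0)))) ∂haarSO3 := by
    intro y
    obtain ⟨β, hβ⟩ := exists_rot_R1_equator y
    rw [← lintegral_mul_right_eq_self
      (fun g => φ (rot g (equator 0), rot g (equator (arccos (y.1 0))))) (R1 β)]
    simp only [rot_mul, hβ, rot_R1_equator_zero]
  rw [lintegral_congr h2]
  refine lintegral_arccos_coord 0 (f := fun l =>
    ∫⁻ g, φ (rot g (equator 0), rot g (equator l)) ∂haarSO3) ?_
  exact Measurable.lintegral_prod_right' (f := fun p : ℝ × SO3 =>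
    φ (rot p.2 (equator 0), rot p.2 (equator p.1))) (by fun_prop)

theorem lintegral_Ioc_add_of_periodic {f : ℝ → ENNReal} {T : ℝ} (hT : 0 < T)
    (hf : Function.Periodic f T) (c : ℝ) :
    ∫⁻ a in Ioc 0 T, f (a + c) = ∫⁻ a in Ioc 0 T, f a := by
  have h1 : ∫⁻ a in Ioc 0 T, f (a + c) = ∫⁻ a in Ioc c (c + T), f a := by
    rw [← lintegral_indicator measurableSet_Ioc, ← lintegral_indicator measurableSet_Ioc,
      ← lintegral_add_right_eq_self (fun a => (Ioc c (c + T)).indicator f a) c]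
    congr 1
    ext a
    by_cases h : a ∈ Ioc 0 T
    · rw [indicator_of_mem h, indicator_of_mem
        (show a + c ∈ Ioc c (c + T) from ⟨by linarith [h.1], by linarith [h.2]⟩)]
    · rw [indicator_of_notMem h, indicator_of_notMem]
      exact fun h' => h ⟨by linarith [h'.1], by linarith [h'.2]⟩
  rw [h1]
  have := (isAddFundamentalDomain_Ioc hT c (volume : Measure ℝ)).setLIntegral_eq
    (isAddFundamentalDomain_Ioc hT 0 (volume : Measure ℝ)) f ?_
  · rwa [zero_add] at this
  · rintro ⟨_, n, rfl⟩ x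
    change f (n • T + x) = f x
    rw [add_comm]
    exact hf.zsmul n x

/-- The uniform measure on the angles. -/
noncomputable def circ : Measure ℝ :=
  (ENNReal.ofReal (2 * π))⁻¹ • volume.restrict (Ioc 0 (2 * π))

instance : IsProbabilityMeasure circ := ⟨by
  rw [circ, Measure.smul_apply, Measure.restrict_apply_univ, Real.volume_Ioc, sub_zero, smul_eq_mul]
  exact ENNReal.inv_mul_cancel (by simpa using pi_pos) ENNReal.ofReal_ne_top⟩

theorem lintegral_circ_add {f : ℝ → ENNReal} (hf : Function.Periodic f (2 * π)) (c : ℝ) :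
    ∫⁻ a, f (a + c) ∂circ = ∫⁻ a, f a ∂circ := by
  rw [circ, lintegral_smul_measure, lintegral_smul_measure,
    lintegral_Ioc_add_of_periodic (by positivity) hf]

/-- The Haar measure in Euler angles. -/
theorem lintegral_euler {ψ : SO3 → ENNReal} (hψ : Measurable ψ) :
    ∫⁻ g, ψ g ∂haarSO3
      = ∫⁻ α, ∫⁻ a, ∫⁻ b, ψ (R3 a * R1 α * R3 (-b)) ∂circ ∂circ ∂arcLaw := by
  -- The average of ψ over rotations about the third axis on both sides. It has the same Haar
  -- integral and is bi-invariant, so by the Euler decomposition it depends only on the height of g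
  -- e₃, which is distributed as a coordinate of a uniform point.
  set Ψ : SO3 → ENNReal := fun g => ∫⁻ a, ∫⁻ b, ψ (R3 a * g * R3 (-b)) ∂circ ∂circ with hΨ
  have hΨm : Measurable Ψ := by
    refine Measurable.lintegral_prod_right' (f := fun p : SO3 × ℝ =>
      ∫⁻ b, ψ (R3 p.2 * p.1 * R3 (-b)) ∂circ) ?_
    exact Measurable.lintegral_prod_right' (f := fun p : (SO3 × ℝ) × ℝ =>
      ψ (R3 p.1.2 * p.1.1 * R3 (-p.2))) (by fun_prop)
  have h1 : ∫⁻ g, ψ g ∂haarSO3 = ∫⁻ g, Ψ g ∂haarSO3 := by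
    have h2 : ∀ a b, ∫⁻ g, ψ (R3 a * g * R3 (-b)) ∂haarSO3 = ∫⁻ g, ψ g ∂haarSO3 := by
      intro a b
      rw [lintegral_mul_left_eq_self (fun g => ψ (g * R3 (-b))) (R3 a),
        lintegral_mul_right_eq_self]
    have h3 : ∫⁻ a, ∫⁻ b, ∫⁻ g, ψ (R3 a * g * R3 (-b)) ∂haarSO3 ∂circ ∂circ
        = ∫⁻ g, ψ g ∂haarSO3 := by
      simp only [h2, lintegral_const, measure_univ, mul_one]
    rw [← h3, hΨ]
    symm
    rw [lintegral_lintegral_swap]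
    · refine lintegral_congr fun a => ?_
      rw [lintegral_lintegral_swap]
      unfold Function.uncurry
      fun_prop
    · refine Measurable.aemeasurable ?_
      exact Measurable.lintegral_prod_right' (f := fun p : (SO3 × ℝ) × ℝ =>
        ψ (R3 p.1.2 * p.1.1 * R3 (-p.2))) (by fun_prop)
  have hinv : ∀ g c d, Ψ (R3 c * g * R3 d) = Ψ g := by
    intro g c d
    have e : ∀ a b, R3 a * (R3 c * g * R3 d) * R3 (-b) = R3 (a + c) * g * R3 (-(b + -d)) := by
      intro a b
      rw [R3_add, neg_add, neg_neg, add_comm (-b), R3_add]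
      simp only [mul_assoc]
    simp only [hΨ, e]
    have p1 : ∀ a, Function.Periodic (fun b => ψ (R3 a * g * R3 (-b))) (2 * π) := by
      intro a b
      simp only
      rw [← R3_add_two_pi (-(b + 2 * π))]
      congr 3; ring
    have p2 : Function.Periodic (fun a => ∫⁻ b, ψ (R3 a * g * R3 (-b)) ∂circ) (2 * π) := by
      intro a
      simp only [R3_add_two_pi]
    rw [← lintegral_circ_add p2 c]
    refine lintegral_congr fun a => ?_
    exact lintegral_circ_add (p1 (a + c)) (-d)
  set e3 : S2 := ⟨!₂[0, 0, 1], by simp [EuclideanSpace.norm_eq, Fin.sum_univ_three]⟩ with he3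
  have h22 : ∀ g : SO3, g.1 2 2 = (rot g e3).1 2 := by
    intro g
    simp [rot, rotVec, he3, Matrix.mulVec, dotProduct, Fin.sum_univ_three]
  have h4 : ∀ g, Ψ g = Ψ (R1 (arccos ((rot g e3).1 2))) := by
    intro g
    obtain ⟨a, b, h⟩ := exists_euler g
    rw [← h22]
    conv_lhs => rw [h]
    exact hinv _ _ _
  rw [h1, lintegral_congr h4, lintegral_rot e3 (φ := fun x => Ψ (R1 (arccos (x.1 2))))]
  · exact lintegral_arccos_coord 2 (f := fun α => Ψ (R1 α)) (by fun_prop)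
  · have : Measurable fun x : S2 => arccos (x.1 2) := measurable_arccos.comp (by fun_prop)
    fun_prop

/-! ### Crossing in terms of triple products -/

/-- The triple product of three vectors. -/
def triple (u v w : EuclideanSpace ℝ (Fin 3)) : ℝ :=
  u 0 * (v 1 * w 2 - v 2 * w 1) - u 1 * (v 0 * w 2 - v 2 * w 0) + u 2 * (v 0 * w 1 - v 1 * w 0)

theorem triple_rotVec (g : SO3) (u v w : EuclideanSpace ℝ (Fin 3)) :
    triple (rotVec g u) (rotVec g v) (rotVec g w) = triple u v w := by
  have h := g.det_eq_one
  rw [Matrix.det_fin_three] at h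
  rw [← mul_one (triple u v w), ← h]
  simp only [triple, rotVec, Matrix.mulVec, dotProduct, Fin.sum_univ_three]
  ring

theorem exists_combination_of_triple_eq_zero {u v w : EuclideanSpace ℝ (Fin 3)}
    (h : triple u v w = 0) :
    ∃ a b c : ℝ, (a ≠ 0 ∨ b ≠ 0 ∨ c ≠ 0) ∧ a • u + b • v + c • w = 0 := by
  have hdet : (Matrix.of ![u.ofLp, v.ofLp, w.ofLp]).det = 0 := by
    rw [Matrix.det_fin_three, ← h]
    simp [triple]
    ring
  obtain ⟨z, hz, hz0⟩ := Matrix.exists_vecMul_eq_zero_iff.2 hdet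
  refine ⟨z 0, z 1, z 2, ?_, ?_⟩
  · by_contra! hcon
    exact hz (by ext i; fin_cases i; exacts [hcon.1, hcon.2.1, hcon.2.2])
  · ext i
    have := congrFun hz0 i
    simp [Matrix.vecMul, dotProduct, Fin.sum_univ_three] at this
    simpa using this

/-- Both sides expand (x₁ × x₂) × (x₃ × x₄), a vector on the line common to the two planes spanned
by the arcs. -/
theorem triple_combination (x₁ x₂ x₃ x₄ : EuclideanSpace ℝ (Fin 3)) :
    triple x₁ x₂ x₄ • x₃ + (-triple x₁ x₂ x₃) • x₄
      = (-triple x₂ x₃ x₄) • x₁ + triple x₁ x₃ x₄ • x₂ := by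
  ext i
  fin_cases i <;> simp [triple] <;> ring

/-- This is the equality case of the triangle inequality for angles: z lies in the cone spanned by x
and y. For antipodal endpoints every point of the sphere is an equality case, hence the hypothesis.
-/
theorem mem_arc_iff {x y z : S2} (hxy : y ≠ -x) :
    z ∈ arc x y ↔ ∃ a b : ℝ, 0 ≤ a ∧ 0 ≤ b ∧ z.1 = a • x.1 + b • y.1 := by
  have hz : z.1 ≠ 0 := ne_zero_of_mem_unit_sphere z
  have hπ : InnerProductGeometry.angle x.1 y.1 ≠ π := by
    intro h
    obtain ⟨-, r, hr, h2⟩ := InnerProductGeometry.angle_eq_pi_iff.1 h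
    refine hxy (Subtype.ext ?_)
    have hn := norm_eq_of_mem_sphere y
    rw [h2, norm_smul, norm_eq_of_mem_sphere x, mul_one, Real.norm_eq_abs, abs_of_neg hr] at hn
    rw [h2, show r = -1 by linarith, neg_one_smul]
    rfl
  simp only [arc, sdist, mem_ofPred_eq]
  rw [eq_comm, InnerProductGeometry.angle_eq_angle_add_angle_iff hz, or_iff_right hπ,
    Submodule.mem_span_pair]
  constructor
  · rintro ⟨a, b, h⟩
    exact ⟨a, b, a.2, b.2, h.symm⟩
  · rintro ⟨a, b, ha, hb, h⟩
    exact ⟨⟨a, ha⟩, ⟨b, hb⟩, h.symm⟩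

theorem S2.eq_of_smul {x y : S2} {r : ℝ} (hr : 0 ≤ r) (h : x.1 = r • y.1) : x = y := by
  have hn := norm_eq_of_mem_sphere x
  rw [h, norm_smul, norm_eq_of_mem_sphere y, mul_one, Real.norm_eq_abs, abs_of_nonneg hr] at hn
  exact Subtype.ext (by rw [h, hn, one_smul])

theorem S2.eq_or_eq_neg_of_smul {x y : S2} {r : ℝ} (h : x.1 = r • y.1) : x = y ∨ x = -y := by
  rcases le_total 0 r with hr | hr
  · exact Or.inl (S2.eq_of_smul hr h)
  · refine Or.inr (S2.eq_of_smul (r := -r) (by linarith) ?_)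
    rw [h]
    simp

theorem pos_of_mem_arc {x y p : S2} {a b : ℝ} (ha : 0 ≤ a) (hb : 0 ≤ b)
    (h : p.1 = a • x.1 + b • y.1) (hx : p ≠ x) (hy : p ≠ y) : 0 < a ∧ 0 < b := by
  refine ⟨lt_of_le_of_ne ha fun h0 => hy ?_, lt_of_le_of_ne hb fun h0 => hx ?_⟩
  · exact S2.eq_of_smul hb (by rw [h, ← h0]; simp)
  · exact S2.eq_of_smul ha (by rw [h, ← h0]; simp)

/-- The vector q = k (x₁ × x₂) × (x₃ × x₄) has positive coefficients in both pairs of endpoints, so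
its direction lies on both arcs; the sign of k selects one of the two antipodal intersections of the
great circles. Nonvanishing triple products give uniqueness and exclude endpoints. -/
theorem crosses_of_pos {x₁ x₂ x₃ x₄ : S2} {k : ℝ}
    (ha : 0 < k * triple x₁.1 x₂.1 x₄.1) (hb : 0 < k * -triple x₁.1 x₂.1 x₃.1)
    (hc : 0 < k * -triple x₂.1 x₃.1 x₄.1) (hd : 0 < k * triple x₁.1 x₃.1 x₄.1) :
    Crosses x₁ x₂ x₃ x₄ := by
  set a := triple x₁.1 x₂.1 x₄.1 with hadef
  set b := -triple x₁.1 x₂.1 x₃.1 with hbdef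
  set c := -triple x₂.1 x₃.1 x₄.1 with hcdef
  set d := triple x₁.1 x₃.1 x₄.1 with hddef
  have hk : k ≠ 0 := by rintro rfl; simp at ha
  have ha0 : a ≠ 0 := by intro h; simp [h] at ha
  have hb0 : b ≠ 0 := by intro h; simp [h] at hb
  have hc0 : c ≠ 0 := by intro h; simp [h] at hc
  have hd0 : d ≠ 0 := by intro h; simp [h] at hd
  have h12 : x₂ ≠ -x₁ := by
    rintro rfl
    refine ha0 ?_
    simp [hadef, triple]; ring
  have h34 : x₄ ≠ -x₃ := by
    rintro rfl
    refine hd0 ?_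
    simp [hddef, triple]; ring
  set q : EuclideanSpace ℝ (Fin 3) := (k * a) • x₃.1 + (k * b) • x₄.1 with hq
  have hq' : q = (k * c) • x₁.1 + (k * d) • x₂.1 := by
    have := triple_combination x₁.1 x₂.1 x₃.1 x₄.1
    rw [hq, mul_smul, mul_smul, mul_smul, mul_smul, ← smul_add, ← smul_add]
    exact congrArg _ this
  have tq1 : triple x₁.1 q x₄.1 = k * d * a := by
    rw [hq', hadef]; simp [triple]; ring
  have hq0 : q ≠ 0 := by
    intro h
    rw [h] at tq1
    have : triple x₁.1 0 x₄.1 = 0 := by simp [triple]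
    rw [this] at tq1
    exact mul_ne_zero (mul_ne_zero hk hd0) ha0 tq1.symm
  have hn : 0 < ‖q‖ := norm_pos_iff.2 hq0
  set p : S2 := ⟨‖q‖⁻¹ • q, by
    rw [mem_sphere_zero_iff_norm, norm_smul, norm_inv, norm_norm, inv_mul_cancel₀ hn.ne']⟩ with hp
  refine ⟨h12, h34, p, ?_, ?_, ?_, ?_, ?_⟩
  · ext r
    rw [mem_inter_iff, mem_arc_iff h12, mem_arc_iff h34, mem_singleton_iff]
    constructor
    · rintro ⟨⟨s, t, hs, ht, h⟩, ⟨s', t', hs', ht', h'⟩⟩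
      have e : s' * b = t' * a := by
        have h0 : triple x₁.1 x₂.1 r.1 = 0 := by rw [h]; simp [triple]; ring
        have h1 : triple x₁.1 x₂.1 r.1 = t' * a - s' * b := by
          rw [h', hadef, hbdef]; simp [triple]; ring
        linarith
      refine S2.eq_of_smul (r := s' / (k * a) * ‖q‖) (by positivity) ?_
      rw [h', hp, smul_smul, mul_assoc, mul_inv_cancel₀ hn.ne', mul_one, hq, smul_add, smul_smul,
        smul_smul, div_mul_cancel₀ _ ha.ne']
      congr 2
      field_simp
      linarith
    · rintro rfl
      refine ⟨⟨‖q‖⁻¹ * (k * c), ‖q‖⁻¹ * (k * d), by positivity, by positivity, ?_⟩,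
        ⟨‖q‖⁻¹ * (k * a), ‖q‖⁻¹ * (k * b), by positivity, by positivity, ?_⟩⟩
      · rw [mul_smul ‖q‖⁻¹ (k * c), mul_smul ‖q‖⁻¹ (k * d), ← smul_add, ← hq']
      · rw [mul_smul ‖q‖⁻¹ (k * a), mul_smul ‖q‖⁻¹ (k * b), ← smul_add, ← hq]
  all_goals
    intro h
    have hv : q = ‖q‖ • p.1 := by rw [hp, smul_smul, mul_inv_cancel₀ hn.ne', one_smul]
    rw [h] at hv
  · have : triple x₁.1 q x₄.1 = 0 := by rw [hv]; simp [triple]; ring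
    rw [tq1] at this
    exact mul_ne_zero (mul_ne_zero hk hd0) ha0 this
  · have h1 : triple q x₂.1 x₄.1 = 0 := by rw [hv]; simp [triple]; ring
    have h2 : triple q x₂.1 x₄.1 = k * c * a := by rw [hq', hadef]; simp [triple]; ring
    exact mul_ne_zero (mul_ne_zero hk hc0) ha0 (h2.symm.trans h1)
  · have h1 : triple x₁.1 x₃.1 q = 0 := by rw [hv]; simp [triple]; ring
    have h2 : triple x₁.1 x₃.1 q = k * b * d := by rw [hq, hddef]; simp [triple]; ring
    exact mul_ne_zero (mul_ne_zero hk hb0) hd0 (h2.symm.trans h1)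
  · have h1 : triple x₁.1 q x₄.1 = 0 := by rw [hv]; simp [triple]; ring
    have h2 : triple x₁.1 q x₄.1 = k * a * d := by rw [hq, hddef]; simp [triple]; ring
    exact mul_ne_zero (mul_ne_zero hk ha0) hd0 (h2.symm.trans h1)

/-- Crossing is detected by the signs of four triple products. -/
theorem crosses_iff {x₁ x₂ x₃ x₄ : S2} :
    Crosses x₁ x₂ x₃ x₄ ↔
      (0 < triple x₁.1 x₂.1 x₄.1 ∧ triple x₁.1 x₂.1 x₃.1 < 0 ∧
        triple x₂.1 x₃.1 x₄.1 < 0 ∧ 0 < triple x₁.1 x₃.1 x₄.1) ∨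
      (triple x₁.1 x₂.1 x₄.1 < 0 ∧ 0 < triple x₁.1 x₂.1 x₃.1 ∧
        0 < triple x₂.1 x₃.1 x₄.1 ∧ triple x₁.1 x₃.1 x₄.1 < 0) := by
  constructor
  · rintro ⟨h12, h34, p, hp, hp1, hp2, hp3, hp4⟩
    have hmem : p ∈ arc x₁ x₂ ∩ arc x₃ x₄ := by rw [hp]; exact mem_singleton p
    rw [mem_inter_iff, mem_arc_iff h12, mem_arc_iff h34] at hmem
    obtain ⟨⟨s, t, hs, ht, h⟩, ⟨s', t', hs', ht', h'⟩⟩ := hmem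
    obtain ⟨hs, ht⟩ := pos_of_mem_arc hs ht h hp1 hp2
    obtain ⟨hs', ht'⟩ := pos_of_mem_arc hs' ht' h' hp3 hp4
    -- The crossing point is a positive combination of either pair. Taking triple products of its
    -- two expressions relates the four triple products by positive factors, so one sign determines
    -- the others.
    have e1 : t' * triple x₁.1 x₂.1 x₄.1 = -(s' * triple x₁.1 x₂.1 x₃.1) := by
      have h0 : triple x₁.1 x₂.1 p.1 = 0 := by rw [h]; simp [triple]; ring
      have h1 : triple x₁.1 x₂.1 p.1
          = s' * triple x₁.1 x₂.1 x₃.1 + t' * triple x₁.1 x₂.1 x₄.1 := by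
        rw [h']; simp [triple]; ring
      linarith
    have e2 : s * triple x₁.1 x₃.1 x₄.1 = -(t * triple x₂.1 x₃.1 x₄.1) := by
      have h0 : triple p.1 x₃.1 x₄.1 = 0 := by rw [h']; simp [triple]; ring
      have h1 : triple p.1 x₃.1 x₄.1
          = s * triple x₁.1 x₃.1 x₄.1 + t * triple x₂.1 x₃.1 x₄.1 := by
        rw [h]; simp [triple]; ring
      linarith
    have e3 : t * triple x₁.1 x₂.1 x₄.1 = s' * triple x₁.1 x₃.1 x₄.1 := by
      have h0 : triple x₁.1 p.1 x₄.1 = t * triple x₁.1 x₂.1 x₄.1 := by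
        rw [h]; simp [triple]; ring
      have h1 : triple x₁.1 p.1 x₄.1 = s' * triple x₁.1 x₃.1 x₄.1 := by
        rw [h']; simp [triple]; ring
      linarith
    rcases lt_trichotomy (triple x₁.1 x₂.1 x₄.1) 0 with hlt | h0 | hgt
    · right
      have i1 : 0 < triple x₁.1 x₂.1 x₃.1 := by
        refine pos_of_mul_pos_right (b := triple x₁.1 x₂.1 x₃.1) (a := s') ?_ hs'.le
        have := mul_neg_of_pos_of_neg ht' hlt
        linarith
      have i2 : triple x₁.1 x₃.1 x₄.1 < 0 := by
        have := mul_neg_of_pos_of_neg ht hlt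
        rw [e3] at this
        exact neg_of_mul_neg_right this hs'.le
      refine ⟨hlt, i1, ?_, i2⟩
      refine pos_of_mul_pos_right (b := triple x₂.1 x₃.1 x₄.1) (a := t) ?_ ht.le
      have := mul_neg_of_pos_of_neg hs i2
      linarith
    -- Degenerate case: the endpoints lie on one great circle. Moving p slightly towards x₃ stays in
    -- both arcs, which contradicts uniqueness of the common point.
    · exfalso
      have h123 : triple x₁.1 x₂.1 x₃.1 = 0 := by
        rw [h0, mul_zero] at e1
        have : s' * triple x₁.1 x₂.1 x₃.1 = 0 := by linarith
        exact (mul_eq_zero.1 this).resolve_left hs'.ne'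
      have hne : x₂ ≠ x₁ := by
        rintro rfl
        exact hp1 (S2.eq_of_smul (r := s + t) (by linarith) (by rw [h, add_smul]))
      obtain ⟨α, β, γ, hnz, hlin⟩ := exists_combination_of_triple_eq_zero h123
      have hγ : γ ≠ 0 := by
        rintro rfl
        rw [zero_smul, add_zero] at hlin
        by_cases hβ : β = 0
        · rw [hβ, zero_smul, add_zero, smul_eq_zero] at hlin
          have := hlin.resolve_right (ne_zero_of_mem_unit_sphere x₁)
          simp [this, hβ] at hnz
        · have : x₂.1 = (-(β⁻¹ * α)) • x₁.1 := by
            have h1 : β • x₂.1 = -(α • x₁.1) := by rw [eq_neg_iff_add_eq_zero, add_comm]; exact hlin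
            rw [← inv_smul_smul₀ hβ x₂.1, h1, smul_neg, smul_smul, neg_smul]
          rcases S2.eq_or_eq_neg_of_smul this with h | h
          · exact hne h
          · exact h12 h
      obtain ⟨l, m, hlm⟩ : ∃ l m : ℝ, x₃.1 = l • x₁.1 + m • x₂.1 := by
        refine ⟨-(γ⁻¹ * α), -(γ⁻¹ * β), ?_⟩
        have h1 : γ • x₃.1 = -(α • x₁.1 + β • x₂.1) := by
          rw [eq_neg_iff_add_eq_zero, add_comm]; exact hlin
        rw [← inv_smul_smul₀ hγ x₃.1, h1, smul_neg, smul_add, smul_smul, smul_smul, neg_smul,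
          neg_smul, neg_add]
      -- Since s and t are positive, a small ε keeps both coefficients of p + ε x₃ with respect to
      -- x₁, x₂ nonnegative.
      obtain ⟨ε, hε, hε1, hε2⟩ : ∃ ε : ℝ, 0 < ε ∧ 0 ≤ s + ε * l ∧ 0 ≤ t + ε * m := by
        refine ⟨min (s / (1 + |l|)) (t / (1 + |m|)), by positivity, ?_, ?_⟩
        · have h1 : min (s / (1 + |l|)) (t / (1 + |m|)) * (1 + |l|) ≤ s := by
            rw [← le_div_iff₀ (by positivity)]; exact min_le_left _ _
          have h2 : 0 < min (s / (1 + |l|)) (t / (1 + |m|)) := by positivity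
          nlinarith [neg_abs_le l]
        · have h1 : min (s / (1 + |l|)) (t / (1 + |m|)) * (1 + |m|) ≤ t := by
            rw [← le_div_iff₀ (by positivity)]; exact min_le_right _ _
          have h2 : 0 < min (s / (1 + |l|)) (t / (1 + |m|)) := by positivity
          nlinarith [neg_abs_le m]
      have h3p : ∀ r : ℝ, x₃.1 ≠ r • p.1 := by
        intro r hr
        rcases S2.eq_or_eq_neg_of_smul hr with h3 | h3
        · exact hp3 h3.symm
        · refine hp4 (S2.eq_of_smul (r := t' / (1 + s')) (by positivity) ?_)
          have h4 : t' • x₄.1 = (1 + s') • p.1 := by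
            have : x₃.1 = -p.1 := by rw [h3]; rfl
            rw [this] at h'
            rw [add_smul, one_smul]
            nth_rewrite 1 [h']
            simp
          rw [div_eq_inv_mul, mul_smul, h4, inv_smul_smul₀ (by positivity)]
      set q := p.1 + ε • x₃.1 with hq
      have hq0 : q ≠ 0 := by
        intro h5
        refine h3p (-ε⁻¹) ?_
        rw [hq, add_comm, ← eq_neg_iff_add_eq_zero] at h5
        rw [← inv_smul_smul₀ hε.ne' x₃.1, h5, smul_neg, neg_smul]
      have hn : 0 < ‖q‖ := norm_pos_iff.2 hq0
      set r : S2 := ⟨‖q‖⁻¹ • q, by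
        rw [mem_sphere_zero_iff_norm, norm_smul, norm_inv, norm_norm, inv_mul_cancel₀ hn.ne']⟩
        with hr
      have hrmem : r ∈ arc x₁ x₂ ∩ arc x₃ x₄ := by
        rw [mem_inter_iff, mem_arc_iff h12, mem_arc_iff h34]
        refine ⟨⟨‖q‖⁻¹ * (s + ε * l), ‖q‖⁻¹ * (t + ε * m), by positivity, by positivity, ?_⟩,
          ⟨‖q‖⁻¹ * (s' + ε), ‖q‖⁻¹ * t', by positivity, by positivity, ?_⟩⟩
        · rw [hr]
          simp only
          rw [mul_smul, mul_smul, ← smul_add, hq, h, hlm]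
          congr 1
          module
        · rw [hr]
          simp only
          rw [mul_smul, mul_smul, ← smul_add, hq, h']
          congr 1
          module
      rw [hp, mem_singleton_iff] at hrmem
      have hqp : q = ‖q‖ • p.1 := by
        rw [← hrmem, hr, smul_smul, mul_inv_cancel₀ hn.ne', one_smul]
      refine h3p (ε⁻¹ * (‖q‖ - 1)) ?_
      have : ε • x₃.1 = (‖q‖ - 1) • p.1 := by
        rw [sub_smul, one_smul, ← hqp, hq, add_sub_cancel_left]
      rw [mul_smul, ← this, inv_smul_smul₀ hε.ne']
    · left
      have i1 : triple x₁.1 x₂.1 x₃.1 < 0 := by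
        have := mul_pos ht' hgt
        have h2 : s' * triple x₁.1 x₂.1 x₃.1 < 0 := by linarith
        exact neg_of_mul_neg_right h2 hs'.le
      have i2 : 0 < triple x₁.1 x₃.1 x₄.1 := by
        have := mul_pos ht hgt
        rw [e3] at this
        exact pos_of_mul_pos_right this hs'.le
      refine ⟨hgt, i1, ?_, i2⟩
      have := mul_pos hs i2
      have h2 : t * triple x₂.1 x₃.1 x₄.1 < 0 := by linarith
      exact neg_of_mul_neg_right h2 ht.le
  · rintro (⟨h1, h2, h3, h4⟩ | ⟨h1, h2, h3, h4⟩)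
    · exact crosses_of_pos (k := 1) (by linarith) (by linarith) (by linarith) (by linarith)
    · exact crosses_of_pos (k := -1) (by linarith) (by linarith) (by linarith) (by linarith)

theorem measurableSet_crosses :
    MeasurableSet {q : (S2 × S2) × (S2 × S2) | Crosses q.1.1 q.1.2 q.2.1 q.2.2} := by
  have hcoord (f : (S2 × S2) × (S2 × S2) → S2) (hf : Measurable f) (i : Fin 3) :
      Measurable fun q => (f q).1 i := by fun_prop
  have hm (f₁ f₂ f₃ : (S2 × S2) × (S2 × S2) → S2) (h₁ : Measurable f₁) (h₂ : Measurable f₂)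
      (h₃ : Measurable f₃) : Measurable fun q => triple (f₁ q).1 (f₂ q).1 (f₃ q).1 := by
    unfold triple
    have a := hcoord f₁ h₁
    have b := hcoord f₂ h₂
    have c := hcoord f₃ h₃
    exact (((a 0).mul (((b 1).mul (c 2)).sub ((b 2).mul (c 1)))).sub
      ((a 1).mul (((b 0).mul (c 2)).sub ((b 2).mul (c 0))))).add
      ((a 2).mul (((b 0).mul (c 1)).sub ((b 1).mul (c 0))))
  have m1 : Measurable fun q : (S2 × S2) × (S2 × S2) => q.1.1 := by fun_prop
  have m2 : Measurable fun q : (S2 × S2) × (S2 × S2) => q.1.2 := by fun_prop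
  have m3 : Measurable fun q : (S2 × S2) × (S2 × S2) => q.2.1 := by fun_prop
  have m4 : Measurable fun q : (S2 × S2) × (S2 × S2) => q.2.2 := by fun_prop
  have t124 := hm _ _ _ m1 m2 m4
  have t123 := hm _ _ _ m1 m2 m3
  have t234 := hm _ _ _ m2 m3 m4
  have t134 := hm _ _ _ m1 m3 m4
  simp only [crosses_iff]
  have z {f : (S2 × S2) × (S2 × S2) → ℝ} (hf : Measurable f) :
      MeasurableSet {q | 0 < f q} ∧ MeasurableSet {q | f q < 0} :=
    ⟨measurableSet_lt measurable_const hf, measurableSet_lt hf measurable_const⟩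
  exact ((z t124).1.inter ((z t123).2.inter ((z t234).2.inter (z t134).1))).union
    ((z t124).2.inter ((z t123).1.inter ((z t234).1.inter (z t134).2)))

/-- The two great circles meet at the point with parameter a on the first and b on the second, and
at its antipode. The two alternatives say that both arcs contain the former or both contain the
latter; the angle α and the lengths enter the triple products only through positive factors. -/
theorem crosses_euler (g : SO3) (a b : ℝ) {l l' α : ℝ} (hl : l ∈ Ioo 0 π) (hl' : l' ∈ Ioo 0 π)
    (hα : α ∈ Ioo 0 π) :
    Crosses (rot g (equator 0)) (rot g (equator l))
        (rot (g * (R3 a * R1 α * R3 (-b))) (equator 0))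
        (rot (g * (R3 a * R1 α * R3 (-b))) (equator l')) ↔
      ((0 < sin a ∧ 0 < sin (l - a)) ∧ (0 < sin b ∧ 0 < sin (l' - b))) ∨
      ((sin a < 0 ∧ sin (l - a) < 0) ∧ (sin b < 0 ∧ sin (l' - b) < 0)) := by
  have e1 (s : ℝ) : rot g (equator s) = rot (g * R3 a) (equator (s - a)) := by
    rw [rot_mul, rot_R3_equator, add_sub_cancel]
  have e2 (s : ℝ) : rot (g * (R3 a * R1 α * R3 (-b))) (equator s)
      = rot (g * R3 a) (rot (R1 α) (equator (s - b))) := by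
    rw [sub_eq_neg_add, ← rot_R3_equator, ← rot_mul, ← rot_mul]
    simp only [mul_assoc]
  rw [e1, e1, e2, e2, crosses_iff]
  have hs := sin_pos_of_mem_Ioo hl
  have hs' := sin_pos_of_mem_Ioo hl'
  have hsα := sin_pos_of_mem_Ioo hα
  have rotcoe (x : S2) : (rot (g * R3 a) x).1 = rotVec (g * R3 a) x.1 := rfl
  simp only [rotcoe, triple_rotVec]
  have sub (x y : ℝ) : sin x = sin (x - y) * cos y + cos (x - y) * sin y := by
    rw [← sin_add, sub_add_cancel]
  have t124 : triple (equator (0 - a)).1 (equator (l - a)).1 (rot (R1 α) (equator (l' - b))).1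
      = sin l * sin α * sin (l' - b) := by
    rw [sub l a]
    simp [triple, rot, rotVec, equator, R1]
    ring
  have t123 : triple (equator (0 - a)).1 (equator (l - a)).1 (rot (R1 α) (equator (0 - b))).1
      = -(sin l * sin α * sin b) := by
    rw [sub l a]
    simp [triple, rot, rotVec, equator, R1]
    ring
  have t134 : triple (equator (0 - a)).1 (rot (R1 α) (equator (0 - b))).1
      (rot (R1 α) (equator (l' - b))).1 = sin l' * sin α * sin a := by
    rw [sub l' b]
    simp [triple, rot, rotVec, equator, R1]
    ring
  have t234 : triple (equator (l - a)).1 (rot (R1 α) (equator (0 - b))).1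
      (rot (R1 α) (equator (l' - b))).1 = -(sin l' * sin α * sin (l - a)) := by
    rw [sub l' b]
    simp [triple, rot, rotVec, equator, R1]
    ring
  have hp := mul_pos hs hsα
  have hp' := mul_pos hs' hsα
  rw [t124, t123, t134, t234]
  have hneg {c x : ℝ} (hc : 0 < c) : c * x < 0 ↔ x < 0 := by
    rw [← neg_pos, ← mul_neg, mul_pos_iff_of_pos_left hc, neg_pos]
  simp only [neg_neg_iff_pos, neg_pos, mul_pos_iff_of_pos_left hp, mul_pos_iff_of_pos_left hp',
    hneg hp, hneg hp']
  tauto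

/-! ### The crossing functional as a correlation of the flux -/

@[fun_prop]
theorem measurable_lintegral {X Y : Type*} [MeasurableSpace X] [MeasurableSpace Y]
    {ν : Measure Y} [SFinite ν] {f : X → Y → ENNReal} (hf : Measurable fun p : X × Y => f p.1 p.2) :
    Measurable fun x => ∫⁻ y, f x y ∂ν := hf.lintegral_prod_right'

theorem lintegral_swap {X Y : Type*} [MeasurableSpace X] [MeasurableSpace Y]
    {μ : Measure X} {ν : Measure Y} [SFinite μ] [SFinite ν] {f : X → Y → ENNReal}
    (hf : Measurable fun p : X × Y => f p.1 p.2) :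
    ∫⁻ x, ∫⁻ y, f x y ∂ν ∂μ = ∫⁻ y, ∫⁻ x, f x y ∂μ ∂ν :=
  lintegral_lintegral_swap hf.aemeasurable

theorem ae_arcLaw : ∀ᵐ l ∂arcLaw, l ∈ Ioo 0 π :=
  (withDensity_absolutelyContinuous _ _).ae_le (ae_restrict_mem measurableSet_Ioo)

/-- The weight of the arc of length `l` that starts at distance `a` before the base point of
the frame `g`, in the direction of `g`. -/
noncomputable def arcVal (w : S2 × S2 → ENNReal) (g : SO3) (l a : ℝ) : ENNReal :=
  w (rot g (equator (-a)), rot g (equator (l - a)))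

/-- The indicator that an arc of length `l` which starts at distance `a` before a point
contains this point. -/
noncomputable def window (l a : ℝ) : ENNReal :=
  {p : ℝ × ℝ | 0 < sin p.2 ∧ 0 < sin (p.1 - p.2)}.indicator 1 (l, a)

/-- The total weight of the arcs through the base point of the frame `g`, in the
direction of `g`. -/
noncomputable def flux (w : S2 × S2 → ENNReal) (g : SO3) : ENNReal :=
  ∫⁻ l, ∫⁻ a, window l a * arcVal w g l a ∂circ ∂arcLaw

theorem measurable_window : Measurable fun p : ℝ × ℝ => window p.1 p.2 := by
  have m1 : Measurable fun p : ℝ × ℝ => sin p.2 := by fun_prop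
  have m2 : Measurable fun p : ℝ × ℝ => sin (p.1 - p.2) := by fun_prop
  have : MeasurableSet {p : ℝ × ℝ | 0 < sin p.2 ∧ 0 < sin (p.1 - p.2)} :=
    (measurableSet_lt measurable_const m1).inter (measurableSet_lt measurable_const m2)
  exact measurable_one.indicator this

@[fun_prop]
theorem measurable_window_comp {X : Type*} [MeasurableSpace X] {l a : X → ℝ}
    (hl : Measurable l) (ha : Measurable a) : Measurable fun x => window (l x) (a x) := by
  have := measurable_window.comp (hl.prodMk ha)
  exact this

theorem measurable_arcVal {w : S2 × S2 → ENNReal} (hw : Measurable w) {X : Type*}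
    [MeasurableSpace X] {g : X → SO3} {l a : X → ℝ} (hg : Measurable g)
    (hl : Measurable l) (ha : Measurable a) : Measurable fun x => arcVal w (g x) (l x) (a x) := by
  unfold arcVal; fun_prop

theorem measurable_flux {w : S2 × S2 → ENNReal} (hw : Measurable w) : Measurable (flux w) := by
  have := @measurable_arcVal _ hw
  unfold flux
  fun_prop (disch := assumption)

theorem window_periodic (l : ℝ) : Function.Periodic (window l) (2 * π) := by
  intro a
  have h : ((l, a + 2 * π) ∈ {p : ℝ × ℝ | 0 < sin p.2 ∧ 0 < sin (p.1 - p.2)}) ↔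
      (l, a) ∈ {p : ℝ × ℝ | 0 < sin p.2 ∧ 0 < sin (p.1 - p.2)} := by
    simp only [mem_ofPred_eq, sin_add_two_pi, ← sub_sub, sin_sub_two_pi]
  unfold window
  by_cases h1 : (l, a) ∈ {p : ℝ × ℝ | 0 < sin p.2 ∧ 0 < sin (p.1 - p.2)}
  · rw [indicator_of_mem h1, indicator_of_mem (h.2 h1)]; rfl
  · rw [indicator_of_notMem h1, indicator_of_notMem (mt h.1 h1)]

theorem arcVal_mul_R3 (w : S2 × S2 → ENNReal) (g : SO3) (l a c : ℝ) :
    arcVal w (g * R3 c) l (a + c) = arcVal w g l a := by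
  unfold arcVal
  rw [rot_mul, rot_mul, rot_R3_equator, rot_R3_equator]
  congr 4 <;> ring

theorem arcVal_mul_R3' (w : S2 × S2 → ENNReal) (g : SO3) (l a : ℝ) :
    arcVal w (g * R3 (-a)) l 0 = arcVal w g l a := by
  rw [← arcVal_mul_R3 w g l a (-a), add_neg_cancel]

theorem arcVal_periodic (w : S2 × S2 → ENNReal) (g : SO3) (l : ℝ) :
    Function.Periodic (arcVal w g l) (2 * π) := by
  intro a
  have h : g = g * R3 (2 * π) := by
    have h0 : R3 0 = 1 := by
      apply Subtype.ext
      simp [R3, Matrix.one_fin_three]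
    rw [← zero_add (2 * π), R3_add_two_pi, h0, mul_one]
  conv_lhs => rw [h]
  rw [arcVal_mul_R3]

/-- Moving the frame half way around its great circle puts the base point at the antipode, which
amounts to shifting the position parameter by π. -/
theorem flux_mul_R3_pi (w : S2 × S2 → ENNReal) (g : SO3) :
    flux w (g * R3 π) = ∫⁻ l, ∫⁻ a, window l (a + π) * arcVal w g l a ∂circ ∂arcLaw := by
  refine lintegral_congr fun l => ?_
  have hp : Function.Periodic (fun a => window l a * arcVal w (g * R3 π) l a) (2 * π) := by
    intro a
    simp only [window_periodic l a, arcVal_periodic w _ l a]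
  rw [← lintegral_circ_add hp π]
  simp only [arcVal_mul_R3]

/-- The two alternatives of `crosses_euler` are disjoint by the sign of sin a, so the indicator is a
sum, and each term is a product of a condition on each arc. -/
theorem indicator_crosses_euler (g : SO3) (a b : ℝ) {l l' α : ℝ} (hl : l ∈ Ioo 0 π)
    (hl' : l' ∈ Ioo 0 π) (hα : α ∈ Ioo 0 π) :
    {q : (S2 × S2) × (S2 × S2) | Crosses q.1.1 q.1.2 q.2.1 q.2.2}.indicator
        (1 : (S2 × S2) × (S2 × S2) → ENNReal)
        ((rot g (equator 0), rot g (equator l)),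
          (rot (g * (R3 a * R1 α * R3 (-b))) (equator 0),
            rot (g * (R3 a * R1 α * R3 (-b))) (equator l')))
      = window l a * window l' b + window l (a + π) * window l' (b + π) := by
  have hc := crosses_euler g a b hl hl' hα
  have e (x y : ℝ) : window x (y + π) = {p : ℝ × ℝ | sin p.2 < 0 ∧ sin (p.1 - p.2) < 0}.indicator
      (1 : ℝ × ℝ → ENNReal) (x, y) := by
    have h : ((x, y + π) ∈ {p : ℝ × ℝ | 0 < sin p.2 ∧ 0 < sin (p.1 - p.2)}) ↔
        (x, y) ∈ {p : ℝ × ℝ | sin p.2 < 0 ∧ sin (p.1 - p.2) < 0} := by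
      simp only [mem_ofPred_eq, sin_add_pi, ← sub_sub, sin_sub_pi, neg_pos]
    unfold window
    by_cases h1 : (x, y) ∈ {p : ℝ × ℝ | sin p.2 < 0 ∧ sin (p.1 - p.2) < 0}
    · rw [indicator_of_mem h1, indicator_of_mem (h.2 h1)]; rfl
    · rw [indicator_of_notMem h1, indicator_of_notMem (mt h.1 h1)]
  rw [e, e]
  have hL : {q : (S2 × S2) × (S2 × S2) | Crosses q.1.1 q.1.2 q.2.1 q.2.2}.indicator
        (1 : (S2 × S2) × (S2 × S2) → ENNReal)
        ((rot g (equator 0), rot g (equator l)),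
          (rot (g * (R3 a * R1 α * R3 (-b))) (equator 0),
            rot (g * (R3 a * R1 α * R3 (-b))) (equator l')))
      = if ((0 < sin a ∧ 0 < sin (l - a)) ∧ (0 < sin b ∧ 0 < sin (l' - b))) ∨
          ((sin a < 0 ∧ sin (l - a) < 0) ∧ (sin b < 0 ∧ sin (l' - b) < 0)) then 1 else 0 := by
    set Q := {q : (S2 × S2) × (S2 × S2) | Crosses q.1.1 q.1.2 q.2.1 q.2.2}
    have hQ : (((rot g (equator 0), rot g (equator l)),
          (rot (g * (R3 a * R1 α * R3 (-b))) (equator 0),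
            rot (g * (R3 a * R1 α * R3 (-b))) (equator l'))) ∈ Q) ↔ _ := hc
    split_ifs with h
    · rw [indicator_of_mem (hQ.2 h)]; rfl
    · rw [indicator_of_notMem (mt hQ.1 h)]
  rw [hL]
  unfold window
  simp only [Set.indicator_apply, mem_ofPred_eq, Pi.one_apply]
  by_cases h1 : 0 < sin a
  · simp [h1, h1.not_gt, ← ite_and, and_comm, and_left_comm]
  · by_cases h2 : sin a < 0 <;> simp [h1, h2, ← ite_and, and_comm, and_left_comm]

theorem lintegral_mul_rearrange {A : SO3 → ℝ → ℝ → ENNReal}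
    (hA : Measurable fun p : SO3 × ℝ × ℝ => A p.1 p.2.1 p.2.2) :
    ∫⁻ α, ∫⁻ g, (∫⁻ l, ∫⁻ a, A g l a ∂circ ∂arcLaw) *
        (∫⁻ l, ∫⁻ b, A (g * R1 α) l b ∂circ ∂arcLaw) ∂haarSO3 ∂arcLaw
      = ∫⁻ l, ∫⁻ l', ∫⁻ α, ∫⁻ a, ∫⁻ b, ∫⁻ g, A g l a * A (g * R1 α) l' b
          ∂haarSO3 ∂circ ∂circ ∂arcLaw ∂arcLaw ∂arcLaw := by
  have hA' {X : Type} [MeasurableSpace X] {g : X → SO3} {l a : X → ℝ} (hg : Measurable g)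
      (hl : Measurable l) (ha : Measurable a) : Measurable fun x => A (g x) (l x) (a x) :=
    hA.comp (hg.prodMk (hl.prodMk ha))
  have h1 : ∀ α g, (∫⁻ l, ∫⁻ a, A g l a ∂circ ∂arcLaw) *
      (∫⁻ l, ∫⁻ b, A (g * R1 α) l b ∂circ ∂arcLaw)
      = ∫⁻ l, ∫⁻ l', ∫⁻ a, ∫⁻ b, A g l a * A (g * R1 α) l' b ∂circ ∂circ ∂arcLaw ∂arcLaw := by
    intro α g
    rw [← lintegral_mul_const _ (by fun_prop)]
    refine lintegral_congr fun l => ?_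
    rw [← lintegral_const_mul _ (by fun_prop)]
    refine lintegral_congr fun l' => ?_
    rw [← lintegral_mul_const _ (by fun_prop)]
    refine lintegral_congr fun a => ?_
    rw [← lintegral_const_mul _ (by fun_prop)]
  simp only [h1]
  rw [lintegral_congr fun α => lintegral_swap (by fun_prop), lintegral_swap (by fun_prop)]
  refine lintegral_congr fun l => ?_
  rw [lintegral_congr fun α => lintegral_swap (by fun_prop), lintegral_swap (by fun_prop)]
  refine lintegral_congr fun l' => lintegral_congr fun α => ?_
  rw [lintegral_swap (by fun_prop)]
  refine lintegral_congr fun a => ?_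
  rw [lintegral_swap (by fun_prop)]

/-- The first arc is given by a frame g, the second by g h with h in Euler angles. Moving the frame
to the crossing point by invariance leaves the angle α alone between the two arcs, and the integral
factors into fluxes. The factor 2 counts the two antipodal intersections of the great circles. -/
theorem lintegral_crossing {w : S2 × S2 → ENNReal} (hw : Measurable w) :
    ∫⁻ q, w q.1 * w q.2 *
        {q : (S2 × S2) × (S2 × S2) | Crosses q.1.1 q.1.2 q.2.1 q.2.2}.indicator 1 q
        ∂((unif.prod unif).prod (unif.prod unif))
      = 2 * ∫⁻ α, ∫⁻ g, flux w g * flux w (g * R1 α) ∂haarSO3 ∂arcLaw := by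
  set χ : (S2 × S2) × (S2 × S2) → ENNReal :=
    {q : (S2 × S2) × (S2 × S2) | Crosses q.1.1 q.1.2 q.2.1 q.2.2}.indicator 1 with hχ
  have hχm : Measurable χ := measurable_one.indicator measurableSet_crosses
  have hk {X : Type} [MeasurableSpace X] {g : X → SO3} {l a : X → ℝ} (hg : Measurable g)
      (hl : Measurable l) (ha : Measurable a) : Measurable fun x => arcVal w (g x) (l x) (a x) :=
    measurable_arcVal hw hg hl ha
  rw [lintegral_prod _ (by fun_prop), lintegral_pair (by fun_prop)]
  have h1 : ∀ l g, ∫⁻ p', w (rot g (equator 0), rot g (equator l)) * w p' *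
        χ ((rot g (equator 0), rot g (equator l)), p') ∂(unif.prod unif)
      = ∫⁻ l', ∫⁻ α, ∫⁻ a, ∫⁻ b, arcVal w g l 0 * arcVal w (g * (R3 a * R1 α * R3 (-b))) l' 0 *
          χ ((rot g (equator 0), rot g (equator l)),
            (rot (g * (R3 a * R1 α * R3 (-b))) (equator 0),
              rot (g * (R3 a * R1 α * R3 (-b))) (equator l')))
          ∂circ ∂circ ∂arcLaw ∂arcLaw := by
    intro l g
    rw [lintegral_pair (by fun_prop)]
    refine lintegral_congr fun l' => ?_
    rw [← lintegral_mul_left_eq_self _ g, lintegral_euler (by fun_prop)]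
    simp only [arcVal, neg_zero, sub_zero]
  simp only [h1]
  have h2 : ∀ l, ∫⁻ g, ∫⁻ l', ∫⁻ α, ∫⁻ a, ∫⁻ b,
        arcVal w g l 0 * arcVal w (g * (R3 a * R1 α * R3 (-b))) l' 0 *
          χ ((rot g (equator 0), rot g (equator l)),
            (rot (g * (R3 a * R1 α * R3 (-b))) (equator 0),
              rot (g * (R3 a * R1 α * R3 (-b))) (equator l')))
          ∂circ ∂circ ∂arcLaw ∂arcLaw ∂haarSO3
      = ∫⁻ l', ∫⁻ α, ∫⁻ a, ∫⁻ b, ∫⁻ g,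
        arcVal w g l 0 * arcVal w (g * (R3 a * R1 α * R3 (-b))) l' 0 *
          χ ((rot g (equator 0), rot g (equator l)),
            (rot (g * (R3 a * R1 α * R3 (-b))) (equator 0),
              rot (g * (R3 a * R1 α * R3 (-b))) (equator l')))
          ∂haarSO3 ∂circ ∂circ ∂arcLaw ∂arcLaw := by
    intro l
    rw [lintegral_swap (by fun_prop)]
    refine lintegral_congr fun l' => ?_
    rw [lintegral_swap (by fun_prop)]
    refine lintegral_congr fun α => ?_
    rw [lintegral_swap (by fun_prop)]
    refine lintegral_congr fun a => ?_
    rw [lintegral_swap (by fun_prop)]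
  simp only [h2]
  have h3 : ∀ l ∈ Ioo 0 π, ∀ l' ∈ Ioo 0 π, ∀ α ∈ Ioo 0 π, ∀ a b, ∫⁻ g,
        arcVal w g l 0 * arcVal w (g * (R3 a * R1 α * R3 (-b))) l' 0 *
          χ ((rot g (equator 0), rot g (equator l)),
            (rot (g * (R3 a * R1 α * R3 (-b))) (equator 0),
              rot (g * (R3 a * R1 α * R3 (-b))) (equator l'))) ∂haarSO3
      = (∫⁻ g, (window l a * arcVal w g l a) * (window l' b * arcVal w (g * R1 α) l' b) ∂haarSO3) +
        ∫⁻ g, (window l (a + π) * arcVal w g l a) *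
          (window l' (b + π) * arcVal w (g * R1 α) l' b) ∂haarSO3 := by
    intro l hl l' hl' α hα a b
    -- The translation by R3 (-a) makes the common point of the two great circles the base point of
    -- g.
    rw [← lintegral_add_left (by fun_prop), ← lintegral_mul_right_eq_self _ (R3 (-a))]
    refine lintegral_congr fun g => ?_
    rw [hχ, indicator_crosses_euler _ a b hl hl' hα]
    have e : g * R3 (-a) * (R3 a * R1 α * R3 (-b)) = (g * R1 α) * R3 (-b) := by
      have h0 : R3 (-a) * R3 a = 1 := by
        rw [← R3_add, neg_add_cancel]
        apply Subtype.ext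
        simp [R3, Matrix.one_fin_three]
      calc g * R3 (-a) * (R3 a * R1 α * R3 (-b))
          = g * (R3 (-a) * R3 a) * R1 α * R3 (-b) := by simp only [mul_assoc]
        _ = _ := by rw [h0, mul_one]
    rw [e, arcVal_mul_R3', arcVal_mul_R3']
    ring
  have h4 : ∫⁻ l, ∫⁻ l', ∫⁻ α, ∫⁻ a, ∫⁻ b, ∫⁻ g,
        arcVal w g l 0 * arcVal w (g * (R3 a * R1 α * R3 (-b))) l' 0 *
          χ ((rot g (equator 0), rot g (equator l)),
            (rot (g * (R3 a * R1 α * R3 (-b))) (equator 0),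
              rot (g * (R3 a * R1 α * R3 (-b))) (equator l')))
          ∂haarSO3 ∂circ ∂circ ∂arcLaw ∂arcLaw ∂arcLaw
      = (∫⁻ l, ∫⁻ l', ∫⁻ α, ∫⁻ a, ∫⁻ b, ∫⁻ g,
          (window l a * arcVal w g l a) * (window l' b * arcVal w (g * R1 α) l' b)
          ∂haarSO3 ∂circ ∂circ ∂arcLaw ∂arcLaw ∂arcLaw) +
        ∫⁻ l, ∫⁻ l', ∫⁻ α, ∫⁻ a, ∫⁻ b, ∫⁻ g,
          (window l (a + π) * arcVal w g l a) * (window l' (b + π) * arcVal w (g * R1 α) l' b)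
          ∂haarSO3 ∂circ ∂circ ∂arcLaw ∂arcLaw ∂arcLaw := by
    rw [← lintegral_add_left (by fun_prop)]
    refine lintegral_congr_ae ?_
    filter_upwards [ae_arcLaw] with l hl
    rw [← lintegral_add_left (by fun_prop)]
    refine lintegral_congr_ae ?_
    filter_upwards [ae_arcLaw] with l' hl'
    rw [← lintegral_add_left (by fun_prop)]
    refine lintegral_congr_ae ?_
    filter_upwards [ae_arcLaw] with α hα
    rw [← lintegral_add_left (by fun_prop)]
    refine lintegral_congr fun a => ?_
    rw [← lintegral_add_left (by fun_prop)]
    exact lintegral_congr fun b => h3 l hl l' hl' α hα a b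
  rw [h4, ← lintegral_mul_rearrange (A := fun g l a => window l a * arcVal w g l a) (by fun_prop),
    ← lintegral_mul_rearrange (A := fun g l a => window l (a + π) * arcVal w g l a) (by fun_prop),
    two_mul]
  simp only [← flux_mul_R3_pi]
  congr 1
  refine lintegral_congr fun α => ?_
  have hf := measurable_flux hw
  have e : ∀ g, g * R1 α * R3 π = g * R3 π * R1 (-α) := fun g => by
    rw [mul_assoc, R1_mul_R3_pi, mul_assoc]
  simp only [e]
  -- The antipodal term has angle -α after translation by R3 π; a further translation by R1 α
  -- exchanges the two factors and recovers the first term.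
  rw [lintegral_mul_right_eq_self (fun g => flux w g * flux w (g * R1 (-α))) (R3 π),
    ← lintegral_mul_right_eq_self (fun g => flux w g * flux w (g * R1 (-α))) (R1 α)]
  refine lintegral_congr fun g => ?_
  have h0 : R1 α * R1 (-α) = 1 := by
    rw [← R1_add, add_neg_cancel]
    apply Subtype.ext
    simp [R1, Matrix.one_fin_three]
  rw [mul_assoc g, h0, mul_one, mul_comm]

/-! ### The flux through arcs of each length, and the energy at a point -/

theorem window_eq_indicator {l a : ℝ} (hl : l ∈ Ioo 0 π) (ha : a ∈ Ioc 0 (2 * π)) :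
    window l a = (Ioo 0 l).indicator 1 a := by
  have h : ((l, a) ∈ {p : ℝ × ℝ | 0 < sin p.2 ∧ 0 < sin (p.1 - p.2)}) ↔ a ∈ Ioo 0 l := by
    constructor
    · rintro ⟨h1, h2⟩
      simp only at h1 h2
      have haπ : a < π := by
        by_contra! hcon
        have := sin_nonpos_of_nonpos_of_neg_pi_le (x := a - 2 * π) (by linarith [ha.2]) (by linarith)
        rw [sin_sub_two_pi] at this
        linarith
      refine ⟨ha.1, ?_⟩
      by_contra! hcon
      have := sin_nonpos_of_nonpos_of_neg_pi_le (x := l - a) (by linarith) (by linarith [hl.1])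
      linarith
    · rintro ⟨h1, h2⟩
      exact ⟨sin_pos_of_pos_of_lt_pi h1 (h2.trans hl.2),
        sin_pos_of_pos_of_lt_pi (by simp only; linarith) (by simp only; linarith [hl.2])⟩
  unfold window
  by_cases h1 : a ∈ Ioo 0 l
  · rw [indicator_of_mem h1, indicator_of_mem (h.2 h1)]; rfl
  · rw [indicator_of_notMem h1, indicator_of_notMem (mt h.1 h1)]

theorem lintegral_window_mul {f : ℝ → ENNReal} {l : ℝ} (hl : l ∈ Ioo 0 π) :
    ∫⁻ a, window l a * f a ∂circ = (ENNReal.ofReal (2 * π))⁻¹ * ∫⁻ a in Ioo 0 l, f a := by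
  have hsub : Ioo 0 l ⊆ Ioc 0 (2 * π) := fun a ha =>
    ⟨ha.1, by linarith [ha.2, hl.2, pi_pos]⟩
  rw [circ, lintegral_smul_measure, smul_eq_mul, ← lintegral_indicator measurableSet_Ioc,
    ← lintegral_indicator measurableSet_Ioo]
  congr 2
  ext a
  by_cases h1 : a ∈ Ioc 0 (2 * π)
  · rw [indicator_of_mem h1, window_eq_indicator hl h1]
    by_cases h2 : a ∈ Ioo 0 l
    · rw [indicator_of_mem h2, indicator_of_mem h2, Pi.one_apply, one_mul]
    · rw [indicator_of_notMem h2, indicator_of_notMem h2, zero_mul]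
  · rw [indicator_of_notMem h1, indicator_of_notMem fun h2 => h1 (hsub h2)]

/-- The average weight of the arcs of length `l` through the base point of the frame `g`, in the
direction of `g`. -/
noncomputable def arcMean (w : S2 × S2 → ENNReal) (g : SO3) (l : ℝ) : ENNReal :=
  (ENNReal.ofReal l)⁻¹ * ∫⁻ a in Ioo 0 l, arcVal w g l a

theorem lintegral_arcLaw {f : ℝ → ENNReal} (hf : Measurable f) :
    ∫⁻ l, f l ∂arcLaw = ∫⁻ l in Ioo 0 π, ENNReal.ofReal (sin l / 2) * f l := by
  rw [arcLaw, lintegral_withDensity_eq_lintegral_mul _ (by fun_prop) hf]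
  rfl

section

variable {w : S2 × S2 → ENNReal}

theorem measurable_lintegral_arcVal (hw : Measurable w) :
    Measurable fun p : SO3 × ℝ => ∫⁻ a in Ioo 0 p.2, arcVal w p.1 p.2 a := by
  have hk := @measurable_arcVal _ hw
  have h (p : SO3 × ℝ) : ∫⁻ a in Ioo 0 p.2, arcVal w p.1 p.2 a
      = ∫⁻ a, {q : (SO3 × ℝ) × ℝ | 0 < q.2 ∧ q.2 < q.1.2}.indicator
          (fun q => arcVal w q.1.1 q.1.2 q.2) (p, a) := by
    rw [← lintegral_indicator measurableSet_Ioo]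
    rfl
  simp only [h]
  refine Measurable.lintegral_prod_right' (f := fun q : (SO3 × ℝ) × ℝ =>
    {q : (SO3 × ℝ) × ℝ | 0 < q.2 ∧ q.2 < q.1.2}.indicator
      (fun q => arcVal w q.1.1 q.1.2 q.2) q) ?_
  refine Measurable.indicator (hk (by fun_prop) (by fun_prop) (by fun_prop)) ?_
  exact (measurableSet_lt measurable_const measurable_snd).inter
    (measurableSet_lt measurable_snd (measurable_snd.comp measurable_fst))

theorem measurable_arcMean (hw : Measurable w) {X : Type*} [MeasurableSpace X] {g : X → SO3}
    {l : X → ℝ} (hg : Measurable g) (hl : Measurable l) :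
    Measurable fun x => arcMean w (g x) (l x) := by
  have h := (measurable_lintegral_arcVal hw).comp (hg.prodMk hl)
  exact (ENNReal.measurable_ofReal.comp hl).inv.mul h

theorem arcMean_le_one (hw1 : ∀ p, w p ≤ 1) (g : SO3) (l : ℝ) : arcMean w g l ≤ 1 := by
  have h : ∫⁻ a in Ioo 0 l, arcVal w g l a ≤ ENNReal.ofReal l := by
    calc ∫⁻ a in Ioo 0 l, arcVal w g l a ≤ ∫⁻ a in Ioo 0 l, 1 := lintegral_mono fun a => hw1 _
      _ = ENNReal.ofReal l := by simp
  exact (mul_le_mul_right h _).trans (ENNReal.inv_mul_le_one _)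

/-- The window has length l, which turns the density sin l / 2 into l sin l; the constant is 1/(2π)
from `circ` times 1/2 from `arcLaw`. -/
theorem flux_eq (hw : Measurable w) (g : SO3) :
    flux w g = ENNReal.ofReal (1 / (4 * π)) *
      ∫⁻ l in Ioo 0 π, arcMean w g l * ENNReal.ofReal (l * sin l) := by
  have hk := @measurable_arcVal _ hw
  have hmean := @measurable_arcMean _ hw
  rw [flux, lintegral_arcLaw (by fun_prop), ← lintegral_const_mul _ (by fun_prop)]
  refine setLIntegral_congr_fun measurableSet_Ioo fun l hl => ?_
  have hs := sin_pos_of_mem_Ioo hl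
  have hl0 : ENNReal.ofReal l ≠ 0 := by simpa using hl.1
  rw [lintegral_window_mul hl, arcMean]
  have e : ENNReal.ofReal (1 / (4 * π)) * ((ENNReal.ofReal l)⁻¹ *
      (∫⁻ a in Ioo 0 l, arcVal w g l a) * ENNReal.ofReal (l * sin l))
      = ((ENNReal.ofReal l)⁻¹ * ENNReal.ofReal l) * (ENNReal.ofReal (1 / (4 * π)) *
        ENNReal.ofReal (sin l)) * ∫⁻ a in Ioo 0 l, arcVal w g l a := by
    rw [ENNReal.ofReal_mul hl.1.le]; ring
  rw [e, ENNReal.inv_mul_cancel hl0 ENNReal.ofReal_ne_top, one_mul, ← mul_assoc,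
    ← ENNReal.ofReal_inv_of_pos (by positivity), ← ENNReal.ofReal_mul (by positivity),
    ← ENNReal.ofReal_mul (by positivity)]
  congr 2
  field_simp
  norm_num

/-- Reversing the direction exchanges the endpoints of each arc, and this is where the symmetry of w
enters. The flux thus depends on an unoriented direction, as the inequality on the projective line
requires. -/
theorem flux_mul_R1_pi (hw : Measurable w) (hsymm : ∀ x y, w (x, y) = w (y, x)) (g : SO3) :
    flux w (g * R1 π) = flux w g := by
  rw [flux_eq hw, flux_eq hw]
  congr 2
  ext l
  congr 1
  unfold arcMean
  congr 1
  have h : ∀ a, arcVal w (g * R1 π) l a = arcVal w g l (l - a) := by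
    intro a
    unfold arcVal
    rw [rot_mul, rot_mul, rot_R1_pi_equator, rot_R1_pi_equator, hsymm]
    congr 4
    all_goals ring
  simp only [h]
  rw [← lintegral_indicator measurableSet_Ioo, ← lintegral_indicator measurableSet_Ioo,
    ← lintegral_sub_left_eq_self _ l]
  congr 1
  ext a
  by_cases h1 : a ∈ Ioo 0 l
  · rw [indicator_of_mem h1, indicator_of_mem
      (show l - a ∈ Ioo 0 l from ⟨by linarith [h1.2], by linarith [h1.1]⟩), sub_sub_cancel]
  · rw [indicator_of_notMem h1, indicator_of_notMem]
    exact fun h2 => h1 ⟨by linarith [h2.2], by linarith [h2.1]⟩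

/-- By right invariance the correlation at angle α is that of the directions u and u + α for every
u. Averaging over u in (0, π) gives the factor 1/π, and π-periodicity lets v = u + α range over (0,
π); the kernel |sin(u - v)| is 2 times the density of `arcLaw`. -/
theorem lintegral_crossing_eq_energy (hw : Measurable w) (hsymm : ∀ x y, w (x, y) = w (y, x)) :
    2 * ∫⁻ α, ∫⁻ g, flux w g * flux w (g * R1 α) ∂haarSO3 ∂arcLaw
      = (ENNReal.ofReal π)⁻¹ * ∫⁻ g, (∫⁻ u in Ioo 0 π, ∫⁻ v in Ioo 0 π,
          ENNReal.ofReal |sin (u - v)| * flux w (g * R1 v) * flux w (g * R1 u)) ∂haarSO3 := by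
  have hf := measurable_flux hw
  have h1 : ∀ g u, ∫⁻ v in Ioo 0 π, ENNReal.ofReal |sin (u - v)| * flux w (g * R1 v)
      = ∫⁻ α in Ioo 0 π, ENNReal.ofReal (sin α) * flux w (g * R1 u * R1 α) := by
    intro g u
    have hp : Function.Periodic
        (fun v => ENNReal.ofReal |sin (u - v)| * flux w (g * R1 v)) π := by
      intro v
      simp only [← sub_sub, sin_sub_pi, abs_neg, R1_add, ← mul_assoc, flux_mul_R1_pi hw hsymm]
    have := lintegral_Ioc_add_of_periodic pi_pos hp u
    rw [restrict_Ioo_eq_restrict_Ioc, ← this]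
    refine setLIntegral_congr_fun measurableSet_Ioc fun α hα => ?_
    have hs : sin (u - (α + u)) = -sin α := by rw [← sin_neg]; congr 1; ring
    simp only [hs, abs_neg]
    rw [abs_of_nonneg (sin_nonneg_of_mem_Icc ⟨hα.1.le, hα.2⟩), add_comm α u, R1_add, mul_assoc g]
  have h2 : ∀ u, ∫⁻ g, (∫⁻ v in Ioo 0 π,
        ENNReal.ofReal |sin (u - v)| * flux w (g * R1 v) * flux w (g * R1 u)) ∂haarSO3
      = ∫⁻ α in Ioo 0 π, ENNReal.ofReal (sin α) *
          ∫⁻ g, flux w g * flux w (g * R1 α) ∂haarSO3 := by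
    intro u
    have e : ∀ g, ∫⁻ v in Ioo 0 π,
        ENNReal.ofReal |sin (u - v)| * flux w (g * R1 v) * flux w (g * R1 u)
        = (fun g => (∫⁻ α in Ioo 0 π, ENNReal.ofReal (sin α) * flux w (g * R1 α)) * flux w g)
          (g * R1 u) := by
      intro g
      rw [lintegral_mul_const _ (by fun_prop), h1]
    rw [lintegral_congr e, lintegral_mul_right_eq_self (fun g =>
      (∫⁻ α in Ioo 0 π, ENNReal.ofReal (sin α) * flux w (g * R1 α)) * flux w g) (R1 u)]
    rw [lintegral_congr fun g => (lintegral_mul_const _ (by fun_prop)).symm,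
      lintegral_swap (by fun_prop)]
    refine lintegral_congr fun α => ?_
    rw [← lintegral_const_mul _ (by fun_prop)]
    refine lintegral_congr fun g => ?_
    ring
  rw [lintegral_swap (μ := haarSO3) (by fun_prop), lintegral_congr h2, lintegral_const,
    Measure.restrict_apply_univ, Real.volume_Ioo, sub_zero, mul_comm _ (ENNReal.ofReal π),
    ← mul_assoc, ENNReal.inv_mul_cancel (by simpa using pi_pos) ENNReal.ofReal_ne_top, one_mul,
    lintegral_arcLaw (by fun_prop), ← lintegral_const_mul _ (by fun_prop)]
  refine lintegral_congr fun α => ?_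
  rw [← mul_assoc, ← ENNReal.ofReal_ofNat 2, ← ENNReal.ofReal_mul zero_le_two]
  congr 2
  ring

/-- By invariance the average over frames does not see the position of the arc, so only the mean of
w at each length remains. The constant is the length π of the range of u times 2 from the density
sin l / 2. -/
theorem lintegral_arcMean (hw : Measurable w) :
    ∫⁻ g, (∫⁻ u in Ioo 0 π, ∫⁻ l in Ioo 0 π,
        arcMean w (g * R1 u) l * ENNReal.ofReal (sin l)) ∂haarSO3
      = ENNReal.ofReal (2 * π) * ∫⁻ p, w p ∂(unif.prod unif) := by
  have hk := @measurable_arcVal _ hw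
  have hmean := @measurable_arcMean _ hw
  have h0 : ∀ l ∈ Ioo 0 π, ∫⁻ g, arcMean w g l ∂haarSO3 = ∫⁻ g, arcVal w g l 0 ∂haarSO3 := by
    intro l hl
    have hl0 : ENNReal.ofReal l ≠ 0 := by simpa using hl.1
    unfold arcMean
    rw [lintegral_const_mul _ (by fun_prop), lintegral_swap (by fun_prop)]
    have : ∀ a, ∫⁻ g, arcVal w g l a ∂haarSO3 = ∫⁻ g, arcVal w g l 0 ∂haarSO3 := by
      intro a
      rw [← lintegral_mul_right_eq_self (fun g => arcVal w g l 0) (R3 (-a))]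
      simp only [arcVal_mul_R3']
    rw [lintegral_congr this, lintegral_const, Measure.restrict_apply_univ, Real.volume_Ioo,
      sub_zero, mul_comm _ (ENNReal.ofReal l), ← mul_assoc,
      ENNReal.inv_mul_cancel hl0 ENNReal.ofReal_ne_top, one_mul]
  have h1 : ∀ u, ∫⁻ g, (∫⁻ l in Ioo 0 π,
        arcMean w (g * R1 u) l * ENNReal.ofReal (sin l)) ∂haarSO3
      = 2 * ∫⁻ p, w p ∂(unif.prod unif) := by
    intro u
    rw [lintegral_mul_right_eq_self
        (fun g => ∫⁻ l in Ioo 0 π, arcMean w g l * ENNReal.ofReal (sin l)) (R1 u),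
      lintegral_swap (by fun_prop), lintegral_pair hw, lintegral_arcLaw (by fun_prop),
      ← lintegral_const_mul _ (by fun_prop)]
    refine setLIntegral_congr_fun measurableSet_Ioo fun l hl => ?_
    rw [lintegral_mul_const _ (by fun_prop), h0 l hl, mul_comm, ← mul_assoc,
      ← ENNReal.ofReal_ofNat 2, ← ENNReal.ofReal_mul zero_le_two]
    simp only [arcVal, neg_zero, sub_zero]
    congr 2
    ring
  rw [lintegral_swap (by fun_prop), lintegral_congr h1, lintegral_const,
    Measure.restrict_apply_univ, Real.volume_Ioo, sub_zero, ENNReal.ofReal_mul zero_le_two,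
    ENNReal.ofReal_ofNat]
  ring

end

/-! ### The lower bound for the crossing functional -/

/-- `zonoid_energy_ge` for extended nonnegative densities. -/
theorem lintegral_energy_ge {V : ℝ → ℝ → ENNReal} (hV : Measurable fun p : ℝ × ℝ => V p.1 p.2)
    (h1 : ∀ u l, V u l ≤ 1) {t : ℝ} (ht : t ∈ Icc 0 π) :
    2 * π * arcMoment t ^ 2 + 4 * arcMoment t * t *
        ((∫⁻ u in Ioo 0 π, ∫⁻ l in Ioo 0 π, V u l * ENNReal.ofReal (sin l)).toReal
          - π * (1 - cos t))
      ≤ (∫⁻ u in Ioo 0 π, ∫⁻ v in Ioo 0 π, ENNReal.ofReal |sin (u - v)| *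
          (∫⁻ l in Ioo 0 π, V v l * ENNReal.ofReal (l * sin l)) *
          ∫⁻ l in Ioo 0 π, V u l * ENNReal.ofReal (l * sin l)).toReal := by
  have hV' {X : Type} [MeasurableSpace X] {f g : X → ℝ} (hf : Measurable f) (hg : Measurable g) :
      Measurable fun x => V (f x) (g x) := hV.comp (hf.prodMk hg)
  have hfin : ∀ u l, V u l < ⊤ := fun u l => (h1 u l).trans_lt ENNReal.one_lt_top
  have key := zonoid_energy_ge (W := fun u l => (V u l).toReal) hV.ennreal_toReal
    (fun u l => ENNReal.toReal_nonneg) (fun u l => ENNReal.toReal_le_of_le_ofReal zero_le_one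
      (by simpa using h1 u l)) ht
  have conv (f : ℝ → ℝ) : ∫ x in (0 : ℝ)..π, f x = ∫ x in Ioo 0 π, f x := by
    rw [intervalIntegral.integral_of_le pi_pos.le, integral_Ioc_eq_integral_Ioo]
  have inner (k : ℝ → ℝ) (hk : Measurable k) (C : ℝ) (hk0 : ∀ l ∈ Ioo 0 π, 0 ≤ k l)
      (hkC : ∀ l ∈ Ioo 0 π, k l ≤ C) (u : ℝ) :
      ∫ l in (0 : ℝ)..π, (V u l).toReal * k l
        = (∫⁻ l in Ioo 0 π, V u l * ENNReal.ofReal (k l)).toReal ∧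
      ∫⁻ l in Ioo 0 π, V u l * ENNReal.ofReal (k l) ≤ ENNReal.ofReal C * ENNReal.ofReal π := by
    constructor
    · rw [conv, ← integral_toReal (by fun_prop)
        (Filter.Eventually.of_forall fun l => ENNReal.mul_lt_top (hfin u l) ENNReal.ofReal_lt_top)]
      refine setIntegral_congr_fun measurableSet_Ioo fun l hl => ?_
      simp only [ENNReal.toReal_mul, ENNReal.toReal_ofReal (hk0 l hl)]
    · calc ∫⁻ l in Ioo 0 π, V u l * ENNReal.ofReal (k l)
          ≤ ∫⁻ l in Ioo 0 π, ENNReal.ofReal C := by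
            refine setLIntegral_mono' measurableSet_Ioo fun l hl => ?_
            calc V u l * ENNReal.ofReal (k l) ≤ 1 * ENNReal.ofReal C :=
                  mul_le_mul' (h1 u l) (ENNReal.ofReal_le_ofReal (hkC l hl))
              _ = _ := one_mul _
        _ = _ := by simp
  have s := inner sin (by fun_prop) 1
    (fun l hl => (sin_pos_of_mem_Ioo hl).le) fun l _ => sin_le_one l
  have m := inner (fun l => l * sin l) (by fun_prop) π
    (fun l hl => mul_nonneg hl.1.le (sin_pos_of_mem_Ioo hl).le)
    fun l hl => by nlinarith [sin_le_one l, hl.1, hl.2, sin_pos_of_mem_Ioo hl]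
  set F : ℝ → ENNReal := fun u => ∫⁻ l in Ioo 0 π, V u l * ENNReal.ofReal (l * sin l) with hF
  have hFm : Measurable F := by fun_prop
  have hFle : ∀ u, F u ≤ ENNReal.ofReal π * ENNReal.ofReal π := fun u => (m u).2
  have hFlt : ∀ u, F u < ⊤ := fun u => (hFle u).trans_lt
    (ENNReal.mul_lt_top ENNReal.ofReal_lt_top ENNReal.ofReal_lt_top)
  have hz : ∀ u, zonoid (fun u => (F u).toReal) u
      = (∫⁻ v in Ioo 0 π, ENNReal.ofReal |sin (u - v)| * F v).toReal := by
    intro u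
    rw [zonoid, conv, ← integral_toReal (by fun_prop) (Filter.Eventually.of_forall fun v =>
      ENNReal.mul_lt_top ENNReal.ofReal_lt_top (hFlt v))]
    simp only [ENNReal.toReal_mul, ENNReal.toReal_ofReal (abs_nonneg _)]
  have hzlt : ∀ u, ∫⁻ v in Ioo 0 π, ENNReal.ofReal |sin (u - v)| * F v < ⊤ := by
    intro u
    calc ∫⁻ v in Ioo 0 π, ENNReal.ofReal |sin (u - v)| * F v
        ≤ ∫⁻ v in Ioo 0 π, 1 * (ENNReal.ofReal π * ENNReal.ofReal π) := by
          refine lintegral_mono fun v => mul_le_mul' ?_ (hFle v)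
          rw [← ENNReal.ofReal_one]
          exact ENNReal.ofReal_le_ofReal (abs_sin_le_one _)
      _ = ENNReal.ofReal π * ENNReal.ofReal π * ENNReal.ofReal π := by simp
      _ < ⊤ := ENNReal.mul_lt_top (ENNReal.mul_lt_top ENNReal.ofReal_lt_top ENNReal.ofReal_lt_top)
        ENNReal.ofReal_lt_top
  simp only [(m _).1, (s _).1] at key
  rw [conv, integral_toReal (by fun_prop) (Filter.Eventually.of_forall fun u =>
    (s u).2.trans_lt (ENNReal.mul_lt_top ENNReal.ofReal_lt_top ENNReal.ofReal_lt_top)), conv] at key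
  refine key.trans_eq ?_
  rw [lintegral_congr fun u => lintegral_mul_const _ (by fun_prop), ← integral_toReal (by fun_prop)
    (Filter.Eventually.of_forall fun u => ENNReal.mul_lt_top (hzlt u) (hFlt u))]
  refine integral_congr_ae (Filter.Eventually.of_forall fun u => ?_)
  simp only [ENNReal.toReal_mul]
  congr 1
  exact hz u

/-- A kernel as an extended nonnegative function of a pair of points. -/
noncomputable def ekernel (w : S2 → S2 → ℝ) (p : S2 × S2) : ENNReal := ENNReal.ofReal (w p.1 p.2)

section

variable {w : S2 → S2 → ℝ}

theorem IsKernel.measurable_ekernel (hw : IsKernel w) : Measurable (ekernel w) :=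
  hw.measurable.ennreal_ofReal

theorem IsKernel.ekernel_symm (hw : IsKernel w) (x y : S2) : ekernel w (x, y) = ekernel w (y, x) :=
  congrArg ENNReal.ofReal (hw.symm x y)

theorem IsKernel.ekernel_le_one (hw : IsKernel w) (p : S2 × S2) : ekernel w p ≤ 1 := by
  simpa [ekernel] using (hw.mem_Icc p.1 p.2).2

theorem IsKernel.edgeDensity_eq (hw : IsKernel w) :
    edgeDensity w = (∫⁻ p, ekernel w p ∂(unif.prod unif)).toReal := by
  rw [edgeDensity]
  have hint : Integrable (Function.uncurry w) (unif.prod unif) :=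
    Integrable.of_bound hw.measurable.aestronglyMeasurable 1 (Filter.Eventually.of_forall fun p => by
      have := hw.mem_Icc p.1 p.2
      rw [Function.uncurry, norm_of_nonneg this.1]
      exact this.2)
  refine (integral_prod (Function.uncurry w) hint).symm.trans ?_
  rw [integral_eq_lintegral_of_nonneg_ae (f := Function.uncurry w)
      (Filter.Eventually.of_forall fun p => (hw.mem_Icc p.1 p.2).1)
      hw.measurable.aestronglyMeasurable]
  rfl

theorem IsKernel.edgeDensity_mem_Icc (hw : IsKernel w) : edgeDensity w ∈ Icc (0 : ℝ) 1 := by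
  rw [hw.edgeDensity_eq]
  refine ⟨ENNReal.toReal_nonneg, ENNReal.toReal_le_of_le_ofReal zero_le_one ?_⟩
  calc ∫⁻ p, ekernel w p ∂(unif.prod unif) ≤ ∫⁻ _, 1 ∂(unif.prod unif) :=
        lintegral_mono hw.ekernel_le_one
    _ = ENNReal.ofReal 1 := by simp

theorem IsKernel.crossing_eq (hw : IsKernel w) :
    crossing w = (2 * ∫⁻ α, ∫⁻ g, flux (ekernel w) g * flux (ekernel w) (g * R1 α)
      ∂haarSO3 ∂arcLaw).toReal := by
  classical
  have hwE := hw.measurable_ekernel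
  set χ : (S2 × S2) × (S2 × S2) → ENNReal :=
    {q : (S2 × S2) × (S2 × S2) | Crosses q.1.1 q.1.2 q.2.1 q.2.2}.indicator 1 with hχ
  have hχm : Measurable χ := measurable_one.indicator measurableSet_crosses
  have hχ1 : ∀ q, χ q < ⊤ := fun q =>
    (indicator_le_self' (fun _ _ => zero_le_one) q).trans_lt ENNReal.one_lt_top
  rw [← lintegral_crossing hwE, crossing, ← hχ, ← integral_toReal
    (f := fun q => ekernel w q.1 * ekernel w q.2 * χ q) (by fun_prop)
    (Filter.Eventually.of_forall fun q => ENNReal.mul_lt_top (ENNReal.mul_lt_top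
      ENNReal.ofReal_lt_top ENNReal.ofReal_lt_top) (hχ1 q))]
  refine integral_congr_ae (Filter.Eventually.of_forall fun q => ?_)
  simp only [ENNReal.toReal_mul, ekernel, ENNReal.toReal_ofReal (hw.mem_Icc _ _).1]
  congr 1
  by_cases h : Crosses q.1.1 q.1.2 q.2.1 q.2.2
  · rw [if_pos h, hχ, indicator_of_mem (by exact h)]
    simp
  · rw [if_neg h, hχ, indicator_of_notMem (by exact h)]
    simp

/-- The constant is 1/π from the average over directions times (1/(4π))² from the two fluxes. -/
theorem IsKernel.crossing_eq_energy (hw : IsKernel w) :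
    crossing w = 1 / (16 * π ^ 3) * (∫⁻ g, (∫⁻ u in Ioo 0 π, ∫⁻ v in Ioo 0 π,
      ENNReal.ofReal |sin (u - v)| *
        (∫⁻ l in Ioo 0 π, arcMean (ekernel w) (g * R1 v) l * ENNReal.ofReal (l * sin l)) *
        ∫⁻ l in Ioo 0 π, arcMean (ekernel w) (g * R1 u) l * ENNReal.ofReal (l * sin l))
      ∂haarSO3).toReal := by
  have hwE := hw.measurable_ekernel
  have hmean := @measurable_arcMean _ hwE
  have e : ∀ (g : SO3) (u v : ℝ), ENNReal.ofReal |sin (u - v)| * flux (ekernel w) (g * R1 v) *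
      flux (ekernel w) (g * R1 u) = ENNReal.ofReal (1 / (4 * π)) ^ 2 * (ENNReal.ofReal |sin (u - v)| *
        (∫⁻ l in Ioo 0 π, arcMean (ekernel w) (g * R1 v) l * ENNReal.ofReal (l * sin l)) *
        ∫⁻ l in Ioo 0 π, arcMean (ekernel w) (g * R1 u) l * ENNReal.ofReal (l * sin l)) := by
    intro g u v
    rw [flux_eq hwE, flux_eq hwE]
    ring
  rw [hw.crossing_eq, lintegral_crossing_eq_energy hwE hw.ekernel_symm]
  simp only [e]
  have e2 : ∀ (g : SO3), ∫⁻ u in Ioo 0 π, ∫⁻ v in Ioo 0 π,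
      ENNReal.ofReal (1 / (4 * π)) ^ 2 * (ENNReal.ofReal |sin (u - v)| *
        (∫⁻ l in Ioo 0 π, arcMean (ekernel w) (g * R1 v) l * ENNReal.ofReal (l * sin l)) *
        ∫⁻ l in Ioo 0 π, arcMean (ekernel w) (g * R1 u) l * ENNReal.ofReal (l * sin l))
      = ENNReal.ofReal (1 / (4 * π)) ^ 2 * ∫⁻ u in Ioo 0 π, ∫⁻ v in Ioo 0 π,
      (ENNReal.ofReal |sin (u - v)| *
        (∫⁻ l in Ioo 0 π, arcMean (ekernel w) (g * R1 v) l * ENNReal.ofReal (l * sin l)) *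
        ∫⁻ l in Ioo 0 π, arcMean (ekernel w) (g * R1 u) l * ENNReal.ofReal (l * sin l)) := by
    intro g
    rw [← lintegral_const_mul _ (by fun_prop)]
    refine lintegral_congr fun u => ?_
    rw [← lintegral_const_mul _ (by fun_prop)]
  rw [lintegral_congr e2, lintegral_const_mul _ (by fun_prop), ENNReal.toReal_mul,
    ENNReal.toReal_mul, ← mul_assoc]
  congr 1
  rw [ENNReal.toReal_inv, ENNReal.toReal_pow, ENNReal.toReal_ofReal (by positivity),
    ENNReal.toReal_ofReal (by positivity)]
  field_simp
  norm_num

theorem setLIntegral_Ioo_le {f : ℝ → ENNReal} {C : ENNReal} (h : ∀ x ∈ Ioo 0 π, f x ≤ C) :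
    ∫⁻ x in Ioo 0 π, f x ≤ C * ENNReal.ofReal π := by
  calc ∫⁻ x in Ioo 0 π, f x ≤ ∫⁻ _ in Ioo 0 π, C := setLIntegral_mono' measurableSet_Ioo h
    _ = C * ENNReal.ofReal π := by simp

theorem integrable_toReal_of_le {X : Type*} [MeasurableSpace X] {ν : Measure X} [IsFiniteMeasure ν]
    {f : X → ENNReal} (hf : Measurable f) {C : ENNReal} (hC : C < ⊤) (h : ∀ x, f x ≤ C) :
    Integrable (fun x => (f x).toReal) ν :=
  Integrable.of_bound hf.ennreal_toReal.aestronglyMeasurable C.toReal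
    (Filter.Eventually.of_forall fun x => by
      rw [norm_of_nonneg ENNReal.toReal_nonneg]
      exact ENNReal.toReal_mono hC.ne (h x))

/-- The local inequality is used at every frame with the same global t, not with the local edge
mass. It is affine in that mass, whose mean over frames is exactly π (1 - cos t), so only the
constant 2π S(t)² survives. -/
theorem IsKernel.crossing_ge (hw : IsKernel w) {t : ℝ} (ht : t ∈ Icc 0 π)
    (hcos : cos t = 1 - 2 * edgeDensity w) : arcMoment t ^ 2 / (8 * π ^ 2) ≤ crossing w := by
  have hwE := hw.measurable_ekernel
  have hmean := @measurable_arcMean _ hwE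
  have hV1 := arcMean_le_one hw.ekernel_le_one
  set F : SO3 → ENNReal := fun g =>
    ∫⁻ l in Ioo 0 π, arcMean (ekernel w) g l * ENNReal.ofReal (l * sin l) with hF
  set S : SO3 → ENNReal := fun g => ∫⁻ u in Ioo 0 π, ∫⁻ l in Ioo 0 π,
    arcMean (ekernel w) (g * R1 u) l * ENNReal.ofReal (sin l) with hS
  set I : SO3 → ENNReal := fun g => ∫⁻ u in Ioo 0 π, ∫⁻ v in Ioo 0 π,
    ENNReal.ofReal |sin (u - v)| * F (g * R1 v) * F (g * R1 u) with hI
  have hFm : Measurable F := by fun_prop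
  have hSm : Measurable S := by fun_prop
  have hIm : Measurable I := by fun_prop
  have hsin (x : ℝ) : ENNReal.ofReal |sin x| ≤ 1 := by simpa using abs_sin_le_one x
  have hFle : ∀ g, F g ≤ ENNReal.ofReal π * ENNReal.ofReal π := fun g =>
    setLIntegral_Ioo_le fun l hl => by
      calc _ ≤ 1 * ENNReal.ofReal π := mul_le_mul' (hV1 g l) (ENNReal.ofReal_le_ofReal (by
            nlinarith [sin_le_one l, hl.1, hl.2, sin_pos_of_mem_Ioo hl]))
        _ = _ := one_mul _
  have hSle : ∀ g, S g ≤ 1 * 1 * ENNReal.ofReal π * ENNReal.ofReal π := fun g =>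
    setLIntegral_Ioo_le fun u _ => setLIntegral_Ioo_le fun l _ =>
      mul_le_mul' (hV1 _ l) (by simpa using sin_le_one l)
  have hIle : ∀ g, I g ≤ 1 * (ENNReal.ofReal π * ENNReal.ofReal π) *
      (ENNReal.ofReal π * ENNReal.ofReal π) * ENNReal.ofReal π * ENNReal.ofReal π := fun g =>
    setLIntegral_Ioo_le fun u _ => setLIntegral_Ioo_le fun v _ =>
      mul_le_mul' (mul_le_mul' (hsin _) (hFle _)) (hFle _)
  have hStop : 1 * 1 * ENNReal.ofReal π * ENNReal.ofReal π < ⊤ := by finiteness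
  have hItop : 1 * (ENNReal.ofReal π * ENNReal.ofReal π) *
      (ENNReal.ofReal π * ENNReal.ofReal π) * ENNReal.ofReal π * ENNReal.ofReal π < ⊤ := by
    finiteness
  have key : ∀ g, 2 * π * arcMoment t ^ 2 + 4 * arcMoment t * t *
      ((S g).toReal - π * (1 - cos t)) ≤ (I g).toReal := fun g =>
    lintegral_energy_ge (V := fun u l => arcMean (ekernel w) (g * R1 u) l) (by fun_prop)
      (fun u l => hV1 _ l) ht
  have hSint := integrable_toReal_of_le (ν := haarSO3) hSm hStop hSle
  have hIint := integrable_toReal_of_le (ν := haarSO3) hIm hItop hIle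
  -- The mean is 2π e(w), and 2 e(w) = 1 - cos t.
  have hSval : ∫ g, (S g).toReal ∂haarSO3 = π * (1 - cos t) := by
    rw [integral_toReal hSm.aemeasurable
      (Filter.Eventually.of_forall fun g => (hSle g).trans_lt hStop), hS, lintegral_arcMean hwE,
      ENNReal.toReal_mul, ENNReal.toReal_ofReal (by positivity), ← hw.edgeDensity_eq, hcos]
    ring
  have hdiff : Integrable (fun g => 4 * arcMoment t * t * ((S g).toReal - π * (1 - cos t)))
    haarSO3 := (hSint.sub (integrable_const _)).const_mul _
  have hmono := integral_mono (μ := haarSO3) ((integrable_const _).add hdiff) hIint key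
  simp only [Pi.add_apply] at hmono
  rw [integral_add (integrable_const _) hdiff,
    integral_const_mul (4 * arcMoment t * t), integral_sub hSint (integrable_const _), hSval, integral_const,
    integral_const, probReal_univ, one_smul, one_smul, sub_self, mul_zero, add_zero,
    integral_toReal hIm.aemeasurable
      (Filter.Eventually.of_forall fun g => (hIle g).trans_lt hItop)] at hmono
  rw [hw.crossing_eq_energy]
  calc arcMoment t ^ 2 / (8 * π ^ 2) = 1 / (16 * π ^ 3) * (2 * π * arcMoment t ^ 2) := by
        field_simp; ring
    _ ≤ _ := mul_le_mul_of_nonneg_left hmono (by positivity)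

end

/-! ### Threshold kernels -/

theorem measurable_sdist : Measurable fun p : S2 × S2 => sdist p.1 p.2 := by
  have h : ∀ p : S2 × S2, sdist p.1 p.2 = arccos (inner ℝ (p.1 : EuclideanSpace ℝ (Fin 3)) p.2) := by
    intro p
    rw [sdist, InnerProductGeometry.angle, norm_eq_of_mem_sphere, norm_eq_of_mem_sphere]
    simp
  simp only [h]
  exact (by fun_prop : Continuous fun p : S2 × S2 =>
    arccos (inner ℝ (p.1 : EuclideanSpace ℝ (Fin 3)) p.2)).measurable

theorem isKernel_threshold (t : ℝ) : IsKernel (threshold t) where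
  measurable := by
    unfold threshold Function.uncurry
    exact Measurable.ite (measurableSet_le measurable_sdist measurable_const) measurable_const
      measurable_const
  symm x y := by
    unfold threshold sdist
    rw [InnerProductGeometry.angle_comm]
  mem_Icc x y := by
    unfold threshold
    split_ifs <;> simp

theorem sdist_rot_equator (g : SO3) {a b : ℝ} (h : b - a ∈ Icc 0 π) :
    sdist (rot g (equator a)) (rot g (equator b)) = b - a := by
  have e : inner ℝ (rot g (equator a)).1 (rot g (equator b)).1 = cos (b - a) := by
    refine (inner_rotVec g _ _).trans ?_
    simp [equator, PiLp.inner_apply, Fin.sum_univ_three, cos_sub]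
  rw [sdist, InnerProductGeometry.angle, norm_eq_of_mem_sphere, norm_eq_of_mem_sphere, e, mul_one,
    div_one, arccos_cos h.1 h.2]

theorem arcVal_threshold (t : ℝ) (g : SO3) {l : ℝ} (hl : l ∈ Ioo 0 π) (a : ℝ) :
    arcVal (ekernel (threshold t)) g l a = (Iic t).indicator 1 l := by
  have h : l - a - -a = l := by ring
  have e := sdist_rot_equator g (a := -a) (b := l - a) (by rw [h]; exact Ioo_subset_Icc_self hl)
  rw [h] at e
  simp only [arcVal, ekernel, threshold, e, indicator_apply, mem_Iic, Pi.one_apply]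
  split_ifs <;> simp

theorem arcMean_threshold (t : ℝ) (g : SO3) {l : ℝ} (hl : l ∈ Ioo 0 π) :
    arcMean (ekernel (threshold t)) g l = (Iic t).indicator 1 l := by
  have hl0 : ENNReal.ofReal l ≠ 0 := by simpa using hl.1
  rw [arcMean, lintegral_congr fun a => arcVal_threshold t g hl a, lintegral_const,
    Measure.restrict_apply_univ, Real.volume_Ioo, sub_zero, mul_comm _ (ENNReal.ofReal l),
    ← mul_assoc, ENNReal.inv_mul_cancel hl0 ENNReal.ofReal_ne_top, one_mul]

theorem setLIntegral_indicator_Iic {t : ℝ} (ht : t ∈ Icc 0 π) {f : ℝ → ℝ} (hf : Continuous f)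
    (h0 : ∀ l ∈ Icc 0 π, 0 ≤ f l) :
    ∫⁻ l in Ioo 0 π, (Iic t).indicator 1 l * ENNReal.ofReal (f l)
      = ENNReal.ofReal (∫ l in (0 : ℝ)..t, f l) := by
  have e : ∀ l, (Iic t).indicator 1 l * ENNReal.ofReal (f l)
      = (Iic t).indicator (fun l => ENNReal.ofReal (f l)) l := fun l => by
    by_cases h : l ∈ Iic t <;> simp [h]
  have hset : Iic t ∩ Ioc 0 π = Ioc 0 t := by
    ext l
    exact ⟨fun h => ⟨h.2.1, h.1⟩, fun h => ⟨h.2, h.1, h.2.trans ht.2⟩⟩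
  rw [lintegral_congr e, restrict_Ioo_eq_restrict_Ioc, setLIntegral_indicator measurableSet_Iic, hset,
    intervalIntegral.integral_of_le ht.1, ofReal_integral_eq_lintegral_ofReal
      (hf.integrableOn_Ioc) ((ae_restrict_mem measurableSet_Ioc).mono fun l hl =>
        h0 l ⟨hl.1.le, hl.2.trans ht.2⟩)]

theorem edgeDensity_threshold {t : ℝ} (ht : t ∈ Icc 0 π) :
    edgeDensity (threshold t) = (1 - cos t) / 2 := by
  have hw := isKernel_threshold t
  have hwE := hw.measurable_ekernel
  rw [hw.edgeDensity_eq, lintegral_pair hwE, lintegral_arcLaw (by fun_prop)]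
  have e : ∀ l ∈ Ioo 0 π, ENNReal.ofReal (sin l / 2) * ∫⁻ g, ekernel (threshold t)
      (rot g (equator 0), rot g (equator l)) ∂haarSO3
      = (Iic t).indicator 1 l * ENNReal.ofReal (sin l / 2) := by
    intro l hl
    have e1 : ∀ g, ekernel (threshold t) (rot g (equator 0), rot g (equator l))
        = (Iic t).indicator 1 l := fun g => by
      rw [← arcVal_threshold t g hl 0, arcVal, neg_zero, sub_zero]
    rw [lintegral_congr e1, lintegral_const, measure_univ, mul_one, mul_comm]
  have hcos := cos_le_one t
  rw [setLIntegral_congr_fun measurableSet_Ioo e, setLIntegral_indicator_Iic ht (by fun_prop)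
    fun l hl => div_nonneg (sin_nonneg_of_mem_Icc hl) zero_le_two, intervalIntegral.integral_div,
    integral_sin, cos_zero, ENNReal.toReal_ofReal (by linarith)]

/-- The weight of an arc depends only on its length, so the flux is the same for all frames and the
correlation reduces to its square. -/
theorem flux_threshold {t : ℝ} (ht : t ∈ Icc 0 π) (g : SO3) :
    flux (ekernel (threshold t)) g = ENNReal.ofReal (arcMoment t / (4 * π)) := by
  rw [flux_eq (isKernel_threshold t).measurable_ekernel,
    setLIntegral_congr_fun measurableSet_Ioo
      (g := fun l => (Iic t).indicator 1 l * ENNReal.ofReal (l * sin l))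
      fun l hl => by rw [arcMean_threshold t g hl],
    setLIntegral_indicator_Iic ht (by fun_prop)
      fun l hl => mul_nonneg hl.1 (sin_nonneg_of_mem_Icc hl),
    integral_mul_sin, ← ENNReal.ofReal_mul (by positivity)]
  congr 1
  ring

theorem crossing_threshold {t : ℝ} (ht : t ∈ Icc 0 π) :
    crossing (threshold t) = arcMoment t ^ 2 / (8 * π ^ 2) := by
  have h0 : 0 ≤ arcMoment t / (4 * π) := div_nonneg (arcMoment_nonneg ht) (by positivity)
  rw [(isKernel_threshold t).crossing_eq]
  simp only [flux_threshold ht, lintegral_const, measure_univ, mul_one, ENNReal.toReal_mul,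
    ENNReal.toReal_ofReal h0, ENNReal.toReal_ofNat]
  ring

end SphericalCrossing

theorem theorem2p1 :
    (∀ w : SphericalCrossing.S2 → SphericalCrossing.S2 → ℝ, SphericalCrossing.IsKernel w →
      (∃ t ∈ Set.Icc (0 : ℝ) Real.pi, Real.cos t = 1 - 2 * SphericalCrossing.edgeDensity w) ∧
      ∀ t ∈ Set.Icc (0 : ℝ) Real.pi,
        Real.cos t = 1 - 2 * SphericalCrossing.edgeDensity w →
        SphericalCrossing.crossing w ≥
          (Real.sin t - t * Real.cos t) ^ 2 / (8 * Real.pi ^ 2)) ∧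
    (∀ t ∈ Set.Icc (0 : ℝ) Real.pi,
      SphericalCrossing.IsKernel (SphericalCrossing.threshold t) ∧
      Real.cos t = 1 - 2 * SphericalCrossing.edgeDensity (SphericalCrossing.threshold t) ∧
      SphericalCrossing.crossing (SphericalCrossing.threshold t) =
        (Real.sin t - t * Real.cos t) ^ 2 / (8 * Real.pi ^ 2)) := by
  refine ⟨fun w hw => ⟨?_, fun t ht hcos => hw.crossing_ge ht hcos⟩, fun t ht =>
    ⟨SphericalCrossing.isKernel_threshold t, ?_, SphericalCrossing.crossing_threshold ht⟩⟩
  · have he := hw.edgeDensity_mem_Icc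
    exact ⟨Real.arccos (1 - 2 * SphericalCrossing.edgeDensity w),
      ⟨Real.arccos_nonneg _, Real.arccos_le_pi _⟩,
      Real.cos_arccos (by linarith [he.2]) (by linarith [he.1])⟩
  · rw [SphericalCrossing.edgeDensity_threshold ht]
    ring
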